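/- Let $\mathcal G(\mathbb R^d)$ be the Colombeau algebra: moderate nets $(u_\varepsilon)_{\varepsilon\in(0,1]}$ of smooth complex valued functions modulo negligible nets. Let $a_{1,1},\dots,a_{1,n},a_0,f\in\mathcal G(\mathbb R_t\times\mathbb R^n_x)$, where $f$ is compactly supported with respect to $x$ (its support lies in $\mathbb R\times K$ for some compact $K\subset\mathbb R^n$), and let $u_0\in\mathcal G(\mathbb R^n)$ have compact support. With $D=-i\partial$, consider $$D_tu=\sum_{j=1}^n a_{1,j}(t,x)D_ju+a_0(t,x)u+f(t,x),\qquad u(0,\cdot)=u_0.\tag{1}$$ A net $(r_\varepsilon)$ is slow scale if $|r_\varepsilon|^q=O(\varepsilon^{-1})$ as $\varepsilon\to0$ for all $q\ge0$. An element of $\mathcal G$ is of logarithmic type (of slow scale logarithmic type; slow scale regular) if it has a representative whose supremum over each compact set is $O(\log(1/\varepsilon))$ (is $O(\log\mu_\varepsilon)$ with some slow scale net $\mu_\varepsilon\ge1$; whose derivatives of every order have suprema over each compact set that are $O(\mu_\varepsilon)$ with slow scale nets $\mu$). Consider the hypotheses - (h1) the $a_{1,j}$ are real valued, compactly supported with respect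 to $x$, and all $\partial_{x_k}a_{1,j}$ are of logarithmic type; - (h2) the $a_{1,j}$ are real valued, slow scale regular, compactly supported with respect to $x$, and all $\partial_{x_k}a_{1,j}$ are of slow scale logarithmic type; - (i1) $a_0$ is compactly supported with respect to $x$ and of logarithmic type; - (i2) $a_0$ is slow scale regular, compactly supported with respect to $x$ and of slow scale logarithmic type. (i) Assume (h1) and (i1). There are a unique c-bounded generalised map $\gamma(x,t,s)$ (one with a moderate representative that maps each compact set into a compact set independent of $\varepsilon$, for small $\varepsilon$) with $$\partial_s\gamma_h(x,t,s)=-a_{1,h}(s,\gamma(x,t,s)),\quad h=1,\dots,n,\qquad \gamma(x,t,t)=x,$$ a unique $b\in\mathcal G(\mathbb R^{n+1})$ with $D_tb=\sum_ja_{1,j}D_jb+a_0b$, $b(0,\cdot)=1$, and a unique solution $u\in\mathcal G(\mathbb R^{n+1})$ of (1). The generalised function $b(\tau,\gamma(y,0,\tau))$ of $(\tau,y)$ is invertible, and $$u(t,x)=F_\phi(b)(t)\Bigl(u_0+i\int_0^t\frac{f(\tau,\gamma(\cdot,0,\tau))}{b(\tau,\gamma(\cdot,0,\tau))}\,d\tau\Bigr)(x)\quad\text{in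 }\mathcal G(\mathbb R^{n+1}),$$ where $\phi(t,x,\eta)=\sum_{h=1}^n\gamma_h(x,t,0)\eta_h$, the argument of $F_\phi(b)(t)$ is compactly supported with respect to $x$, and, on representatives, $$F_\phi(b)(t)(v)(x)=(2\pi)^{-n}\int_{\mathbb R^n}e^{i\phi(t,x,\eta)}\,b(t,x)\,\widehat v(\eta)\,d\eta,\qquad \widehat v(\eta)=\int_{\mathbb R^n}e^{-iy\cdot\eta}v(y)\,dy.$$ (ii) Assume (h2) and (i2). Then everything in (i) holds, and moreover $b$ is slow scale regular and $\phi$ is slow scale regular as a generalised symbol homogeneous of degree one in $\eta$: it has a representative $(\phi_\varepsilon)$ such that for every compact $K\subset\mathbb R^{n+1}$ and all multi-indices $\alpha,\beta$ the net $\sup_{(t,x)\in K,\ \eta\ne0}|\eta|^{|\alpha|-1}|\partial_\eta^\alpha\partial_{(t,x)}^\beta\phi_\varepsilon(t,x,\eta)|$ is $O(\mu_\varepsilon)$ for some slow scale net $\mu$. -/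

import Mathlib

open Set Filter Topology MeasureTheory
open scoped ContDiff

namespace Colombeau

/-! ### Nets indexed by `(0, 1]` and their growth as `ε → 0` -/

/-- The index set `(0, 1]`. -/
abbrev Eps : Type := Set.Ioc (0 : ℝ) 1

/-- The filter `ε → 0` on `(0, 1]`. -/
def eps0 : Filter Eps := Filter.comap (fun ε : Eps => (ε : ℝ)) (𝓝 0)

/-- `sup_{x ∈ K} p_ε(x) = O(ε ^ (-N))` for some `N`. -/
def ModBound {E : Type} (p : Eps → E → ℝ) (K : Set E) : Prop :=
  ∃ (N : ℕ) (C : ℝ), ∀ᶠ ε in eps0, ∀ x ∈ K, p ε x ≤ C * ((ε : ℝ)⁻¹) ^ N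

/-- `sup_{x ∈ K} p_ε(x) = O(ε ^ q)` for all `q`. -/
def NegBound {E : Type} (p : Eps → E → ℝ) (K : Set E) : Prop :=
  ∀ q : ℕ, ∃ C : ℝ, ∀ᶠ ε in eps0, ∀ x ∈ K, p ε x ≤ C * (ε : ℝ) ^ q

/-- Slow scale nets: every power is `O(ε⁻¹)`. (Only moduli matter, so real nets suffice;
integer powers suffice.) -/
def IsSlowScale (r : Eps → ℝ) : Prop :=
  ∀ q : ℕ, ∃ C : ℝ, ∀ᶠ ε in eps0, |r ε| ^ q ≤ C * (ε : ℝ)⁻¹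

/-- `sup_{x ∈ K} p_ε(x) = O(r_ε)` for some slow scale net `r`. -/
def SlowScaleBound {E : Type} (p : Eps → E → ℝ) (K : Set E) : Prop :=
  ∃ r : Eps → ℝ, IsSlowScale r ∧ ∃ C : ℝ, ∀ᶠ ε in eps0, ∀ x ∈ K, p ε x ≤ C * |r ε|

set_option linter.unusedSectionVars false
set_option linter.unusedVariables false

section Bounds

variable {E : Type} {p q : Eps → E → ℝ} {K : Set E}

lemma one_le_inv (ε : Eps) : 1 ≤ (ε : ℝ)⁻¹ := (one_le_inv₀ ε.2.1).2 ε.2.2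

lemma ModBound.mono (hq : ModBound q K) (h : ∀ ε, ∀ x ∈ K, p ε x ≤ q ε x) : ModBound p K := by
  obtain ⟨N, C, hC⟩ := hq
  exact ⟨N, C, hC.mono fun ε he x hx => (h ε x hx).trans (he x hx)⟩

lemma NegBound.mono (hq : NegBound q K) (h : ∀ ε, ∀ x ∈ K, p ε x ≤ q ε x) : NegBound p K := by
  intro m
  obtain ⟨C, hC⟩ := hq m
  exact ⟨C, hC.mono fun ε he x hx => (h ε x hx).trans (he x hx)⟩

lemma modBound_const {c : ℝ} (h : ∀ ε, ∀ x ∈ K, p ε x ≤ c) : ModBound p K :=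
  ⟨0, c, Eventually.of_forall fun ε x hx => by simpa using h ε x hx⟩

lemma negBound_zero : NegBound (fun _ _ => (0 : ℝ)) K :=
  fun _ => ⟨0, Eventually.of_forall fun ε x _ => by simp⟩

lemma ModBound.add (hp : ModBound p K) (hq : ModBound q K) :
    ModBound (fun ε x => p ε x + q ε x) K := by
  obtain ⟨N, C, hC⟩ := hp
  obtain ⟨M, D, hD⟩ := hq
  refine ⟨N + M, |C| + |D|, ?_⟩
  filter_upwards [hC, hD] with ε h1 h2 x hx
  have hi := one_le_inv ε
  have a1 : ((ε : ℝ)⁻¹) ^ N ≤ ((ε : ℝ)⁻¹) ^ (N + M) := pow_le_pow_right₀ hi (by omega)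
  have a2 : ((ε : ℝ)⁻¹) ^ M ≤ ((ε : ℝ)⁻¹) ^ (N + M) := pow_le_pow_right₀ hi (by omega)
  have p1 : (0 : ℝ) ≤ ((ε : ℝ)⁻¹) ^ N := by positivity
  have p2 : (0 : ℝ) ≤ ((ε : ℝ)⁻¹) ^ M := by positivity
  calc p ε x + q ε x ≤ C * ((ε : ℝ)⁻¹) ^ N + D * ((ε : ℝ)⁻¹) ^ M := add_le_add (h1 x hx) (h2 x hx)
    _ ≤ |C| * ((ε : ℝ)⁻¹) ^ (N + M) + |D| * ((ε : ℝ)⁻¹) ^ (N + M) := by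
        gcongr
        · exact le_abs_self C
        · exact le_abs_self D
    _ = _ := by ring

lemma NegBound.add (hp : NegBound p K) (hq : NegBound q K) :
    NegBound (fun ε x => p ε x + q ε x) K := by
  intro m
  obtain ⟨C, hC⟩ := hp m
  obtain ⟨D, hD⟩ := hq m
  refine ⟨C + D, ?_⟩
  filter_upwards [hC, hD] with ε h1 h2 x hx
  linarith [h1 x hx, h2 x hx, add_mul C D ((ε : ℝ) ^ m)]

lemma ModBound.mul (hp : ModBound p K) (hq : ModBound q K) (hp0 : ∀ ε x, 0 ≤ p ε x)
    (hq0 : ∀ ε x, 0 ≤ q ε x) : ModBound (fun ε x => p ε x * q ε x) K := by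
  obtain ⟨N, C, hC⟩ := hp
  obtain ⟨M, D, hD⟩ := hq
  refine ⟨N + M, C * D, ?_⟩
  filter_upwards [hC, hD] with ε h1 h2 x hx
  calc p ε x * q ε x ≤ (C * ((ε : ℝ)⁻¹) ^ N) * (D * ((ε : ℝ)⁻¹) ^ M) :=
        mul_le_mul (h1 x hx) (h2 x hx) (hq0 ε x) ((hp0 ε x).trans (h1 x hx))
    _ = _ := by ring

lemma NegBound.mul_mod (hp : NegBound p K) (hq : ModBound q K) (hp0 : ∀ ε x, 0 ≤ p ε x)
    (hq0 : ∀ ε x, 0 ≤ q ε x) : NegBound (fun ε x => p ε x * q ε x) K := by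
  obtain ⟨M, D, hD⟩ := hq
  intro m
  obtain ⟨C, hC⟩ := hp (m + M)
  refine ⟨C * D, ?_⟩
  filter_upwards [hC, hD] with ε h1 h2 x hx
  have he : (ε : ℝ) ≠ 0 := ε.2.1.ne'
  calc p ε x * q ε x ≤ (C * (ε : ℝ) ^ (m + M)) * (D * ((ε : ℝ)⁻¹) ^ M) :=
        mul_le_mul (h1 x hx) (h2 x hx) (hq0 ε x) ((hp0 ε x).trans (h1 x hx))
    _ = C * D * (ε : ℝ) ^ m * ((ε : ℝ) ^ M * ((ε : ℝ)⁻¹) ^ M) := by ring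
    _ = _ := by rw [← mul_pow, mul_inv_cancel₀ he, one_pow, mul_one]

lemma ModBound.sum {ι : Type} (s : Finset ι) {P : ι → Eps → E → ℝ}
    (h : ∀ i ∈ s, ModBound (P i) K) : ModBound (fun ε x => ∑ i ∈ s, P i ε x) K := by
  classical
  induction s using Finset.induction_on with
  | empty => exact modBound_const (c := 0) fun ε x _ => by simp
  | insert a s ha ih =>
    simp only [Finset.sum_insert ha]
    exact (h a (by simp)).add (ih fun i hi => h i (by simp [hi]))

lemma NegBound.sum {ι : Type} (s : Finset ι) {P : ι → Eps → E → ℝ}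
    (h : ∀ i ∈ s, NegBound (P i) K) : NegBound (fun ε x => ∑ i ∈ s, P i ε x) K := by
  classical
  induction s using Finset.induction_on with
  | empty => simpa using negBound_zero
  | insert a s ha ih =>
    simp only [Finset.sum_insert ha]
    exact (h a (by simp)).add (ih fun i hi => h i (by simp [hi]))

lemma ModBound.pow (hp : ModBound p K) (hp0 : ∀ ε x, 0 ≤ p ε x) (n : ℕ) :
    ModBound (fun ε x => p ε x ^ n) K := by
  induction n with
  | zero => exact modBound_const (c := 1) fun ε x _ => by simp
  | succ n ih =>
    simp only [pow_succ]
    exact ih.mul hp (fun ε x => pow_nonneg (hp0 ε x) n) hp0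

lemma ModBound.const_mul (hp : ModBound p K) (hp0 : ∀ ε x, 0 ≤ p ε x) (c : ℝ) (hc : 0 ≤ c) :
    ModBound (fun ε x => c * p ε x) K :=
  (modBound_const (p := fun _ _ => c) fun _ _ _ => le_rfl).mul hp (fun _ _ => hc) hp0

lemma NegBound.const_mul (hp : NegBound p K) (hp0 : ∀ ε x, 0 ≤ p ε x) (c : ℝ) (hc : 0 ≤ c) :
    NegBound (fun ε x => c * p ε x) K :=
  (hp.mul_mod (modBound_const (p := fun _ _ => c) fun _ _ _ => le_rfl) hp0 (fun _ _ => hc)).mono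
    fun ε x _ => (mul_comm _ _).le

end Bounds

/-! ### Moderate, negligible and slow scale nets of functions

The norm of the `k`-th Fréchet derivative is equivalent to the maximum of the `|∂^α u|`,
`|α| = k`. -/

section Nets

variable {E : Type} [NormedAddCommGroup E] [NormedSpace ℝ E]
  {E' : Type} [NormedAddCommGroup E'] [NormedSpace ℝ E']
  {F : Type} [NormedAddCommGroup F] [NormedSpace ℝ F]
  {F' : Type} [NormedAddCommGroup F'] [NormedSpace ℝ F']
  {F'' : Type} [NormedAddCommGroup F''] [NormedSpace ℝ F'']

def ModOn (u : Eps → E → F) (U : Set E) : Prop :=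
  ∀ K ⊆ U, IsCompact K → ∀ k : ℕ, ModBound (fun ε x => ‖iteratedFDeriv ℝ k (u ε) x‖) K

def NegOn (u : Eps → E → F) (U : Set E) : Prop :=
  ∀ K ⊆ U, IsCompact K → ∀ k : ℕ, NegBound (fun ε x => ‖iteratedFDeriv ℝ k (u ε) x‖) K

def SlowScaleOn (u : Eps → E → F) (U : Set E) : Prop :=
  ∀ K ⊆ U, IsCompact K → ∀ k : ℕ, SlowScaleBound (fun ε x => ‖iteratedFDeriv ℝ k (u ε) x‖) K

/-- A net of maps is c-bounded if it maps compact sets into compact sets, uniformly for small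
`ε`. -/
def CBounded (u : Eps → E → F) : Prop :=
  ∀ K : Set E, IsCompact K → ∃ L : Set F, IsCompact L ∧ ∀ᶠ ε in eps0, MapsTo (u ε) K L

lemma ModOn.mono {u : Eps → E → F} {U V : Set E} (h : ModOn u V) (hUV : U ⊆ V) : ModOn u U :=
  fun K hK => h K (hK.trans hUV)

lemma NegOn.mono {u : Eps → E → F} {U V : Set E} (h : NegOn u V) (hUV : U ⊆ V) : NegOn u U :=
  fun K hK => h K (hK.trans hUV)

lemma NegOn.modOn {u : Eps → E → F} {U : Set E} (h : NegOn u U) : ModOn u U := fun K hK hc k => by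
  obtain ⟨C, hC⟩ := h K hK hc k 0
  exact ⟨0, C, by simpa using hC⟩

lemma negOn_zero (U : Set E) : NegOn (fun (_ : Eps) (_ : E) => (0 : F)) U := fun K _ _ k =>
  negBound_zero.mono fun ε x _ => by
    simp [show (fun _ : E => (0 : F)) = 0 from rfl]

lemma NegOn.add {u v : Eps → E → F} {U : Set E} (hU : IsOpen U)
    (su : ∀ ε, ContDiffOn ℝ ∞ (u ε) U) (sv : ∀ ε, ContDiffOn ℝ ∞ (v ε) U)
    (hu : NegOn u U) (hv : NegOn v U) : NegOn (fun ε x => u ε x + v ε x) U := fun K hK hc k =>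
  ((hu K hK hc k).add (hv K hK hc k)).mono fun ε x hx => by
    have h1 := (su ε).contDiffAt (hU.mem_nhds (hK hx))
    have h2 := (sv ε).contDiffAt (hU.mem_nhds (hK hx))
    have := iteratedFDeriv_add_apply (i := k) (h1.of_le (by exact_mod_cast le_top))
      (h2.of_le (by exact_mod_cast le_top))
    change ‖iteratedFDeriv ℝ k (u ε + v ε) x‖ ≤ _
    rw [this]
    exact norm_add_le _ _

lemma ModOn.add {u v : Eps → E → F} {U : Set E} (hU : IsOpen U)
    (su : ∀ ε, ContDiffOn ℝ ∞ (u ε) U) (sv : ∀ ε, ContDiffOn ℝ ∞ (v ε) U)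
    (hu : ModOn u U) (hv : ModOn v U) : ModOn (fun ε x => u ε x + v ε x) U := fun K hK hc k =>
  ((hu K hK hc k).add (hv K hK hc k)).mono fun ε x hx => by
    have h1 := (su ε).contDiffAt (hU.mem_nhds (hK hx))
    have h2 := (sv ε).contDiffAt (hU.mem_nhds (hK hx))
    have := iteratedFDeriv_add_apply (i := k) (h1.of_le (by exact_mod_cast le_top))
      (h2.of_le (by exact_mod_cast le_top))
    change ‖iteratedFDeriv ℝ k (u ε + v ε) x‖ ≤ _
    rw [this]
    exact norm_add_le _ _

lemma NegOn.neg {u : Eps → E → F} {U : Set E} (hu : NegOn u U) :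
    NegOn (fun ε x => - u ε x) U := fun K hK hc k =>
  (hu K hK hc k).mono fun ε x _ => by
    change ‖iteratedFDeriv ℝ k (-(u ε)) x‖ ≤ _
    rw [iteratedFDeriv_neg_apply, norm_neg]

/-- A net that does not depend on `ε`. -/
lemma modOn_const {f : E → F} (hf : ContDiff ℝ ∞ f) (U : Set E) :
    ModOn (fun _ : Eps => f) U := fun K _ hc k => by
  have hcont : Continuous fun x => ‖iteratedFDeriv ℝ k f x‖ :=
    (hf.continuous_iteratedFDeriv (m := k) (by exact_mod_cast le_top)).norm
  obtain ⟨C, hC⟩ := hc.bddAbove_image hcont.continuousOn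
  exact modBound_const (c := C) fun ε x hx => hC (mem_image_of_mem _ hx)

lemma cBounded_const {f : E → F} (hf : Continuous f) : CBounded (fun _ : Eps => f) :=
  fun K hK => ⟨f '' K, hK.image hf, Eventually.of_forall fun _ => mapsTo_image f K⟩

lemma contDiff_bilin (B : F →L[ℝ] F' →L[ℝ] F'') {u : E → F} {v : E → F'} (su : ContDiff ℝ ∞ u)
    (sv : ContDiff ℝ ∞ v) : ContDiff ℝ ∞ (fun y => B (u y) (v y)) :=
  B.isBoundedBilinearMap.contDiff.comp (su.prodMk sv)

lemma norm_bilin_le (B : F →L[ℝ] F' →L[ℝ] F'') {u : E → F} {v : E → F'} (su : ContDiff ℝ ∞ u)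
    (sv : ContDiff ℝ ∞ v) (k : ℕ) (x : E) :
    ‖iteratedFDeriv ℝ k (fun y => B (u y) (v y)) x‖ ≤ ‖B‖ * ∑ i ∈ Finset.range (k + 1),
      (k.choose i : ℝ) * (‖iteratedFDeriv ℝ i u x‖ * ‖iteratedFDeriv ℝ (k - i) v x‖) := by
  have := B.norm_iteratedFDeriv_le_of_bilinear su sv x (n := k) (by exact_mod_cast le_top)
  simpa [mul_assoc] using this

lemma modBound_bilin (B : F →L[ℝ] F' →L[ℝ] F'') {u : Eps → E → F} {v : Eps → E → F'}
    (su : ∀ ε, ContDiff ℝ ∞ (u ε)) (sv : ∀ ε, ContDiff ℝ ∞ (v ε)) {K : Set E} {k : ℕ}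
    (hu : ∀ j ≤ k, ModBound (fun ε x => ‖iteratedFDeriv ℝ j (u ε) x‖) K)
    (hv : ∀ j ≤ k, ModBound (fun ε x => ‖iteratedFDeriv ℝ j (v ε) x‖) K) :
    ModBound (fun ε x => ‖iteratedFDeriv ℝ k (fun y => B (u ε y) (v ε y)) x‖) K := by
  refine ModBound.mono ?_ fun ε x _ => norm_bilin_le B (su ε) (sv ε) k x
  refine ModBound.const_mul (ModBound.sum _ fun i hi => ?_) (fun ε x => by positivity) _
    (by positivity)
  refine ModBound.const_mul ?_ (fun ε x => by positivity) _ (by positivity)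
  exact (hu i (by simp at hi; omega)).mul (hv (k - i) (by omega)) (fun _ _ => norm_nonneg _)
    (fun _ _ => norm_nonneg _)

lemma negBound_bilin (B : F →L[ℝ] F' →L[ℝ] F'') {u : Eps → E → F} {v : Eps → E → F'}
    (su : ∀ ε, ContDiff ℝ ∞ (u ε)) (sv : ∀ ε, ContDiff ℝ ∞ (v ε)) {K : Set E} {k : ℕ}
    (hu : ∀ j ≤ k, NegBound (fun ε x => ‖iteratedFDeriv ℝ j (u ε) x‖) K)
    (hv : ∀ j ≤ k, ModBound (fun ε x => ‖iteratedFDeriv ℝ j (v ε) x‖) K) :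
    NegBound (fun ε x => ‖iteratedFDeriv ℝ k (fun y => B (u ε y) (v ε y)) x‖) K := by
  refine NegBound.mono ?_ fun ε x _ => norm_bilin_le B (su ε) (sv ε) k x
  refine NegBound.const_mul (NegBound.sum _ fun i hi => ?_) (fun ε x => by positivity) _
    (by positivity)
  refine NegBound.const_mul ?_ (fun ε x => by positivity) _ (by positivity)
  exact (hu i (by simp at hi; omega)).mul_mod (hv (k - i) (by omega)) (fun _ _ => norm_nonneg _)
    (fun _ _ => norm_nonneg _)

lemma ModOn.bilin (B : F →L[ℝ] F' →L[ℝ] F'') {u : Eps → E → F} {v : Eps → E → F'}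
    (su : ∀ ε, ContDiff ℝ ∞ (u ε)) (sv : ∀ ε, ContDiff ℝ ∞ (v ε)) {U : Set E}
    (hu : ModOn u U) (hv : ModOn v U) : ModOn (fun ε y => B (u ε y) (v ε y)) U :=
  fun K hK hc _ => modBound_bilin B su sv (fun j _ => hu K hK hc j) (fun j _ => hv K hK hc j)

lemma NegOn.bilin (B : F →L[ℝ] F' →L[ℝ] F'') {u : Eps → E → F} {v : Eps → E → F'}
    (su : ∀ ε, ContDiff ℝ ∞ (u ε)) (sv : ∀ ε, ContDiff ℝ ∞ (v ε)) {U : Set E}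
    (hu : NegOn u U) (hv : ModOn v U) : NegOn (fun ε y => B (u ε y) (v ε y)) U :=
  fun K hK hc _ => negBound_bilin B su sv (fun j _ => hu K hK hc j) (fun j _ => hv K hK hc j)

lemma contDiff_fderiv {f : E → F} (hf : ContDiff ℝ ∞ f) : ContDiff ℝ ∞ (fderiv ℝ f) :=
  hf.fderiv_right (by exact_mod_cast le_top)

lemma ModOn.fderiv {u : Eps → E → F} {U : Set E} (hu : ModOn u U) :
    ModOn (fun ε => fderiv ℝ (u ε)) U := fun K hK hc k =>
  (hu K hK hc (k + 1)).mono fun ε x _ => by rw [norm_iteratedFDeriv_fderiv]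

lemma NegOn.fderiv {u : Eps → E → F} {U : Set E} (hu : NegOn u U) :
    NegOn (fun ε => fderiv ℝ (u ε)) U := fun K hK hc k =>
  (hu K hK hc (k + 1)).mono fun ε x _ => by rw [norm_iteratedFDeriv_fderiv]

/-! ### Composition -/

lemma norm_comp_le {u : E' → F} {f : E → E'} (su : ContDiff ℝ ∞ u) (sf : ContDiff ℝ ∞ f)
    (k : ℕ) (x : E) :
    ‖iteratedFDeriv ℝ k (fun y => u (f y)) x‖ ≤ (k.factorial : ℝ) *
      ((∑ i ∈ Finset.range (k + 1), ‖iteratedFDeriv ℝ i u (f x)‖) *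
        (1 + ∑ i ∈ Finset.range (k + 1), ‖iteratedFDeriv ℝ i f x‖) ^ k) := by
  have h := norm_iteratedFDeriv_comp_le su sf (n := k) (by exact_mod_cast le_top) x
    (C := ∑ i ∈ Finset.range (k + 1), ‖iteratedFDeriv ℝ i u (f x)‖)
    (D := 1 + ∑ i ∈ Finset.range (k + 1), ‖iteratedFDeriv ℝ i f x‖)
    (fun i hi => Finset.single_le_sum (f := fun i => ‖iteratedFDeriv ℝ i u (f x)‖)
      (fun _ _ => norm_nonneg _) (by simp; omega))
    (fun i h1 hi => by
      have a : ‖iteratedFDeriv ℝ i f x‖ ≤ ∑ i ∈ Finset.range (k + 1), ‖iteratedFDeriv ℝ i f x‖ :=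
        Finset.single_le_sum (f := fun i => ‖iteratedFDeriv ℝ i f x‖)
          (fun _ _ => norm_nonneg _) (by simp; omega)
      have b : (0 : ℝ) ≤ ∑ i ∈ Finset.range (k + 1), ‖iteratedFDeriv ℝ i f x‖ := by positivity
      calc _ ≤ 1 + ∑ i ∈ Finset.range (k + 1), ‖iteratedFDeriv ℝ i f x‖ := by linarith
        _ ≤ _ := le_self_pow₀ (by linarith) (by omega))
  simpa [mul_assoc, Function.comp_def] using h

lemma ModBound.comp_of_mapsTo {p : Eps → E' → ℝ} {f : Eps → E → E'} {K : Set E} {L : Set E'}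
    (hp : ModBound p L) (h : ∀ᶠ ε in eps0, MapsTo (f ε) K L) :
    ModBound (fun ε x => p ε (f ε x)) K := by
  obtain ⟨N, C, hC⟩ := hp
  refine ⟨N, C, ?_⟩
  filter_upwards [hC, h] with ε h1 h2 x hx using h1 _ (h2 hx)

lemma NegBound.comp_of_mapsTo {p : Eps → E' → ℝ} {f : Eps → E → E'} {K : Set E} {L : Set E'}
    (hp : NegBound p L) (h : ∀ᶠ ε in eps0, MapsTo (f ε) K L) :
    NegBound (fun ε x => p ε (f ε x)) K := by
  intro q
  obtain ⟨C, hC⟩ := hp q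
  refine ⟨C, ?_⟩
  filter_upwards [hC, h] with ε h1 h2 x hx using h1 _ (h2 hx)

lemma ModOn.comp {u : Eps → E' → F} {f : Eps → E → E'} (su : ∀ ε, ContDiff ℝ ∞ (u ε))
    (sf : ∀ ε, ContDiff ℝ ∞ (f ε)) (hu : ModOn u univ) (hf : ModOn f univ) (cf : CBounded f) :
    ModOn (fun ε x => u ε (f ε x)) univ := fun K hK hc k => by
  obtain ⟨L, hL, hKL⟩ := cf K hc
  refine ModBound.mono ?_ fun ε x _ => norm_comp_le (su ε) (sf ε) k x
  refine ModBound.const_mul (ModBound.mul (ModBound.sum _ fun i _ => ?_) (ModBound.pow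
    (ModBound.add (modBound_const (c := 1) fun _ _ _ => le_rfl)
      (ModBound.sum _ fun i _ => hf K hK hc i)) ?_ k) ?_ ?_) ?_ _ (by positivity)
  · exact (hu L (subset_univ _) hL i).comp_of_mapsTo hKL
  all_goals intros; positivity

lemma NegOn.comp {u : Eps → E' → F} {f : Eps → E → E'} (su : ∀ ε, ContDiff ℝ ∞ (u ε))
    (sf : ∀ ε, ContDiff ℝ ∞ (f ε)) (hu : NegOn u univ) (hf : ModOn f univ) (cf : CBounded f) :
    NegOn (fun ε x => u ε (f ε x)) univ := fun K hK hc k => by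
  obtain ⟨L, hL, hKL⟩ := cf K hc
  refine NegBound.mono ?_ fun ε x _ => norm_comp_le (su ε) (sf ε) k x
  refine NegBound.const_mul (NegBound.mul_mod (NegBound.sum _ fun i _ => ?_) (ModBound.pow
    (ModBound.add (modBound_const (c := 1) fun _ _ _ => le_rfl)
      (ModBound.sum _ fun i _ => hf K hK hc i)) ?_ k) ?_ ?_) ?_ _ (by positivity)
  · exact (hu L (subset_univ _) hL i).comp_of_mapsTo hKL
  all_goals intros; positivity

lemma CBounded.comp {u : Eps → E' → F} {f : Eps → E → E'} (hu : CBounded u) (hf : CBounded f) :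
    CBounded (fun ε x => u ε (f ε x)) := fun K hK => by
  obtain ⟨L, hL, h1⟩ := hf K hK
  obtain ⟨M, hM, h2⟩ := hu L hL
  refine ⟨M, hM, ?_⟩
  filter_upwards [h1, h2] with ε a b x hx using b (a hx)

/-- Replacing the inner net by an equivalent one changes the composition by a negligible net. -/
lemma negBound_comp_sub [ProperSpace E'] {f g : Eps → E → E'}
    (sf : ∀ ε, ContDiff ℝ ∞ (f ε)) (sg : ∀ ε, ContDiff ℝ ∞ (g ε))
    (hf : ModOn f univ) (hg : ModOn g univ) (cf : CBounded f) (cg : CBounded g)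
    (hfg : NegOn (fun ε x => f ε x - g ε x) univ) (k : ℕ) :
    ∀ (F : Type) [NormedAddCommGroup F] [NormedSpace ℝ F] (u : Eps → E' → F),
      (∀ ε, ContDiff ℝ ∞ (u ε)) → ModOn u univ → ∀ j ≤ k, ∀ K : Set E, IsCompact K →
      NegBound (fun ε x => ‖iteratedFDeriv ℝ j (fun y => u ε (f ε y) - u ε (g ε y)) x‖) K := by
  have base : ∀ (F : Type) [NormedAddCommGroup F] [NormedSpace ℝ F] (u : Eps → E' → F),
      (∀ ε, ContDiff ℝ ∞ (u ε)) → ModOn u univ → ∀ K : Set E, IsCompact K →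
      NegBound (fun ε x => ‖iteratedFDeriv ℝ 0 (fun y => u ε (f ε y) - u ε (g ε y)) x‖) K := by
    intro F _ _ u su hu K hK
    obtain ⟨L, hL, h1⟩ := cf K hK
    obtain ⟨M, hM, h2⟩ := cg K hK
    obtain ⟨R, hR⟩ := (hL.union hM).isBounded.subset_closedBall (0 : E')
    obtain ⟨N, C, hC⟩ := hu (Metric.closedBall 0 R) (subset_univ _)
      (isCompact_closedBall 0 R) 1
    intro q
    obtain ⟨D, hD⟩ := hfg K (subset_univ _) hK 0 (q + N)
    refine ⟨C * D, ?_⟩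
    filter_upwards [h1, h2, hC, hD] with ε a1 a2 a3 a4 x hx
    have he : (ε : ℝ) ≠ 0 := ε.2.1.ne'
    have m1 : f ε x ∈ Metric.closedBall (0 : E') R := hR (Or.inl (a1 hx))
    have m2 : g ε x ∈ Metric.closedBall (0 : E') R := hR (Or.inr (a2 hx))
    have key := (convex_closedBall (0 : E') R).norm_image_sub_le_of_norm_fderiv_le
      (𝕜 := ℝ) (f := u ε) (C := C * ((ε : ℝ)⁻¹) ^ N)
      (fun y _ => ((su ε).differentiable (by simp)).differentiableAt)
      (fun y hy => by
        have := a3 y hy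
        rw [← zero_add 1, ← norm_iteratedFDeriv_fderiv, norm_iteratedFDeriv_zero] at this
        exact this) m2 m1
    have a5 := a4 x hx
    rw [norm_iteratedFDeriv_zero] at a5 ⊢
    have hnn : 0 ≤ C * ((ε : ℝ)⁻¹) ^ N := (norm_nonneg _).trans (a3 _ m1)
    calc ‖u ε (f ε x) - u ε (g ε x)‖ ≤ C * ((ε : ℝ)⁻¹) ^ N * ‖f ε x - g ε x‖ := key
      _ ≤ C * ((ε : ℝ)⁻¹) ^ N * (D * (ε : ℝ) ^ (q + N)) := by gcongr
      _ = C * D * (ε : ℝ) ^ q * ((ε : ℝ) ^ N * ((ε : ℝ)⁻¹) ^ N) := by ring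
      _ = _ := by rw [← mul_pow, mul_inv_cancel₀ he, one_pow, mul_one]
  induction k with
  | zero =>
    intro F _ _ u su hu j hj K hK
    obtain rfl : j = 0 := by omega
    exact base F u su hu K hK
  | succ k ih =>
    intro F _ _ u su hu j hj K hK
    obtain _ | i := j
    · exact base F u su hu K hK
    have sDu : ∀ ε, ContDiff ℝ ∞ (fderiv ℝ (u ε)) := fun ε => contDiff_fderiv (su ε)
    have sDf : ∀ ε, ContDiff ℝ ∞ (fderiv ℝ (f ε)) := fun ε => contDiff_fderiv (sf ε)
    have sDg : ∀ ε, ContDiff ℝ ∞ (fderiv ℝ (g ε)) := fun ε => contDiff_fderiv (sg ε)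
    have sDuf : ∀ ε, ContDiff ℝ ∞ (fun y => fderiv ℝ (u ε) (f ε y)) :=
      fun ε => (sDu ε).comp (sf ε)
    have sDug : ∀ ε, ContDiff ℝ ∞ (fun y => fderiv ℝ (u ε) (g ε y)) :=
      fun ε => (sDu ε).comp (sg ε)
    have s1 : ∀ ε, ContDiff ℝ ∞ (fun y => fderiv ℝ (u ε) (f ε y) - fderiv ℝ (u ε) (g ε y)) :=
      fun ε => (sDuf ε).sub (sDug ε)
    have s2 : ∀ ε, ContDiff ℝ ∞ (fun y => fderiv ℝ (f ε) y - fderiv ℝ (g ε) y) :=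
      fun ε => (sDf ε).sub (sDg ε)
    let B := ContinuousLinearMap.compL ℝ E E' F
    have hneg2 : NegOn (fun ε y => fderiv ℝ (f ε) y - fderiv ℝ (g ε) y) univ := by
      have := hfg.fderiv
      convert this using 3 with ε y
      exact (fderiv_fun_sub (((sf ε).differentiable (by simp)).differentiableAt)
        (((sg ε).differentiable (by simp)).differentiableAt)).symm
    have t1 := negBound_bilin B s1 sDf (K := K) (k := i)
      (fun j' hj' => ih _ (fun ε => fderiv ℝ (u ε)) sDu hu.fderiv j' (by omega) K hK)
      (fun j' _ => hf.fderiv K (subset_univ _) hK j')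
    have t2 := negBound_bilin B.flip s2 sDug (K := K) (k := i)
      (fun j' _ => hneg2 K (subset_univ _) hK j')
      (fun j' _ => (ModOn.comp sDu sg hu.fderiv hg cg) K (subset_univ _) hK j')
    refine (t1.add t2).mono fun ε x _ => ?_
    rw [← norm_iteratedFDeriv_fderiv]
    have hd : fderiv ℝ (fun y => u ε (f ε y) - u ε (g ε y)) =
        (fun y => B (fderiv ℝ (u ε) (f ε y) - fderiv ℝ (u ε) (g ε y)) (fderiv ℝ (f ε) y)) +
        (fun y => B.flip (fderiv ℝ (f ε) y - fderiv ℝ (g ε) y) (fderiv ℝ (u ε) (g ε y))) := by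
      funext y
      have du : Differentiable ℝ (u ε) := (su ε).differentiable (by simp)
      have df : Differentiable ℝ (f ε) := (sf ε).differentiable (by simp)
      have dg : Differentiable ℝ (g ε) := (sg ε).differentiable (by simp)
      have e1 : fderiv ℝ (fun y => u ε (f ε y)) y = (fderiv ℝ (u ε) (f ε y)).comp (fderiv ℝ (f ε) y) :=
        fderiv_comp y (du _) (df _)
      have e2 : fderiv ℝ (fun y => u ε (g ε y)) y = (fderiv ℝ (u ε) (g ε y)).comp (fderiv ℝ (g ε) y) :=
        fderiv_comp y (du _) (dg _)
      have e3 : fderiv ℝ (fun y => u ε (f ε y) - u ε (g ε y)) y =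
          fderiv ℝ (fun y => u ε (f ε y)) y - fderiv ℝ (fun y => u ε (g ε y)) y :=
        fderiv_fun_sub ((du.comp df) y) ((du.comp dg) y)
      rw [e3, e1, e2]
      ext z
      simp [B]
    rw [hd]
    have c1 := contDiff_bilin B (s1 ε) (sDf ε)
    have c2 := contDiff_bilin B.flip (s2 ε) (sDug ε)
    rw [iteratedFDeriv_add_apply (c1.contDiffAt.of_le (by exact_mod_cast le_top))
      (c2.contDiffAt.of_le (by exact_mod_cast le_top))]
    exact norm_add_le _ _

lemma NegOn.comp_sub [ProperSpace E'] {u : Eps → E' → F} {f g : Eps → E → E'}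
    (su : ∀ ε, ContDiff ℝ ∞ (u ε)) (hu : ModOn u univ)
    (sf : ∀ ε, ContDiff ℝ ∞ (f ε)) (sg : ∀ ε, ContDiff ℝ ∞ (g ε))
    (hf : ModOn f univ) (hg : ModOn g univ) (cf : CBounded f) (cg : CBounded g)
    (hfg : NegOn (fun ε x => f ε x - g ε x) univ) :
    NegOn (fun ε x => u ε (f ε x) - u ε (g ε x)) univ := fun K _ hc k =>
  negBound_comp_sub sf sg hf hg cf cg hfg k F u su hu k le_rfl K hc

end Nets

/-! ### Parameter integrals -/

section Integral

variable {H : Type} [NormedAddCommGroup H] [NormedSpace ℝ H] [ProperSpace H]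

lemma hasFDerivAt_unitIntegral {F : Type} [NormedAddCommGroup F] [NormedSpace ℝ F]
    {g : H × ℝ → F} (hg : ContDiff ℝ ∞ g) (z : H) :
    HasFDerivAt (fun z => ∫ s in (0 : ℝ)..1, g (z, s))
      (∫ s in (0 : ℝ)..1, (fderiv ℝ g (z, s)).comp (ContinuousLinearMap.inl ℝ H ℝ)) z := by
  have hc : Continuous fun p : H × ℝ => (fderiv ℝ g p).comp (ContinuousLinearMap.inl ℝ H ℝ) :=
    (contDiff_fderiv hg).continuous.clm_comp continuous_const
  have hcomp : IsCompact (Metric.closedBall z 1 ×ˢ Icc (0 : ℝ) 1) :=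
    (isCompact_closedBall z 1).prod isCompact_Icc
  obtain ⟨C, hC⟩ := hcomp.bddAbove_image hc.norm.continuousOn
  refine intervalIntegral.hasFDerivAt_integral_of_dominated_of_fderiv_le
    (F' := fun z s => (fderiv ℝ g (z, s)).comp (ContinuousLinearMap.inl ℝ H ℝ))
    (bound := fun _ => C) (Metric.closedBall_mem_nhds z one_pos) ?_ ?_ ?_ ?_ ?_ ?_
  · exact Eventually.of_forall fun x =>
      (hg.continuous.comp (by fun_prop : Continuous fun s : ℝ => (x, s))).aestronglyMeasurable
  · exact (hg.continuous.comp (by fun_prop : Continuous fun s : ℝ => (z, s))).intervalIntegrable _ _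
  · exact (hc.comp (by fun_prop : Continuous fun s : ℝ => (z, s))).aestronglyMeasurable
  · refine Eventually.of_forall fun s hs x hx => hC ⟨(x, s), ⟨hx, ?_⟩, rfl⟩
    rw [uIoc_of_le zero_le_one] at hs
    exact ⟨hs.1.le, hs.2⟩
  · exact intervalIntegrable_const
  · refine Eventually.of_forall fun s _ x _ => ?_
    have h1 : HasFDerivAt g (fderiv ℝ g (x, s)) (x, s) :=
      ((hg.differentiable (by simp)) (x, s)).hasFDerivAt
    exact h1.comp x (hasFDerivAt_prodMk_left x s)

lemma contDiff_fderiv_inl {F : Type} [NormedAddCommGroup F] [NormedSpace ℝ F]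
    {g : H × ℝ → F} (hg : ContDiff ℝ ∞ g) :
    ContDiff ℝ ∞ fun p : H × ℝ => (fderiv ℝ g p).comp (ContinuousLinearMap.inl ℝ H ℝ) :=
  (contDiff_fderiv hg).clm_comp contDiff_const

lemma contDiff_unitIntegral_nat (n : ℕ) : ∀ {F : Type} [NormedAddCommGroup F] [NormedSpace ℝ F]
    {g : H × ℝ → F}, ContDiff ℝ ∞ g → ContDiff ℝ n (fun z => ∫ s in (0 : ℝ)..1, g (z, s)) := by
  induction n with
  | zero =>
    intro F _ _ g hg
    rw [Nat.cast_zero, contDiff_zero]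
    exact continuous_iff_continuousAt.2 fun z => (hasFDerivAt_unitIntegral hg z).continuousAt
  | succ n ih =>
    intro F _ _ g hg
    rw [Nat.cast_succ, contDiff_succ_iff_fderiv]
    refine ⟨fun z => (hasFDerivAt_unitIntegral hg z).differentiableAt, by simp, ?_⟩
    have : fderiv ℝ (fun z => ∫ s in (0 : ℝ)..1, g (z, s)) = fun z =>
        ∫ s in (0 : ℝ)..1, (fderiv ℝ g (z, s)).comp (ContinuousLinearMap.inl ℝ H ℝ) :=
      funext fun z => (hasFDerivAt_unitIntegral hg z).fderiv
    rw [this]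
    exact ih (contDiff_fderiv_inl hg)

lemma contDiff_unitIntegral {F : Type} [NormedAddCommGroup F] [NormedSpace ℝ F]
    {g : H × ℝ → F} (hg : ContDiff ℝ ∞ g) :
    ContDiff ℝ ∞ (fun z => ∫ s in (0 : ℝ)..1, g (z, s)) :=
  contDiff_infty.2 fun n => contDiff_unitIntegral_nat n hg

/-- Derivatives of the parameter integral are bounded by those of the integrand. -/
lemma norm_unitIntegral_le (k : ℕ) : ∀ {F : Type} [NormedAddCommGroup F] [NormedSpace ℝ F]
    {g : H × ℝ → F}, ContDiff ℝ ∞ g → ∀ (z : H) (C : ℝ),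
    (∀ s ∈ Icc (0 : ℝ) 1, ‖iteratedFDeriv ℝ k g (z, s)‖ ≤ C) →
    ‖iteratedFDeriv ℝ k (fun z => ∫ s in (0 : ℝ)..1, g (z, s)) z‖ ≤ C := by
  induction k with
  | zero =>
    intro F _ _ g hg z C hC
    rw [norm_iteratedFDeriv_zero]
    have := intervalIntegral.norm_integral_le_of_norm_le_const (a := 0) (b := 1)
      (f := fun s => g (z, s)) (C := C) (fun s hs => by
        rw [uIoc_of_le zero_le_one] at hs
        simpa using hC s ⟨hs.1.le, hs.2⟩)
    simpa using this
  | succ k ih =>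
    intro F _ _ g hg z C hC
    rw [← norm_iteratedFDeriv_fderiv]
    have : fderiv ℝ (fun z => ∫ s in (0 : ℝ)..1, g (z, s)) = fun z =>
        ∫ s in (0 : ℝ)..1, (fderiv ℝ g (z, s)).comp (ContinuousLinearMap.inl ℝ H ℝ) :=
      funext fun z => (hasFDerivAt_unitIntegral hg z).fderiv
    rw [this]
    refine ih (contDiff_fderiv_inl hg) z C fun s hs => le_trans ?_ (hC s hs)
    let L : (H × ℝ →L[ℝ] F) →L[ℝ] (H →L[ℝ] F) :=
      (ContinuousLinearMap.compL ℝ H (H × ℝ) F).flip (ContinuousLinearMap.inl ℝ H ℝ)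
    have hL : ‖L‖ ≤ 1 := by
      refine ContinuousLinearMap.opNorm_le_bound _ zero_le_one fun T => ?_
      rw [one_mul]
      refine ContinuousLinearMap.opNorm_le_bound _ (norm_nonneg _) fun h => ?_
      calc ‖T (h, 0)‖ ≤ ‖T‖ * ‖((h, 0) : H × ℝ)‖ := T.le_opNorm _
        _ = ‖T‖ * ‖h‖ := by simp [Prod.norm_def]
    have h1 := L.norm_iteratedFDeriv_comp_left (f := fderiv ℝ g) (x := (z, s)) (n := k)
      (contDiff_fderiv hg).contDiffAt (by exact_mod_cast le_top)
    calc _ ≤ ‖L‖ * ‖iteratedFDeriv ℝ k (fderiv ℝ g) (z, s)‖ := h1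
      _ ≤ 1 * ‖iteratedFDeriv ℝ k (fderiv ℝ g) (z, s)‖ := by gcongr
      _ = ‖iteratedFDeriv ℝ (k + 1) g (z, s)‖ := by rw [one_mul, norm_iteratedFDeriv_fderiv]

variable {F : Type} [NormedAddCommGroup F] [NormedSpace ℝ F] {g : Eps → H × ℝ → F}

lemma ModOn.unitIntegral (sg : ∀ ε, ContDiff ℝ ∞ (g ε)) (hg : ModOn g univ) :
    ModOn (fun ε z => ∫ s in (0 : ℝ)..1, g ε (z, s)) univ := fun K _ hc k => by
  obtain ⟨N, C, h⟩ := hg (K ×ˢ Icc 0 1) (subset_univ _) (hc.prod isCompact_Icc) k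
  exact ⟨N, C, h.mono fun ε hε x hx =>
    norm_unitIntegral_le k (sg ε) x _ fun s hs => hε (x, s) ⟨hx, hs⟩⟩

lemma NegOn.unitIntegral (sg : ∀ ε, ContDiff ℝ ∞ (g ε)) (hg : NegOn g univ) :
    NegOn (fun ε z => ∫ s in (0 : ℝ)..1, g ε (z, s)) univ := fun K _ hc k q => by
  obtain ⟨C, h⟩ := hg (K ×ˢ Icc 0 1) (subset_univ _) (hc.prod isCompact_Icc) k q
  exact ⟨C, h.mono fun ε hε x hx =>
    norm_unitIntegral_le k (sg ε) x _ fun s hs => hε (x, s) ⟨hx, hs⟩⟩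

end Integral

/-! ### The Colombeau algebra -/

section Algebra

variable {E : Type} [NormedAddCommGroup E] [NormedSpace ℝ E]
  {E' : Type} [NormedAddCommGroup E'] [NormedSpace ℝ E']

variable (E) in
/-- Moderate nets of smooth complex valued functions on `E`. -/
def moderateNets : Subalgebra ℂ (Eps → E → ℂ) where
  carrier := {u | (∀ ε, ContDiff ℝ ∞ (u ε)) ∧ ModOn u univ}
  mul_mem' {u v} hu hv := ⟨fun ε => (hu.1 ε).mul (hv.1 ε),
    ModOn.bilin (ContinuousLinearMap.mul ℝ ℂ) hu.1 hv.1 hu.2 hv.2⟩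
  add_mem' {u v} hu hv := ⟨fun ε => (hu.1 ε).add (hv.1 ε),
    ModOn.add isOpen_univ (fun ε => (hu.1 ε).contDiffOn) (fun ε => (hv.1 ε).contDiffOn)
      hu.2 hv.2⟩
  algebraMap_mem' c := ⟨fun _ => contDiff_const, modOn_const (f := fun _ => c) contDiff_const _⟩

lemma mem_moderateNets {u : Eps → E → ℂ} :
    u ∈ moderateNets E ↔ (∀ ε, ContDiff ℝ ∞ (u ε)) ∧ ModOn u univ := Iff.rfl

variable (E) in
/-- The ideal of negligible nets. -/
def negligibleNets : Ideal (moderateNets E) where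
  carrier := {u | NegOn (u : Eps → E → ℂ) univ}
  zero_mem' := negOn_zero univ
  add_mem' {u v} hu hv := NegOn.add isOpen_univ (fun ε => (u.2.1 ε).contDiffOn)
    (fun ε => (v.2.1 ε).contDiffOn) hu hv
  smul_mem' c u hu := by
    have h : NegOn (fun ε x => (u : Eps → E → ℂ) ε x * (c : Eps → E → ℂ) ε x) univ :=
      NegOn.bilin (ContinuousLinearMap.mul ℝ ℂ) u.2.1 c.2.1 hu c.2.2
    have e : ((c • u : moderateNets E) : Eps → E → ℂ) =
        fun ε x => (u : Eps → E → ℂ) ε x * (c : Eps → E → ℂ) ε x := by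
      funext ε x
      exact mul_comm _ _
    change NegOn ((c • u : moderateNets E) : Eps → E → ℂ) univ
    rw [e]
    exact h

variable (E) in
/-- The Colombeau algebra `𝒢(E)` of generalised functions on `E`. -/
def Gen : Type := moderateNets E ⧸ negligibleNets E

noncomputable instance : CommRing (Gen E) :=
  inferInstanceAs (CommRing (moderateNets E ⧸ negligibleNets E))

noncomputable instance : Algebra ℂ (Gen E) :=
  inferInstanceAs (Algebra ℂ (moderateNets E ⧸ negligibleNets E))

/-- The class of a moderate net. -/
noncomputable def Gen.mk (u : moderateNets E) : Gen E := Ideal.Quotient.mk (negligibleNets E) u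

lemma Gen.mk_surjective : Function.Surjective (Gen.mk (E := E)) := Ideal.Quotient.mk_surjective

lemma Gen.mk_eq_iff {u v : moderateNets E} : Gen.mk u = Gen.mk v ↔
    NegOn (fun ε x => (u : Eps → E → ℂ) ε x - (v : Eps → E → ℂ) ε x) univ := Ideal.Quotient.eq

/-- The net `u` is a representative of the generalised function `w`. -/
def IsRep (u : Eps → E → ℂ) (w : Gen E) : Prop :=
  ∃ h : u ∈ moderateNets E, Gen.mk ⟨u, h⟩ = w

/-- Extension of an operation on nets to classes. -/
noncomputable def Gen.map (T : (Eps → E → ℂ) → (Eps → E' → ℂ))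
    (hT : ∀ u ∈ moderateNets E, T u ∈ moderateNets E')
    (hN : ∀ u ∈ moderateNets E, ∀ v ∈ moderateNets E, NegOn (fun ε x => u ε x - v ε x) univ →
      NegOn (fun ε x => T u ε x - T v ε x) univ) : Gen E → Gen E' := fun w =>
  Quotient.liftOn' w (fun u : moderateNets E => Gen.mk ⟨T u, hT u u.2⟩) <| by
    intro u v huv
    have h : Gen.mk u = Gen.mk v := Quotient.sound' huv
    exact Gen.mk_eq_iff.2 (hN u u.2 v v.2 (Gen.mk_eq_iff.1 h))

lemma Gen.map_mk (T : (Eps → E → ℂ) → (Eps → E' → ℂ)) (hT) (hN) (u : moderateNets E) :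
    Gen.map T hT hN (Gen.mk u) = Gen.mk ⟨T u, hT u u.2⟩ := rfl

/-- The generalised function given by a smooth function. -/
noncomputable def Gen.ofSmooth (f : E → ℂ) (hf : ContDiff ℝ ∞ f) : Gen E :=
  Gen.mk ⟨fun _ => f, mem_moderateNets.2 ⟨fun _ => hf, modOn_const hf univ⟩⟩

/-- The directional derivative `∂_v`. -/
noncomputable def Gen.pderiv (v : E) : Gen E → Gen E :=
  Gen.map (fun u ε x => fderiv ℝ (u ε) x v)
    (fun u hu => mem_moderateNets.2 ⟨fun ε => (contDiff_fderiv (hu.1 ε)).clm_apply contDiff_const,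
      ModOn.bilin (ContinuousLinearMap.id ℝ (E →L[ℝ] ℂ)) (fun ε => contDiff_fderiv (hu.1 ε))
        (fun _ => contDiff_const) hu.2.fderiv (modOn_const (f := fun _ => v) contDiff_const univ)⟩)
    (fun u hu w hw h => by
      have h1 := NegOn.bilin (ContinuousLinearMap.id ℝ (E →L[ℝ] ℂ))
        (fun ε => contDiff_fderiv ((hu.1 ε).sub (hw.1 ε)))
        (fun _ => contDiff_const) h.fderiv (modOn_const (f := fun _ => v) contDiff_const univ)
      convert h1 using 3 with ε x
      rw [fderiv_fun_sub (((hu.1 ε).differentiable (by simp)) x)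
        (((hw.1 ε).differentiable (by simp)) x)]
      simp)

/-- `w` is real valued: it is represented by a net of real valued functions. -/
def Gen.RealValued (w : Gen E) : Prop := ∃ u, IsRep u w ∧ ∀ ε x, (u ε x).im = 0

/-- `w` is of logarithmic type. -/
def Gen.LogType (w : Gen E) : Prop :=
  ∃ u, IsRep u w ∧ ∀ K : Set E, IsCompact K →
    ∃ C : ℝ, ∀ᶠ ε in eps0, ∀ x ∈ K, ‖u ε x‖ ≤ C * Real.log ((ε : ℝ)⁻¹)

/-- `w` is of slow scale logarithmic type. -/
def Gen.SlowScaleLogType (w : Gen E) : Prop :=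
  ∃ u, IsRep u w ∧ ∀ K : Set E, IsCompact K →
    ∃ r : Eps → ℝ, IsSlowScale r ∧ (∀ ε, 1 ≤ r ε) ∧
      ∃ C : ℝ, ∀ᶠ ε in eps0, ∀ x ∈ K, ‖u ε x‖ ≤ C * Real.log (r ε)

/-- `w` is slow scale regular. -/
def Gen.SlowScaleRegular (w : Gen E) : Prop := ∃ u, IsRep u w ∧ SlowScaleOn u univ

/-- The restriction of `w` to the open set `V` vanishes in `𝒢(V)`. -/
def Gen.VanishesOn (w : Gen E) (V : Set E) : Prop := ∃ u, IsRep u w ∧ NegOn u V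

/-- The support: the complement of the points with an open neighbourhood on which `w` vanishes. -/
def Gen.supp (w : Gen E) : Set E := {z | ∃ V : Set E, IsOpen V ∧ z ∈ V ∧ w.VanishesOn V}ᶜ

end Algebra

/-! ### c-bounded generalised maps -/

section Maps

variable {E : Type} [NormedAddCommGroup E] [NormedSpace ℝ E]
  {E' : Type} [NormedAddCommGroup E'] [NormedSpace ℝ E']
  {E'' : Type} [NormedAddCommGroup E''] [NormedSpace ℝ E'']

variable (E E') in
/-- c-bounded moderate nets of smooth maps `E → E'`. -/
structure MapNet : Type where
  net : Eps → E → E'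
  smooth : ∀ ε, ContDiff ℝ ∞ (net ε)
  moderate : ModOn net univ
  cBounded : CBounded net

instance mapSetoid : Setoid (MapNet E E') where
  r u v := NegOn (fun ε x => u.net ε x - v.net ε x) univ
  iseqv :=
    { refl := fun u => by simpa using negOn_zero (E := E) (F := E') univ
      symm := fun {u v} h => by simpa using h.neg
      trans := fun {u v w} h1 h2 => by
        simpa using NegOn.add isOpen_univ (fun ε => ((u.smooth ε).sub (v.smooth ε)).contDiffOn)
          (fun ε => ((v.smooth ε).sub (w.smooth ε)).contDiffOn) h1 h2 }

variable (E E') in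
/-- c-bounded generalised maps from `E` to `E'`: classes of c-bounded moderate nets modulo
negligible nets. These are the generalised maps with which generalised functions on `E'` can be
composed. -/
def GMap : Type := Quotient (mapSetoid (E := E) (E' := E'))

/-- The net that does not depend on `ε`. -/
def MapNet.const (f : E → E') (hf : ContDiff ℝ ∞ f) : MapNet E E' where
  net _ := f
  smooth _ := hf
  moderate := modOn_const hf univ
  cBounded := cBounded_const hf.continuous

/-- Composition of nets. -/
def MapNet.comp (u : MapNet E' E'') (f : MapNet E E') : MapNet E E'' where
  net ε x := u.net ε (f.net ε x)
  smooth ε := (u.smooth ε).comp (f.smooth ε)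
  moderate := ModOn.comp u.smooth f.smooth u.moderate f.moderate f.cBounded
  cBounded := u.cBounded.comp f.cBounded

/-- The generalised map given by a smooth map. -/
noncomputable def GMap.ofSmooth (f : E → E') (hf : ContDiff ℝ ∞ f) : GMap E E' :=
  Quotient.mk _ (MapNet.const f hf)

/-- The composition `w ∘ f` with a c-bounded net. -/
noncomputable def Gen.compNet (w : Gen E') (f : MapNet E E') : Gen E :=
  Gen.map (fun u ε x => u ε (f.net ε x))
    (fun u hu => mem_moderateNets.2 ⟨fun ε => (hu.1 ε).comp (f.smooth ε),
      ModOn.comp hu.1 f.smooth hu.2 f.moderate f.cBounded⟩)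
    (fun u hu v hv h =>
      NegOn.comp (u := fun ε x => u ε x - v ε x) (f := f.net)
        (fun ε => (hu.1 ε).sub (hv.1 ε)) f.smooth h f.moderate f.cBounded) w

lemma Gen.compNet_congr [ProperSpace E'] (w : Gen E') {f g : MapNet E E'}
    (hfg : NegOn (fun ε x => f.net ε x - g.net ε x) univ) : w.compNet f = w.compNet g := by
  obtain ⟨u, rfl⟩ := Gen.mk_surjective w
  have h := NegOn.comp_sub (u := (u : Eps → E' → ℂ)) (f := f.net) (g := g.net) u.2.1 u.2.2
    f.smooth g.smooth f.moderate g.moderate f.cBounded g.cBounded hfg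
  unfold Gen.compNet
  rw [Gen.map_mk, Gen.map_mk, Gen.mk_eq_iff]
  exact h

/-- The composition `w ∘ Γ` of a generalised function with a c-bounded generalised map. -/
noncomputable def Gen.comp [ProperSpace E'] (w : Gen E') (Γ : GMap E E') : Gen E :=
  Quotient.liftOn Γ w.compNet fun _ _ hfg => w.compNet_congr hfg

/-- The composition of c-bounded generalised maps. -/
noncomputable def GMap.comp [ProperSpace E'] (Λ : GMap E' E'') (Γ : GMap E E') : GMap E E'' :=
  Quotient.map₂ MapNet.comp (by
    intro u v huv f g hfg
    have h1 := NegOn.comp (fun ε => (u.smooth ε).sub (v.smooth ε)) f.smooth huv f.moderate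
      f.cBounded
    have h2 := NegOn.comp_sub v.smooth v.moderate f.smooth g.smooth f.moderate g.moderate
      f.cBounded g.cBounded hfg
    have h3 := NegOn.add isOpen_univ
      (fun ε => (((u.smooth ε).comp (f.smooth ε)).sub ((v.smooth ε).comp (f.smooth ε))).contDiffOn)
      (fun ε => (((v.smooth ε).comp (f.smooth ε)).sub ((v.smooth ε).comp (g.smooth ε))).contDiffOn)
      h1 h2
    change NegOn (fun ε x => u.net ε (f.net ε x) - v.net ε (g.net ε x)) univ
    simpa using h3) Λ Γ

lemma ModOn.prodMk {u : Eps → E → E'} {v : Eps → E → E''} (su : ∀ ε, ContDiff ℝ ∞ (u ε))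
    (sv : ∀ ε, ContDiff ℝ ∞ (v ε)) (hu : ModOn u univ) (hv : ModOn v univ) :
    ModOn (fun ε x => (u ε x, v ε x)) univ := fun K hK hc k =>
  ((hu K hK hc k).add (hv K hK hc k)).mono fun ε x _ => by
    rw [iteratedFDeriv_prodMk (su ε).contDiffAt (sv ε).contDiffAt (by exact_mod_cast le_top),
      ContinuousMultilinearMap.opNorm_prod]
    exact max_le_add_of_nonneg (norm_nonneg _) (norm_nonneg _)

lemma NegOn.prodMk {u : Eps → E → E'} {v : Eps → E → E''} (su : ∀ ε, ContDiff ℝ ∞ (u ε))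
    (sv : ∀ ε, ContDiff ℝ ∞ (v ε)) (hu : NegOn u univ) (hv : NegOn v univ) :
    NegOn (fun ε x => (u ε x, v ε x)) univ := fun K hK hc k =>
  ((hu K hK hc k).add (hv K hK hc k)).mono fun ε x _ => by
    rw [iteratedFDeriv_prodMk (su ε).contDiffAt (sv ε).contDiffAt (by exact_mod_cast le_top),
      ContinuousMultilinearMap.opNorm_prod]
    exact max_le_add_of_nonneg (norm_nonneg _) (norm_nonneg _)

/-- Pairing of nets. -/
def MapNet.prod (u : MapNet E E') (v : MapNet E E'') : MapNet E (E' × E'') where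
  net ε x := (u.net ε x, v.net ε x)
  smooth ε := (u.smooth ε).prodMk (v.smooth ε)
  moderate := ModOn.prodMk u.smooth v.smooth u.moderate v.moderate
  cBounded K hK := by
    obtain ⟨L, hL, h1⟩ := u.cBounded K hK
    obtain ⟨M, hM, h2⟩ := v.cBounded K hK
    refine ⟨L ×ˢ M, hL.prod hM, ?_⟩
    filter_upwards [h1, h2] with ε a b x hx using ⟨a hx, b hx⟩

/-- The generalised map `x ↦ (Γ(x), Λ(x))`. -/
noncomputable def GMap.prod (Γ : GMap E E') (Λ : GMap E E'') : GMap E (E' × E'') :=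
  Quotient.map₂ MapNet.prod (by
    intro u u' hu v v' hv
    exact NegOn.prodMk (fun ε => (u.smooth ε).sub (u'.smooth ε))
      (fun ε => (v.smooth ε).sub (v'.smooth ε)) hu hv) Γ Λ

end Maps

/-! ### Primitives in time -/

section Primitive

variable {E : Type} [NormedAddCommGroup E] [NormedSpace ℝ E] [ProperSpace E]

lemma intervalIntegral_eq_unit (f : ℝ → ℂ) (t : ℝ) :
    ∫ τ in (0 : ℝ)..t, f τ = (t : ℂ) * ∫ s in (0 : ℝ)..1, f (t * s) := by
  have := intervalIntegral.smul_integral_comp_mul_left (a := 0) (b := 1) f t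
  simp only [mul_zero, mul_one] at this
  rw [← this, Complex.real_smul]

lemma rescale_contDiff : ContDiff ℝ ∞ fun z : (ℝ × E) × ℝ => (z.1.1 * z.2, z.1.2) := by fun_prop

lemma timeCoord_contDiff : ContDiff ℝ ∞ fun z : ℝ × E => (z.1 : ℂ) :=
  Complex.ofRealCLM.contDiff.comp contDiff_fst

/-- The primitive `(t, x) ↦ ∫₀ᵗ w(τ, x) dτ`. -/
noncomputable def Gen.primitive : Gen (ℝ × E) → Gen (ℝ × E) :=
  Gen.map (fun u ε z => ∫ τ in (0 : ℝ)..z.1, u ε (τ, z.2))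
    (fun u hu => by
      have s1 : ∀ ε, ContDiff ℝ ∞ fun z : (ℝ × E) × ℝ => u ε (z.1.1 * z.2, z.1.2) :=
        fun ε => (hu.1 ε).comp rescale_contDiff
      have m1 := ModOn.comp hu.1 (fun _ => rescale_contDiff) hu.2 (modOn_const rescale_contDiff univ)
        (cBounded_const rescale_contDiff.continuous)
      have s2 := fun ε => contDiff_unitIntegral (s1 ε)
      have m2 := ModOn.unitIntegral s1 m1
      have e : (fun (ε : Eps) (z : ℝ × E) => ∫ τ in (0 : ℝ)..z.1, u ε (τ, z.2)) = fun ε z =>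
          (z.1 : ℂ) * ∫ s in (0 : ℝ)..1, u ε (z.1 * s, z.2) := by
        funext ε z
        exact intervalIntegral_eq_unit _ _
      rw [e]
      exact mem_moderateNets.2 ⟨fun ε => timeCoord_contDiff.mul (s2 ε), ModOn.bilin (ContinuousLinearMap.mul ℝ ℂ)
        (fun _ => timeCoord_contDiff) s2 (modOn_const timeCoord_contDiff univ) m2⟩)
    (fun u hu v hv h => by
      have s0 := fun ε => (hu.1 ε).sub (hv.1 ε)
      have s1 : ∀ ε, ContDiff ℝ ∞ fun z : (ℝ × E) × ℝ =>
          u ε (z.1.1 * z.2, z.1.2) - v ε (z.1.1 * z.2, z.1.2) :=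
        fun ε => (s0 ε).comp rescale_contDiff
      have m1 := NegOn.comp s0 (fun _ => rescale_contDiff) h (modOn_const rescale_contDiff univ)
        (cBounded_const rescale_contDiff.continuous)
      have s2 := fun ε => contDiff_unitIntegral (s1 ε)
      have m2 := NegOn.unitIntegral s1 m1
      have m3 := NegOn.bilin (ContinuousLinearMap.mul ℝ ℂ).flip s2 (fun _ => timeCoord_contDiff)
        m2 (modOn_const timeCoord_contDiff univ)
      convert m3 using 3 with ε z
      have cu : Continuous fun τ : ℝ => u ε (τ, z.2) := (hu.1 ε).continuous.comp (by fun_prop)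
      have cv : Continuous fun τ : ℝ => v ε (τ, z.2) := (hv.1 ε).continuous.comp (by fun_prop)
      rw [← intervalIntegral.integral_sub (cu.intervalIntegrable _ _) (cv.intervalIntegrable _ _),
        intervalIntegral_eq_unit]
      simp [mul_comm])

end Primitive

/-! ### Generalised phases and Fourier integral operators -/

/-- Euclidean space `ℝⁿ`. -/
abbrev X (n : ℕ) : Type := EuclideanSpace ℝ (Fin n)

section Fourier

/-- The set of `((t, x), η)` with `η ≠ 0`. -/
def nonzeroFreq (n : ℕ) : Set ((ℝ × X n) × X n) := {p | p.2 ≠ 0}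

lemma isOpen_nonzeroFreq (n : ℕ) : IsOpen (nonzeroFreq n) :=
  isOpen_compl_singleton.preimage continuous_snd

/-- Moderate nets of real functions `φ_ε((t, x), η)`, smooth for `η ≠ 0` and positively homogeneous
of degree one in `η`. By homogeneity, the suprema over compact `K` and `η ≠ 0` of
`|η| ^ (|α| - 1) |∂_η^α ∂_{(t,x)}^β φ_ε|`, that is, the seminorms of `S¹_hg`, are equivalent to
suprema of derivatives of `φ_ε` over compact subsets of `{η ≠ 0}`. -/
structure PhaseNet (n : ℕ) : Type where
  net : Eps → (ℝ × X n) × X n → ℝ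
  smooth : ∀ ε, ContDiffOn ℝ ∞ (net ε) (nonzeroFreq n)
  homogeneous : ∀ ε z η, ∀ c : ℝ, 0 ≤ c → net ε (z, c • η) = c * net ε (z, η)
  moderate : ModOn net (nonzeroFreq n)

instance phaseSetoid (n : ℕ) : Setoid (PhaseNet n) where
  r φ ψ := NegOn (fun ε p => φ.net ε p - ψ.net ε p) (nonzeroFreq n)
  iseqv :=
    { refl := fun φ => by simpa using negOn_zero (F := ℝ) (nonzeroFreq n)
      symm := fun {φ ψ} h => by simpa using h.neg
      trans := fun {φ ψ χ} h1 h2 => by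
        simpa using NegOn.add (isOpen_nonzeroFreq n) (fun ε => (φ.smooth ε).sub (ψ.smooth ε))
          (fun ε => (ψ.smooth ε).sub (χ.smooth ε)) h1 h2 }

/-- Real valued generalised symbols in `((t, x), η)`, homogeneous of degree one in `η`:
the real elements of the space of generalised functions based on `S¹_hg`. -/
def Phase (n : ℕ) : Type := Quotient (phaseSetoid n)

/-- The phase `φ` is slow scale regular: it has a representative with slow scale seminorms. -/
def Phase.SlowScaleRegular {n : ℕ} (φ : Phase n) : Prop :=
  ∃ p : PhaseNet n, Quotient.mk (phaseSetoid n) p = φ ∧ SlowScaleOn p.net (nonzeroFreq n)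

lemma sum_eq_innerSL {n : ℕ} (f : ℝ × X n → X n) :
    (fun p : (ℝ × X n) × X n => ∑ h : Fin n, f p.1 h * p.2 h) =
      fun p => innerSL ℝ (f p.1) p.2 := by
  funext p
  simp [PiLp.inner_apply, mul_comm]

lemma contDiff_linear {n : ℕ} {f : ℝ × X n → X n} (hf : ContDiff ℝ ∞ f) :
    ContDiff ℝ ∞ fun p : (ℝ × X n) × X n => ∑ h : Fin n, f p.1 h * p.2 h := by
  rw [sum_eq_innerSL]
  exact contDiff_bilin (innerSL ℝ) (hf.comp contDiff_fst) contDiff_snd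

lemma ModOn.linear {n : ℕ} {u : Eps → ℝ × X n → X n} (su : ∀ ε, ContDiff ℝ ∞ (u ε))
    (hu : ModOn u univ) :
    ModOn (fun ε (p : (ℝ × X n) × X n) => ∑ h : Fin n, u ε p.1 h * p.2 h) univ := by
  have e : (fun (ε : Eps) (p : (ℝ × X n) × X n) => ∑ h : Fin n, u ε p.1 h * p.2 h) =
      fun ε p => innerSL ℝ (u ε p.1) p.2 := funext fun ε => sum_eq_innerSL (u ε)
  rw [e]
  have m1 : ModOn (fun ε (p : (ℝ × X n) × X n) => u ε p.1) univ :=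
    ModOn.comp su (fun _ => contDiff_fst) hu (modOn_const contDiff_fst univ)
      (cBounded_const continuous_fst)
  have m2 : ModOn (fun (_ : Eps) (p : (ℝ × X n) × X n) => p.2) univ :=
    modOn_const contDiff_snd univ
  exact ModOn.bilin (innerSL ℝ) (u := fun ε (p : (ℝ × X n) × X n) => u ε p.1)
    (v := fun _ p => p.2) (fun ε => (su ε).comp contDiff_fst) (fun _ => contDiff_snd) m1 m2

lemma NegOn.linear {n : ℕ} {u : Eps → ℝ × X n → X n} (su : ∀ ε, ContDiff ℝ ∞ (u ε))
    (hu : NegOn u univ) :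
    NegOn (fun ε (p : (ℝ × X n) × X n) => ∑ h : Fin n, u ε p.1 h * p.2 h) univ := by
  have e : (fun (ε : Eps) (p : (ℝ × X n) × X n) => ∑ h : Fin n, u ε p.1 h * p.2 h) =
      fun ε p => innerSL ℝ (u ε p.1) p.2 := funext fun ε => sum_eq_innerSL (u ε)
  rw [e]
  have m1 : NegOn (fun ε (p : (ℝ × X n) × X n) => u ε p.1) univ :=
    NegOn.comp su (fun _ => contDiff_fst) hu (modOn_const contDiff_fst univ)
      (cBounded_const continuous_fst)
  have m2 : ModOn (fun (_ : Eps) (p : (ℝ × X n) × X n) => p.2) univ :=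
    modOn_const contDiff_snd univ
  exact NegOn.bilin (innerSL ℝ) (u := fun ε (p : (ℝ × X n) × X n) => u ε p.1)
    (v := fun _ p => p.2) (fun ε => (su ε).comp contDiff_fst) (fun _ => contDiff_snd) m1 m2

/-- The net `∑ₕ (f_ε)ₕ(t, x) ηₕ`. -/
noncomputable def PhaseNet.linear {n : ℕ} (f : MapNet (ℝ × X n) (X n)) : PhaseNet n where
  net ε p := ∑ h : Fin n, f.net ε p.1 h * p.2 h
  smooth ε := (contDiff_linear (f.smooth ε)).contDiffOn
  homogeneous ε z η c _ := by
    simp only [PiLp.smul_apply, smul_eq_mul, Finset.mul_sum]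
    exact Finset.sum_congr rfl fun h _ => by ring
  moderate := (ModOn.linear f.smooth f.moderate).mono (subset_univ _)

/-- The phase `φ((t, x), η) = ∑ₕ Γₕ(t, x) ηₕ`. -/
noncomputable def Phase.linear {n : ℕ} (Γ : GMap (ℝ × X n) (X n)) : Phase n :=
  Quotient.map PhaseNet.linear (by
    intro f g hfg
    have hfg' : NegOn (fun ε x => f.net ε x - g.net ε x) univ := hfg
    have h := (NegOn.linear (fun ε => (f.smooth ε).sub (g.smooth ε)) hfg').mono
      (subset_univ (nonzeroFreq n))
    have e : (fun (ε : Eps) (p : (ℝ × X n) × X n) =>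
        ∑ h : Fin n, (f.net ε p.1 - g.net ε p.1) h * p.2 h) =
        fun ε p => (PhaseNet.linear f).net ε p - (PhaseNet.linear g).net ε p := by
      funext ε p
      simp [PhaseNet.linear, sub_mul, Finset.sum_sub_distrib]
    rw [e] at h
    exact h) Γ

/-- The Fourier transform `∫ exp(-i y·η) g(y) dy`. -/
noncomputable def fourierHat {n : ℕ} (g : X n → ℂ) (η : X n) : ℂ :=
  ∫ y : X n, Complex.exp (-(Complex.I * (inner ℝ y η : ℝ))) * g y

/-- `(2π)⁻ⁿ ∫ exp(i φ(t, x, η)) b(t, x) v(t, ·)^(η) dη`. -/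
noncomputable def oscInt {n : ℕ} (φ : (ℝ × X n) × X n → ℝ) (b v : ℝ × X n → ℂ)
    (z : ℝ × X n) : ℂ :=
  (((2 * Real.pi) ^ n : ℝ) : ℂ)⁻¹ *
    ∫ η : X n, Complex.exp (Complex.I * (φ (z, η) : ℝ)) * b z * fourierHat (fun y => v (z.1, y)) η

/-- The generalised function `w` on `ℝ × ℝⁿ` is compactly supported with respect to `x`. -/
def CompactlySupportedInX {n : ℕ} (w : Gen (ℝ × X n)) : Prop :=
  ∃ K : Set (X n), IsCompact K ∧ w.supp ⊆ univ ×ˢ K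

/-- `w(t, ·) = F_φ(b)(t)(v(t, ·))`: the generalised function `w` is the class of the oscillatory
integrals formed with representatives of the phase `φ`, the symbol `b` and the argument `v`, where
the representative of `v` vanishes for `x` outside a fixed compact set. -/
def IsFourierIntegral {n : ℕ} (φ : Phase n) (b v w : Gen (ℝ × X n)) : Prop :=
  CompactlySupportedInX v ∧
  ∃ (p : PhaseNet n) (β ν : Eps → ℝ × X n → ℂ),
    Quotient.mk (phaseSetoid n) p = φ ∧ IsRep β b ∧ IsRep ν v ∧
    (∃ K : Set (X n), IsCompact K ∧ ∀ ε t, ∀ x ∉ K, ν ε (t, x) = 0) ∧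
    IsRep (fun ε => oscInt (p.net ε) (β ε) (ν ε)) w

end Fourier

/-! ### The Cauchy problem -/

section Cauchy

variable {n : ℕ}

/-- `D_t = -i ∂_t`. -/
noncomputable def Dt (u : Gen (ℝ × X n)) : Gen (ℝ × X n) :=
  (-Complex.I) • u.pderiv ((1 : ℝ), (0 : X n))

/-- `∂_j = ∂_{x_j}`. -/
noncomputable def partialX (j : Fin n) (u : Gen (ℝ × X n)) : Gen (ℝ × X n) :=
  u.pderiv ((0 : ℝ), EuclideanSpace.single j (1 : ℝ))

/-- `D_j = -i ∂_j`. -/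
noncomputable def Dx (j : Fin n) (u : Gen (ℝ × X n)) : Gen (ℝ × X n) :=
  (-Complex.I) • partialX j u

/-- The restriction `u(0, ·)`. -/
noncomputable def atZero (u : Gen (ℝ × X n)) : Gen (X n) :=
  u.comp (GMap.ofSmooth (fun x => ((0 : ℝ), x)) (by fun_prop))

/-- `u` solves `D_t u = ∑ⱼ a₁ⱼ D_j u + a₀ u + f`, `u(0, ·) = u₀`. -/
def IsSolution (a1 : Fin n → Gen (ℝ × X n)) (a0 f : Gen (ℝ × X n)) (u0 : Gen (X n))
    (u : Gen (ℝ × X n)) : Prop :=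
  Dt u = ∑ j, a1 j * Dx j u + a0 * u + f ∧ atZero u = u0

lemma coord_contDiff (h : Fin n) : ContDiff ℝ ∞ fun x : X n => ((x h : ℝ) : ℂ) :=
  Complex.ofRealCLM.contDiff.comp (by fun_prop)

/-- The component `γ_h` of `γ = γ(x, t, s)`. -/
noncomputable def component (h : Fin n) (γ : GMap (X n × ℝ × ℝ) (X n)) : Gen (X n × ℝ × ℝ) :=
  (Gen.ofSmooth (fun x : X n => ((x h : ℝ) : ℂ)) (coord_contDiff h)).comp γ

/-- `γ(x, t, s)` is the characteristic curve: `∂_s γ_h = -a₁ₕ(s, γ)`, `γ(x, t, t) = x`. -/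
def IsCharacteristic (a1 : Fin n → Gen (ℝ × X n)) (γ : GMap (X n × ℝ × ℝ) (X n)) : Prop :=
  (∀ h, (component h γ).pderiv ((0 : X n), (0 : ℝ), (1 : ℝ)) =
    -(a1 h).comp ((GMap.ofSmooth (fun z : X n × ℝ × ℝ => z.2.2) (by fun_prop)).prod γ)) ∧
  γ.comp (GMap.ofSmooth (fun z : X n × ℝ => (z.1, z.2, z.2)) (by fun_prop)) =
    GMap.ofSmooth (fun z : X n × ℝ => z.1) (by fun_prop)

/-- The phase `φ(t, x, η) = ∑ₕ γ_h(x, t, 0) ηₕ`. -/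
noncomputable def phaseOf (γ : GMap (X n × ℝ × ℝ) (X n)) : Phase n :=
  Phase.linear (γ.comp (GMap.ofSmooth (fun z : ℝ × X n => (z.2, z.1, (0 : ℝ))) (by fun_prop)))

/-- The generalised map `(τ, y) ↦ (τ, γ(y, 0, τ))`. -/
noncomputable def flowOut (γ : GMap (X n × ℝ × ℝ) (X n)) : GMap (ℝ × X n) (ℝ × X n) :=
  (GMap.ofSmooth (fun z : ℝ × X n => z.1) (by fun_prop)).prod
    (γ.comp (GMap.ofSmooth (fun z : ℝ × X n => (z.2, (0 : ℝ), z.1)) (by fun_prop)))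

/-- `(t, y) ↦ u₀(y) + i ∫₀ᵗ f(τ, γ(y, 0, τ)) / b(τ, γ(y, 0, τ)) dτ`. -/
noncomputable def duhamel (γ : GMap (X n × ℝ × ℝ) (X n)) (b f : Gen (ℝ × X n)) (u0 : Gen (X n)) :
    Gen (ℝ × X n) :=
  u0.comp (GMap.ofSmooth (fun z : ℝ × X n => z.2) (by fun_prop)) +
    Complex.I • Gen.primitive (Ring.inverse (b.comp (flowOut γ)) * f.comp (flowOut γ))

/-- Hypothesis on the principal coefficients: real valued, compactly supported in `x`, with
`∂_k a₁ⱼ` of logarithmic type. -/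
def HypH1 (a1 : Fin n → Gen (ℝ × X n)) : Prop :=
  ∀ j, (a1 j).RealValued ∧ CompactlySupportedInX (a1 j) ∧ ∀ k, (partialX k (a1 j)).LogType

/-- The slow scale version of `HypH1`. -/
def HypH2 (a1 : Fin n → Gen (ℝ × X n)) : Prop :=
  ∀ j, (a1 j).RealValued ∧ (a1 j).SlowScaleRegular ∧ CompactlySupportedInX (a1 j) ∧
    ∀ k, (partialX k (a1 j)).SlowScaleLogType

/-- Hypothesis on the zeroth order coefficient: compactly supported in `x` and of logarithmic
type. -/
def HypI1 (a0 : Gen (ℝ × X n)) : Prop := CompactlySupportedInX a0 ∧ a0.LogType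

/-- The slow scale version of `HypI1`. -/
def HypI2 (a0 : Gen (ℝ × X n)) : Prop :=
  a0.SlowScaleRegular ∧ CompactlySupportedInX a0 ∧ a0.SlowScaleLogType

/-- The characteristic curve `γ`, the symbol `b` and the solution `u` exist and are unique, the
quotient in the formula makes sense, and
`u(t, ·) = F_φ(b)(t)(u₀ + i ∫₀ᵗ f(τ, γ(·, 0, τ)) / b(τ, γ(·, 0, τ)) dτ)` with `φ = phaseOf γ`. -/
def SolutionFormula (a1 : Fin n → Gen (ℝ × X n)) (a0 f : Gen (ℝ × X n)) (u0 : Gen (X n)) : Prop :=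
  (∃! γ, IsCharacteristic a1 γ) ∧ (∃! b, IsSolution a1 a0 0 1 b) ∧
  (∃! u, IsSolution a1 a0 f u0 u) ∧
  ∀ γ b u, IsCharacteristic a1 γ → IsSolution a1 a0 0 1 b → IsSolution a1 a0 f u0 u →
    IsUnit (b.comp (flowOut γ)) ∧ IsFourierIntegral (phaseOf γ) b (duhamel γ b f u0) u

end Cauchy

end Colombeau

open Colombeau

namespace Colombeau

/-! ### Ordinary differential equations -/

section ODE

open scoped NNReal
open Function

/-! The problem is solved by characteristics, exactly for each `ε`; the real work is the growth as
`ε → 0`. Multiplied by `i`, the equation reads `∂_t u - Σ a_j ∂_j u = i a₀ u + i f`. The `a_j` are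
real and compactly supported in `x`, so cutting off gives real representatives that vanish for `x`
outside a fixed compact set `K`. Their flow `γ` is global and smooth, and since points outside `K`
are equilibria, `γ` is c-bounded without any bound on the `a_j`. In coordinates `(t, y)` with `x =
γ(y, 0, t)` the left side becomes `∂_t`. Hence, with `e(t, y) = exp (i ∫₀ᵗ a₀(τ, γ(y, 0, τ)) dτ)`
and `v = u₀ + i ∫₀ᵗ f(τ, γ(·, 0, τ)) / e dτ`, one finds `b(t, x) = e(t, γ(x, t, 0))` and `u(t, x) =
b(t, x) v(t, γ(x, t, 0))`. The phase is linear in `η`, so Fourier inversion turns `F_φ(b) v` into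
exactly this product (`oscInt_linear`): on these representatives the formula holds without error.

The growth estimates rest on `ScaleOrd.of_linear_ode`. For `∂_s v = M v + g`, Grönwall costs a
factor `exp (T sup ‖M‖)`. A derivative of `v` solves an equation with the same `M` and a source
containing only lower derivatives of `v`, so the exponential never sees more than `M` itself. For
derivatives of the flow `M` is `-∂ₓa`, for `e` it is `i a₀`; this is why exactly these must be of
logarithmic type. The estimate is stated for a solid ring `S` of nets of numbers and a solid
`S`-module `N`: moderate nets for both give existence, negligible `N` over moderate `S` gives
uniqueness, slow scale nets for both give part (ii).

For uniqueness, the difference of two solutions satisfies a linear equation with negligible data: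
for `u` after pulling back along the flow (`negOn_of_transport`), for `γ` with the space derivative
of `a` averaged over a segment as coefficient (`negOn_sub_of_flow`). Consequently every solution in
`𝒢` is represented by the explicit one. -/

lemma gronwallBound_le {δ K ε x : ℝ} (hK : 0 ≤ K) (hε : 0 ≤ ε) :
    gronwallBound δ K ε x ≤ (δ + ε * x) * Real.exp (K * x) := by
  rcases hK.eq_or_lt with rfl | hK
  · simp [gronwallBound_K0]
  · rw [gronwallBound_of_K_ne_0 hK.ne']
    -- With `y = K x`: multiply `1 - y ≤ exp (-y)` by `exp y`.
    have h : Real.exp (K * x) - 1 ≤ K * x * Real.exp (K * x) := by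
      have h1 := Real.add_one_le_exp (-(K * x))
      have h2 : Real.exp (K * x) * Real.exp (-(K * x)) = 1 := by rw [← Real.exp_add]; simp
      nlinarith [Real.exp_pos (K * x)]
    have h3 : ε / K * (Real.exp (K * x) - 1) ≤ ε / K * (K * x * Real.exp (K * x)) := by gcongr
    have h4 : ε / K * (K * x * Real.exp (K * x)) = ε * x * Real.exp (K * x) := by field_simp
    linarith

/-- Grönwall's inequality in both time directions; negative times follow by reversing time. -/
lemma norm_le_of_norm_deriv_le {F : Type*} [NormedAddCommGroup F] [NormedSpace ℝ F]
    {v v' : ℝ → F} {T K ε : ℝ} (hK : 0 ≤ K) (hε : 0 ≤ ε)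
    (hv : ∀ s, |s| ≤ T → HasDerivAt v (v' s) s)
    (hb : ∀ s, |s| ≤ T → ‖v' s‖ ≤ K * ‖v s‖ + ε) (s : ℝ) (hs : |s| ≤ T) :
    ‖v s‖ ≤ (‖v 0‖ + ε * |s|) * Real.exp (K * |s|) := by
  have key : ∀ (w w' : ℝ → F), (∀ s, |s| ≤ T → HasDerivAt w (w' s) s) →
      (∀ s, |s| ≤ T → ‖w' s‖ ≤ K * ‖w s‖ + ε) → ∀ s, 0 ≤ s → s ≤ T →
      ‖w s‖ ≤ (‖w 0‖ + ε * s) * Real.exp (K * s) := by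
    intro w w' hw hb s h0 hs
    have ha : ∀ x ∈ Icc 0 s, |x| ≤ T := fun x hx => by
      rw [abs_of_nonneg hx.1]; exact hx.2.trans hs
    have := norm_le_gronwallBound_of_norm_deriv_right_le (f := w) (f' := w') (a := 0) (b := s)
      (K := K) (ε := ε) (fun x hx => (hw x (ha x hx)).continuousAt.continuousWithinAt)
      (fun x hx => (hw x (ha x (Ico_subset_Icc_self hx))).hasDerivWithinAt) le_rfl
      (fun x hx => hb x (ha x (Ico_subset_Icc_self hx))) s ⟨h0, le_rfl⟩
    rw [sub_zero] at this
    exact this.trans (gronwallBound_le hK hε)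
  rcases le_total 0 s with h | h
  · rw [abs_of_nonneg h] at hs ⊢
    exact key v v' hv hb s h hs
  · rw [abs_of_nonpos h] at hs ⊢
    have := key (fun s => v (-s)) (fun s => -v' (-s))
      (fun s hs => by
        have := (hv (-s) (by rwa [abs_neg])).scomp s (hasDerivAt_neg s)
        simpa [Function.comp_def] using this)
      (fun s hs => by simpa using hb (-s) (by rwa [abs_neg])) (-s) (by linarith) hs
    simpa using this

variable {E : Type*} [NormedAddCommGroup E] [NormedSpace ℝ E] [FiniteDimensional ℝ E]

/-- Mean value inequality on the compact convex set `[-T, T] × ball`; one constant serves all times,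
as uniqueness and Picard–Lindelöf demand. -/
lemma exists_lipschitzOnWith_closedBall {f : ℝ → E → E} (hf : ContDiff ℝ 1 (uncurry f)) (T R : ℝ) :
    ∃ K : ℝ≥0, ∀ t, |t| ≤ T → LipschitzOnWith K (f t) (Metric.closedBall 0 R) := by
  have hc : IsCompact (Icc (-T) T ×ˢ Metric.closedBall (0 : E) R) :=
    isCompact_Icc.prod (isCompact_closedBall 0 R)
  obtain ⟨C, hC⟩ := hc.exists_bound_of_continuousOn
    (hf.continuous_fderiv (by simp)).continuousOn
  refine ⟨C.toNNReal, fun t ht => LipschitzOnWith.of_dist_le_mul fun x hx y hy => ?_⟩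
  have hcv : Convex ℝ (Icc (-T) T ×ˢ Metric.closedBall (0 : E) R) :=
    (convex_Icc _ _).prod (convex_closedBall _ _)
  have := hcv.norm_image_sub_le_of_norm_fderiv_le (f := uncurry f) (𝕜 := ℝ) (C := C.toNNReal)
    (x := (t, y)) (y := (t, x)) (fun z _ => (hf.differentiable (by simp)) z)
    (fun z hz => (hC z hz).trans (Real.le_coe_toNNReal C)) ⟨abs_le.1 ht, hy⟩ ⟨abs_le.1 ht, hx⟩
  simpa [dist_eq_norm, Prod.norm_def] using this

/-- Uniqueness of solutions for continuously differentiable fields. -/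
lemma ode_unique {f : ℝ → E → E} (hf : ContDiff ℝ 1 (uncurry f)) {c d : ℝ → E} {a b t₀ : ℝ}
    (h0 : t₀ ∈ Ioo a b) (hc : ∀ t ∈ Ioo a b, HasDerivAt c (f t (c t)) t)
    (hd : ∀ t ∈ Ioo a b, HasDerivAt d (f t (d t)) t) (h : c t₀ = d t₀) : EqOn c d (Ioo a b) := by
  intro t ht
  -- Shrink to a compact interval with `t` and `t₀` in its interior: there both curves stay in one
  -- ball, on which the field is Lipschitz.
  obtain ⟨a', ha, ha'⟩ := exists_between (lt_min ht.1 h0.1)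
  obtain ⟨b', hb', hb⟩ := exists_between (max_lt ht.2 h0.2)
  have hs : Icc a' b' ⊆ Ioo a b := fun x hx => ⟨ha.trans_le hx.1, hx.2.trans_lt hb⟩
  obtain ⟨R1, hR1⟩ := isCompact_Icc.exists_bound_of_continuousOn (s := Icc a' b') (f := c)
    (fun x hx => (hc x (hs hx)).continuousAt.continuousWithinAt)
  obtain ⟨R2, hR2⟩ := isCompact_Icc.exists_bound_of_continuousOn (s := Icc a' b') (f := d)
    (fun x hx => (hd x (hs hx)).continuousAt.continuousWithinAt)
  obtain ⟨K, hK⟩ := exists_lipschitzOnWith_closedBall hf (max |a'| |b'|) (max R1 R2)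
  refine ODE_solution_unique_of_mem_Ioo (v := f) (K := K) (t₀ := t₀) (a := a') (b := b')
    (s := fun _ => Metric.closedBall 0 (max R1 R2)) (fun t ht => hK t ?_)
    ⟨ha'.trans_le (min_le_right _ _), (le_max_right _ _).trans_lt hb'⟩
    (fun x hx => ⟨hc x (hs (Ioo_subset_Icc_self hx)), ?_⟩)
    (fun x hx => ⟨hd x (hs (Ioo_subset_Icc_self hx)), ?_⟩) h
    ⟨ha'.trans_le (min_le_left _ _), (le_max_left _ _).trans_lt hb'⟩
  · exact abs_le_max_abs_abs ht.1.le ht.2.le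
  · simpa using Or.inl (hR1 x (Ioo_subset_Icc_self hx))
  · simpa using Or.inr (hR2 x (Ioo_subset_Icc_self hx))

lemma ode_unique_univ {f : ℝ → E → E} (hf : ContDiff ℝ 1 (uncurry f)) {c d : ℝ → E} {t₀ : ℝ}
    (hc : ∀ t, HasDerivAt c (f t (c t)) t)
    (hd : ∀ t, HasDerivAt d (f t (d t)) t) (h : c t₀ = d t₀) : c = d := by
  funext t
  exact ode_unique hf (a := min t t₀ - 1) (b := max t t₀ + 1) (t₀ := t₀)
    ⟨by linarith [min_le_right t t₀], by linarith [le_max_right t t₀]⟩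
    (fun t _ => hc t) (fun t _ => hd t) h
    ⟨by linarith [min_le_left t t₀], by linarith [le_max_left t t₀]⟩

/-- A field of linear growth has integral curves on every bounded time interval. -/
lemma exists_solution_Ioo {f : ℝ → E → E} (hf : ContDiff ℝ 1 (uncurry f)) {N k : ℝ} (hN : 0 < N)
    (hk : ∀ t, |t| ≤ N → ∀ x, ‖f t x‖ ≤ k * (1 + ‖x‖)) (x₀ : E) :
    ∃ c : ℝ → E, c 0 = x₀ ∧ ∀ t ∈ Ioo (-N) N, HasDerivAt c (f t (c t)) t := by
  have hk0 : 0 ≤ k := by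
    have := (norm_nonneg _).trans (hk 0 (by simpa using hN.le) 0)
    simpa using this
  -- `R` exceeds the Grönwall bound up to time `N` for curves with growth constant `k`. The map `ρ`
  -- below is the identity on the ball of radius `R`, Lipschitz, bounded by `R + 1` and satisfies
  -- `‖ρ x‖ ≤ ‖x‖`. Composing the field with `ρ` makes it globally Lipschitz in `x` and bounded by
  -- `k (R + 2)`, and keeps its linear growth bound.
  set R : ℝ := (‖x₀‖ + k * N) * Real.exp (k * N) + 1 with hR
  have hR0 : 0 < R := by positivity
  let χ : ContDiffBump (0 : E) := ⟨R, R + 1, hR0, by linarith⟩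
  let ρ : E → E := fun x => χ x • x
  have hρ : ContDiff ℝ 1 ρ := χ.contDiff.smul contDiff_id
  have hρc : HasCompactSupport ρ := χ.hasCompactSupport.smul_right
  obtain ⟨K2, hK2⟩ := hρ.lipschitzWith_of_hasCompactSupport hρc (by simp)
  have hρle : ∀ x, ‖ρ x‖ ≤ ‖x‖ := fun x => by
    simp only [ρ, norm_smul, Real.norm_eq_abs, abs_of_nonneg χ.nonneg]
    exact mul_le_of_le_one_left (norm_nonneg _) χ.le_one
  have hρR : ∀ x, ‖ρ x‖ ≤ R + 1 := fun x => by
    by_cases hx : ‖x‖ ≤ R + 1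
    · exact (hρle x).trans hx
    · have : χ x = 0 := χ.zero_of_le_dist (by simpa using (not_le.1 hx).le)
      simp only [ρ, this, zero_smul, norm_zero]
      linarith
  obtain ⟨K1, hK1⟩ := exists_lipschitzOnWith_closedBall hf N (R + 1)
  let L : ℝ≥0 := ⟨k * (R + 2), by positivity⟩
  let N' : ℝ≥0 := ⟨N, hN.le⟩
  have h0 : (0 : ℝ) ∈ Icc (-N) N := ⟨by linarith, hN.le⟩
  -- A field bounded by `L` moves a point by at most `L N` in time `N`, so the ball of that radius
  -- allows the whole interval at once.
  have hPL : IsPicardLindelof (fun t x => f t (ρ x)) (tmin := -N) (tmax := N) ⟨0, h0⟩ x₀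
      (L * N') 0 L (K1 * K2) := by
    refine ⟨fun t ht => ?_, fun x _ => ?_, fun t ht x _ => ?_, ?_⟩
    · exact (hK1 t (abs_le.2 ht)).comp hK2.lipschitzOnWith fun x _ => by simpa using hρR x
    · exact (hf.continuous.comp (by fun_prop : Continuous fun t : ℝ => (t, ρ x))).continuousOn
    · refine (hk t (abs_le.2 ht) _).trans ?_
      exact mul_le_mul_of_nonneg_left (by linarith [hρR x]) hk0
    · simp only [sub_zero, zero_sub, neg_neg, max_self, NNReal.coe_zero]
      exact le_rfl
  obtain ⟨c, hc0, hc⟩ := hPL.exists_eq_forall_mem_Icc_hasDerivWithinAt₀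
  have hc' : ∀ t ∈ Ioo (-N) N, HasDerivAt c (f t (ρ (c t))) t := fun t ht =>
    (hc t (Ioo_subset_Icc_self ht)).hasDerivAt (Icc_mem_nhds ht.1 ht.2)
  refine ⟨c, hc0, fun t ht => ?_⟩
  -- The modified field obeys the same growth bound, so its curve never leaves the region where `ρ`
  -- is the identity and solves the original equation.
  have hb : ‖c t‖ ≤ R := by
    have := norm_le_of_norm_deriv_le (v := c) (v' := fun t => f t (ρ (c t))) (T := |t|) hk0 hk0
      (fun s hs => hc' s (abs_lt.1 (hs.trans_lt (abs_lt.2 ht))))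
      (fun s hs => (hk s (hs.trans (abs_lt.2 ht).le) _).trans (by
        have := hρle (c s)
        nlinarith)) t le_rfl
    have hc00 : c 0 = x₀ := hc0
    rw [hc00] at this
    have ht' : |t| ≤ N := (abs_lt.2 ht).le
    calc ‖c t‖ ≤ _ := this
      _ ≤ (‖x₀‖ + k * N) * Real.exp (k * N) := by gcongr
      _ ≤ R := by linarith
  have : ρ (c t) = c t := by
    have : χ (c t) = 1 := χ.one_of_mem_closedBall (by simpa using hb)
    simp [ρ, this]
  simpa [this] using hc' t ht

/-- A field of linear growth has global integral curves. -/
lemma exists_solution {f : ℝ → E → E} (hf : ContDiff ℝ 1 (uncurry f))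
    (hk : ∀ N : ℝ, ∃ k : ℝ, ∀ t, |t| ≤ N → ∀ x, ‖f t x‖ ≤ k * (1 + ‖x‖)) (x₀ : E) :
    ∃ c : ℝ → E, c 0 = x₀ ∧ ∀ t, HasDerivAt c (f t (c t)) t := by
  have H : ∀ N : ℕ, ∃ c : ℝ → E, c 0 = x₀ ∧
      ∀ t ∈ Ioo (-(N + 1 : ℝ)) (N + 1), HasDerivAt c (f t (c t)) t := fun N => by
    obtain ⟨k, hk⟩ := hk (N + 1)
    exact exists_solution_Ioo hf (by positivity) hk x₀
  choose c hc0 hc using H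
  have hm : ∀ {M N : ℕ}, M ≤ N → ∀ t ∈ Ioo (-(M + 1 : ℝ)) (M + 1), c M t = c N t := by
    intro M N hMN t ht
    have hMN' : (M : ℝ) ≤ N := by exact_mod_cast hMN
    refine ode_unique hf (t₀ := 0) ⟨by linarith [M.cast_nonneg (α := ℝ)], by positivity⟩ (hc M)
      (fun t ht => hc N t ⟨by linarith [ht.1], by linarith [ht.2]⟩) ?_ ht
    rw [hc0, hc0]
  refine ⟨fun t => c ⌈|t|⌉₊ t, by simp [hc0], fun t => ?_⟩
  -- The index `⌈|s|⌉₊` jumps at integers; near `t` it is at most `N`, so the glued curve agrees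
  -- there with the single curve `c N`.
  set N : ℕ := ⌈|t|⌉₊ + 1
  have hI : ∀ s : ℝ, s ∈ Ioo (-(⌈|s|⌉₊ + 1 : ℝ)) (⌈|s|⌉₊ + 1) := fun s =>
    abs_lt.1 ((Nat.le_ceil _).trans_lt (lt_add_one _))
  have hev : (fun t => c ⌈|t|⌉₊ t) =ᶠ[𝓝 t] c N := by
    have : ∀ᶠ s : ℝ in 𝓝 t, |s| < (N : ℝ) := by
      refine (continuous_abs.tendsto t).eventually_lt_const ?_
      simp only [N, Nat.cast_add, Nat.cast_one]
      exact (Nat.le_ceil _).trans_lt (lt_add_one _)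
    filter_upwards [this] with s hs
    exact hm (Nat.ceil_le.2 hs.le) s (hI s)
  have h2 : c ⌈|t|⌉₊ t = c N t := hm (by omega) t (hI t)
  refine HasDerivAt.congr_of_eventuallyEq ?_ hev
  simp only [h2]
  refine hc N t ?_
  have := hI t
  simp only [N, Nat.cast_add, Nat.cast_one]
  exact ⟨by linarith [this.1], by linarith [this.2]⟩

end ODE

/-! ### Smooth dependence of flows on time and initial values -/

section Flow

open scoped NNReal
open Function

/-- `Φ` is the global flow of the autonomous field `V`. -/
structure IsGlobalFlow {E : Type*} [NormedAddCommGroup E] [NormedSpace ℝ E] (V : E → E)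
    (Φ : E → ℝ → E) : Prop where
  init : ∀ x, Φ x 0 = x
  deriv : ∀ x t, HasDerivAt (Φ x) (V (Φ x t)) t

variable {E : Type} [NormedAddCommGroup E] [NormedSpace ℝ E] [FiniteDimensional ℝ E]
  {V : E → E} {Φ : E → ℝ → E}

/-- Nearby trajectories stay close on bounded time intervals. -/
lemma IsGlobalFlow.dist_le (hΦ : IsGlobalFlow V Φ) (hV : ContDiff ℝ ∞ V) (x : E) :
    ∃ R C δ : ℝ, 0 ≤ C ∧ 0 < δ ∧ ∀ y, ‖y - x‖ < δ → ∀ s, |s| ≤ 1 →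
      ‖Φ y s‖ ≤ R ∧ ‖Φ y s - Φ x s‖ ≤ C * ‖y - x‖ := by
  -- The window `[-2, 2]` leaves room around `[-1, 1]`. The cut-off field `W` agrees with `V` up to
  -- distance one from the trajectory of `x` and has a global Lipschitz constant `K`. If `‖y - x‖ <
  -- exp (-2K)`, the `W`-trajectory of `y` stays within distance one, hence where `W = V`, and by
  -- uniqueness it is the `V`-trajectory.
  obtain ⟨R0, hR0⟩ := isCompact_Icc.exists_bound_of_continuousOn (s := Icc (-2 : ℝ) 2) (f := Φ x)
    (fun s _ => (hΦ.deriv x s).continuousAt.continuousWithinAt)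
  have hR0' : 0 ≤ R0 := (norm_nonneg _).trans (hR0 0 (by norm_num))
  let χ : ContDiffBump (0 : E) := ⟨R0 + 1, R0 + 2, by linarith, by linarith⟩
  let W : E → E := fun z => χ z • V z
  have hW : ContDiff ℝ 1 W := χ.contDiff.smul (hV.of_le (by exact_mod_cast le_top))
  have hWc : HasCompactSupport W := χ.hasCompactSupport.smul_right
  have hWV : ∀ z, ‖z‖ ≤ R0 + 1 → W z = V z := fun z hz => by
    have : χ z = 1 := χ.one_of_mem_closedBall (by simpa using hz)
    simp [W, this]
  obtain ⟨K, hK⟩ := hW.lipschitzWith_of_hasCompactSupport hWc (by simp)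
  obtain ⟨k, hk⟩ := hW.continuous.bounded_above_of_compact_support hWc
  have hk0 : 0 ≤ k := (norm_nonneg _).trans (hk 0)
  have hf : ContDiff ℝ 1 (uncurry fun (_ : ℝ) z => W z) := hW.comp contDiff_snd
  refine ⟨R0 + 1, Real.exp (K * 2), Real.exp (-(K * 2)), (Real.exp_pos _).le, Real.exp_pos _,
    fun y hy => ?_⟩
  obtain ⟨c, hc0, hc⟩ := exists_solution hf (fun N => ⟨k, fun t _ z => (hk z).trans (by
    nlinarith [norm_nonneg z])⟩) y
  have hx : ∀ s, |s| ≤ 2 → W (Φ x s) = V (Φ x s) := fun s hs =>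
    hWV _ ((hR0 s (abs_le.1 hs)).trans (by linarith))
  have hd : ∀ s, |s| ≤ 2 → ‖c s - Φ x s‖ ≤ Real.exp (K * 2) * ‖y - x‖ := fun s hs => by
    have := norm_le_of_norm_deriv_le (v := fun s => c s - Φ x s)
      (v' := fun s => W (c s) - V (Φ x s)) (T := 2) (K := K) (ε := 0) K.2 le_rfl
      (fun s _ => (hc s).sub (hΦ.deriv x s))
      (fun s hs => by
        rw [← hx s hs, add_zero]
        exact hK.norm_sub_le _ _) s hs
    simp only [hc0, hΦ.init, zero_mul, add_zero] at this
    calc _ ≤ _ := this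
      _ ≤ ‖y - x‖ * Real.exp (K * 2) := by gcongr
      _ = _ := mul_comm _ _
  have hcR : ∀ s, |s| ≤ 2 → ‖c s‖ ≤ R0 + 1 := fun s hs => by
    have h1 : Real.exp (K * 2) * ‖y - x‖ ≤ 1 := by
      calc _ ≤ Real.exp (K * 2) * Real.exp (-(K * 2)) := by gcongr
        _ = 1 := by rw [← Real.exp_add]; simp
    calc ‖c s‖ = ‖(c s - Φ x s) + Φ x s‖ := by simp
      _ ≤ ‖c s - Φ x s‖ + ‖Φ x s‖ := norm_add_le _ _
      _ ≤ _ := by linarith [hd s hs, hR0 s (abs_le.1 hs)]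
  have hV1 : ContDiff ℝ 1 (uncurry fun (_ : ℝ) z => V z) :=
    (hV.of_le (by exact_mod_cast le_top)).comp contDiff_snd
  have heq : EqOn (Φ y) c (Ioo (-2) 2) := ode_unique hV1 (t₀ := 0) (by norm_num)
    (fun t _ => hΦ.deriv y t)
    (fun t ht => by
      have := hc t
      rwa [hWV _ (hcR t (abs_lt.2 ht).le)] at this) (by rw [hc0, hΦ.init])
  intro s hs
  rw [heq (abs_lt.1 (hs.trans_lt one_lt_two))]
  exact ⟨hcR s (hs.trans one_le_two), hd s (hs.trans one_le_two)⟩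

/-- The mean value inequality twice along the segment: for the derivative, then for `V` minus its
linearisation at `a`. -/
lemma norm_taylor_le {R C : ℝ} (hV : ContDiff ℝ ∞ V)
    (hC : ∀ z ∈ Metric.closedBall (0 : E) R, ‖fderiv ℝ (fderiv ℝ V) z‖ ≤ C) {a b : E}
    (ha : a ∈ Metric.closedBall (0 : E) R) (hb : b ∈ Metric.closedBall (0 : E) R) :
    ‖V b - V a - fderiv ℝ V a (b - a)‖ ≤ C * ‖b - a‖ ^ 2 := by
  have hseg : segment ℝ a b ⊆ Metric.closedBall (0 : E) R :=
    (convex_closedBall _ _).segment_subset ha hb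
  have hC0 : 0 ≤ C := (norm_nonneg _).trans (hC a ha)
  have h1 : ∀ z ∈ segment ℝ a b, ‖fderiv ℝ V z - fderiv ℝ V a‖ ≤ C * ‖b - a‖ := fun z hz => by
    have := (convex_segment a b).norm_image_sub_le_of_norm_fderiv_le (𝕜 := ℝ) (f := fderiv ℝ V)
      (fun z _ => ((contDiff_fderiv hV).differentiable (by simp)) z) (fun z hz => hC z (hseg hz))
      (left_mem_segment ℝ a b) hz
    refine this.trans ?_
    have h2 : ‖z - a‖ ≤ ‖b - a‖ := by
      rw [norm_sub_rev z, norm_sub_rev b]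
      obtain ⟨u, v, hu, hv, huv, rfl⟩ := hz
      have : a - (u • a + v • b) = v • (a - b) := by
        rw [show u = 1 - v by linarith]; module
      rw [this, norm_smul, Real.norm_eq_abs, abs_of_nonneg hv]
      exact mul_le_of_le_one_left (norm_nonneg _) (by linarith)
    gcongr
  have := (convex_segment a b).norm_image_sub_le_of_norm_fderiv_le' (𝕜 := ℝ) (f := V)
    (φ := fderiv ℝ V a) (fun z _ => (hV.differentiable (by simp)) z) h1
    (left_mem_segment ℝ a b) (right_mem_segment ℝ a b)
  rw [pow_two, ← mul_assoc]
  exact this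

/-- The variational equation gives the derivative. The remainder `Φ y s - Φ x s - A s (y - x)`
starts at zero and satisfies the linearised equation up to a Taylor error `O(‖y - x‖²)`, so Grönwall
bounds it quadratically. -/
lemma IsGlobalFlow.hasFDerivAt (hΦ : IsGlobalFlow V Φ) (hV : ContDiff ℝ ∞ V) (x : E)
    {A : ℝ → E →L[ℝ] E} (hA0 : A 0 = ContinuousLinearMap.id ℝ E)
    (hA : ∀ s, HasDerivAt A ((fderiv ℝ V (Φ x s)).comp (A s)) s) :
    HasFDerivAt (fun y => Φ y 1) (A 1) x := by
  obtain ⟨R, C, δ, hC, hδ, hR⟩ := hΦ.dist_le hV x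
  obtain ⟨K, hK⟩ := (isCompact_closedBall (0 : E) R).exists_bound_of_continuousOn
    (contDiff_fderiv hV).continuous.continuousOn
  obtain ⟨K2, hK2⟩ := (isCompact_closedBall (0 : E) R).exists_bound_of_continuousOn
    (contDiff_fderiv (contDiff_fderiv hV)).continuous.continuousOn
  have hxR : ∀ s, |s| ≤ 1 → Φ x s ∈ Metric.closedBall (0 : E) R := fun s hs => by
    simpa using (hR x (by simpa using hδ) s hs).1
  have hK0 : 0 ≤ K := (norm_nonneg _).trans (hK _ (hxR 0 (by simp)))
  have hK20 : 0 ≤ K2 := (norm_nonneg _).trans (hK2 _ (hxR 0 (by simp)))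
  have key : ∀ y, ‖y - x‖ < δ →
      ‖Φ y 1 - Φ x 1 - A 1 (y - x)‖ ≤ K2 * C ^ 2 * Real.exp K * ‖y - x‖ ^ 2 := fun y hy => by
    have := norm_le_of_norm_deriv_le (v := fun s => Φ y s - Φ x s - A s (y - x))
      (v' := fun s => V (Φ y s) - V (Φ x s) - (fderiv ℝ V (Φ x s)).comp (A s) (y - x))
      (T := 1) (K := K) (ε := K2 * C ^ 2 * ‖y - x‖ ^ 2) hK0 (by positivity)
      (fun s _ => ((hΦ.deriv y s).sub (hΦ.deriv x s)).sub
        ((hA s).clm_apply (hasDerivAt_const s (y - x)) |>.congr_deriv (by simp)))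
      (fun s hs => by
        have e : V (Φ y s) - V (Φ x s) - (fderiv ℝ V (Φ x s)).comp (A s) (y - x) =
            fderiv ℝ V (Φ x s) (Φ y s - Φ x s - A s (y - x)) +
            (V (Φ y s) - V (Φ x s) - fderiv ℝ V (Φ x s) (Φ y s - Φ x s)) := by
          simp only [ContinuousLinearMap.comp_apply, map_sub]
          abel
        rw [e]
        refine (norm_add_le _ _).trans (add_le_add ?_ ?_)
        · exact (ContinuousLinearMap.le_opNorm _ _).trans (by gcongr; exact hK _ (hxR s hs))
        · refine (norm_taylor_le hV hK2 (hxR s hs) (by simpa using (hR y hy s hs).1)).trans ?_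
          have := (hR y hy s hs).2
          calc K2 * ‖Φ y s - Φ x s‖ ^ 2 ≤ K2 * (C * ‖y - x‖) ^ 2 := by gcongr
            _ = _ := by ring) 1 (by simp)
    simp only [hΦ.init, hA0, ContinuousLinearMap.id_apply, sub_self, norm_zero, abs_one, mul_one,
      zero_add] at this
    linarith
  rw [hasFDerivAt_iff_isLittleO_nhds_zero]
  have hO : (fun h : E => Φ (x + h) 1 - Φ x 1 - A 1 h) =O[𝓝 0] fun h => ‖h‖ ^ 2 := by
    refine Asymptotics.IsBigO.of_bound (K2 * C ^ 2 * Real.exp K) ?_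
    filter_upwards [Metric.ball_mem_nhds (0 : E) hδ] with h hh
    have := key (x + h) (by simpa using hh)
    simpa using this
  exact hO.trans_isLittleO (by
    have := Asymptotics.isLittleO_norm_pow_id (E' := E) one_lt_two
    simpa using this)

/-- The pair (flow, its derivative applied to a matrix) is again the global flow of a smooth field,
on `E × End E`. So the derivative of a time-one map is a component of another time-one map, to which
the induction hypothesis applies; for this reason the space `E` is quantified inside the induction.
-/
lemma IsGlobalFlow.contDiff_time_one (k : ℕ) : ∀ {E : Type} [NormedAddCommGroup E]
    [NormedSpace ℝ E] [FiniteDimensional ℝ E] {V : E → E} {Φ : E → ℝ → E},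
    IsGlobalFlow V Φ → ContDiff ℝ ∞ V → ContDiff ℝ k (fun x => Φ x 1) := by
  have main : ∀ {E : Type} [NormedAddCommGroup E] [NormedSpace ℝ E] [FiniteDimensional ℝ E]
      {V : E → E} {Φ : E → ℝ → E}, IsGlobalFlow V Φ → ContDiff ℝ ∞ V →
      ∃ B : E → ℝ → E →L[ℝ] E, (∀ x, B x 0 = ContinuousLinearMap.id ℝ E) ∧
        (∀ x s, HasDerivAt (B x) ((fderiv ℝ V (Φ x s)).comp (B x s)) s) ∧
        ∀ x, HasFDerivAt (fun y => Φ y 1) (B x 1) x := by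
    intro E _ _ _ V Φ hΦ hV
    have : ∀ x, ∃ A : ℝ → E →L[ℝ] E, A 0 = ContinuousLinearMap.id ℝ E ∧
        ∀ s, HasDerivAt A ((fderiv ℝ V (Φ x s)).comp (A s)) s := fun x => by
      have hc : Continuous (Φ x) :=
        continuous_iff_continuousAt.2 fun s => (hΦ.deriv x s).continuousAt
      have h1 : ContDiff ℝ 1 (Φ x) := by
        refine contDiff_one_iff_deriv.2 ⟨fun s => (hΦ.deriv x s).differentiableAt, ?_⟩
        rw [show _root_.deriv (Φ x) = fun s => V (Φ x s) from funext fun s => (hΦ.deriv x s).deriv]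
        exact hV.continuous.comp hc
      have hM : ContDiff ℝ 1 fun s => fderiv ℝ V (Φ x s) :=
        ((contDiff_fderiv hV).of_le (by exact_mod_cast le_top)).comp h1
      refine exists_solution (f := fun s A => (fderiv ℝ V (Φ x s)).comp A) ?_ (fun N => ?_) _
      · exact (hM.comp contDiff_fst).clm_comp contDiff_snd
      · obtain ⟨k, hk⟩ := isCompact_Icc.exists_bound_of_continuousOn (s := Icc (-N) N)
          hM.continuous.continuousOn
        refine ⟨k, fun t ht A => (ContinuousLinearMap.opNorm_comp_le _ _).trans ?_⟩
        have h2 := hk t (abs_le.1 ht)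
        have h3 := (norm_nonneg _).trans h2
        calc _ ≤ k * ‖A‖ := by gcongr
          _ ≤ _ := by nlinarith
    choose B hB0 hB using this
    exact ⟨B, hB0, hB, fun x => hΦ.hasFDerivAt hV x (hB0 x) (hB x)⟩
  induction k with
  | zero =>
    intro E _ _ _ V Φ hΦ hV
    obtain ⟨B, -, -, hB⟩ := main hΦ hV
    rw [Nat.cast_zero, contDiff_zero]
    exact continuous_iff_continuousAt.2 fun x => (hB x).continuousAt
  | succ k ih =>
    intro E _ _ _ V Φ hΦ hV
    obtain ⟨B, hB0, hBd, hB⟩ := main hΦ hV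
    rw [Nat.cast_succ, contDiff_succ_iff_fderiv]
    refine ⟨fun x => (hB x).differentiableAt, by simp, ?_⟩
    rw [show fderiv ℝ (fun x => Φ x 1) = fun x => B x 1 from funext fun x => (hB x).fderiv]
    have hflow : IsGlobalFlow (E := E × (E →L[ℝ] E))
        (fun z => (V z.1, (fderiv ℝ V z.1).comp z.2))
        (fun z s => (Φ z.1 s, (B z.1 s).comp z.2)) := by
      refine ⟨fun z => by simp [hΦ.init, hB0], fun z s => ?_⟩
      refine (hΦ.deriv z.1 s).prodMk ?_
      have := (hBd z.1 s).clm_comp (hasDerivAt_const s z.2)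
      simpa [ContinuousLinearMap.comp_assoc] using this
    have h1 := ih hflow ((hV.comp contDiff_fst).prodMk
      (((contDiff_fderiv hV).comp contDiff_fst).clm_comp contDiff_snd))
    have h2 := (contDiff_snd.comp h1).comp
      (contDiff_id.prodMk contDiff_const : ContDiff ℝ k
        fun x : E => (x, ContinuousLinearMap.id ℝ E))
    simpa [Function.comp_def] using h2

/-- Smooth fields have smooth flows. -/
lemma IsGlobalFlow.contDiff {E : Type} [NormedAddCommGroup E]
    [NormedSpace ℝ E] [FiniteDimensional ℝ E] {V : E → E} {Φ : E → ℝ → E}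
    (hΦ : IsGlobalFlow V Φ) (hV : ContDiff ℝ ∞ V) :
    ContDiff ℝ ∞ fun z : E × ℝ => Φ z.1 z.2 := by
  -- Time becomes a parameter of the state: the field `t • V` reaches `Φ x t` at time one.
  have hflow : IsGlobalFlow (E := E × ℝ) (fun z => (z.2 • V z.1, 0))
      (fun z s => (Φ z.1 (s * z.2), z.2)) := by
    refine ⟨fun z => by simp [hΦ.init], fun z s => ?_⟩
    refine HasDerivAt.prodMk ?_ (hasDerivAt_const s z.2)
    have := (hΦ.deriv z.1 (s * z.2)).scomp s ((hasDerivAt_id s).mul_const z.2)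
    simpa [Function.comp_def] using this
  refine contDiff_infty.2 fun k => ?_
  have h1 := hflow.contDiff_time_one k
    ((contDiff_snd.smul (hV.comp contDiff_fst)).prodMk contDiff_const)
  simpa [Function.comp_def] using contDiff_fst.comp h1

/-- The flow of a smooth time dependent field that vanishes outside a compact set. -/
lemma exists_flow {E : Type} [NormedAddCommGroup E] [NormedSpace ℝ E] [FiniteDimensional ℝ E]
    {a : ℝ × E → E} (ha : ContDiff ℝ ∞ a) {K : Set E} (hK : IsCompact K)
    (hsupp : ∀ t, ∀ x ∉ K, a (t, x) = 0) :
    ∃ g : (E × ℝ) × ℝ → E, ContDiff ℝ ∞ g ∧ (∀ p, g (p, 0) = p.1) ∧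
      ∀ p s, HasDerivAt (fun s => g (p, s)) (a (p.2 + s, g (p, s))) s := by
  have hex : ∀ p : E × ℝ, ∃ c : ℝ → E, c 0 = p.1 ∧ ∀ s, HasDerivAt c (a (p.2 + s, c s)) s := by
    intro p
    refine exists_solution (f := fun s x => a (p.2 + s, x)) ?_ (fun N => ?_) p.1
    · exact (ha.of_le (by exact_mod_cast le_top)).comp
        (by fun_prop : ContDiff ℝ 1 fun z : ℝ × E => (p.2 + z.1, z.2))
    · obtain ⟨k, hk⟩ := ((isCompact_Icc (a := p.2 - N) (b := p.2 + N)).prod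
        hK).exists_bound_of_continuousOn ha.continuous.continuousOn
      refine ⟨max k 0, fun t ht x => ?_⟩
      have h1 : ‖a (p.2 + t, x)‖ ≤ max k 0 := by
        by_cases hx : x ∈ K
        · refine (hk (p.2 + t, x) ⟨?_, hx⟩).trans (le_max_left _ _)
          have := abs_le.1 ht
          exact ⟨by simp; linarith, by simp; linarith⟩
        · simp [hsupp _ x hx]
      nlinarith [norm_nonneg x, le_max_right k 0]
  choose c hc0 hc using hex
  -- Adjoining the clock as a coordinate makes the field autonomous.
  have hflow : IsGlobalFlow (E := E × ℝ) (fun z => (a (z.2, z.1), 1))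
      (fun z s => (c z s, z.2 + s)) := by
    refine ⟨fun z => by simp [hc0], fun z s => ?_⟩
    exact (hc z s).prodMk (by simpa using (hasDerivAt_id s).const_add z.2)
  have h1 := hflow.contDiff ((ha.comp (by fun_prop : ContDiff ℝ ∞
    fun z : E × ℝ => (z.2, z.1))).prodMk contDiff_const)
  exact ⟨fun z => c z.1 z.2, contDiff_fst.comp h1, hc0, hc⟩

end Flow

/-! ### Scales of growth -/

/-- A solid ring of nets of real numbers containing the constants. -/
structure IsScale (S : Set (Eps → ℝ)) : Prop where
  one : (fun _ => 1) ∈ S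
  add : ∀ {r s}, r ∈ S → s ∈ S → (fun ε => r ε + s ε) ∈ S
  mul : ∀ {r s}, r ∈ S → s ∈ S → (fun ε => r ε * s ε) ∈ S
  solid : ∀ {r s}, s ∈ S → (∀ᶠ ε in eps0, |r ε| ≤ |s ε|) → r ∈ S

/-- A solid module of nets of real numbers over a scale. -/
structure IsScaleModule (S N : Set (Eps → ℝ)) : Prop where
  zero : (fun _ => 0) ∈ N
  add : ∀ {r s}, r ∈ N → s ∈ N → (fun ε => r ε + s ε) ∈ N
  mul : ∀ {r s}, r ∈ N → s ∈ S → (fun ε => r ε * s ε) ∈ N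
  solid : ∀ {r s}, s ∈ N → (∀ᶠ ε in eps0, |r ε| ≤ |s ε|) → r ∈ N

section Scales

variable {S N : Set (Eps → ℝ)}

lemma IsScale.isScaleModule (hS : IsScale S) : IsScaleModule S S where
  zero := hS.solid hS.one (Eventually.of_forall fun ε => by simp)
  add := hS.add
  mul := hS.mul
  solid := hS.solid

lemma IsScaleModule.abs (hN : IsScaleModule S N) {r : Eps → ℝ} (hr : r ∈ N) :
    (fun ε => |r ε|) ∈ N := hN.solid hr (Eventually.of_forall fun ε => by simp)

lemma IsScale.const (hS : IsScale S) (c : ℝ) : (fun _ => c) ∈ S := by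
  have hn : ∀ n : ℕ, (fun _ : Eps => (n : ℝ)) ∈ S := fun n => by
    induction n with
    | zero => simpa using hS.isScaleModule.zero
    | succ n ih => simpa using hS.add ih hS.one
  obtain ⟨n, hn'⟩ := exists_nat_ge |c|
  exact hS.solid (hn n) (Eventually.of_forall fun ε => by simpa using hn')

/-- Moderate nets of numbers. -/
def modScale : Set (Eps → ℝ) :=
  {r | ∃ (N : ℕ) (C : ℝ), ∀ᶠ ε in eps0, |r ε| ≤ C * ((ε : ℝ)⁻¹) ^ N}

/-- Negligible nets of numbers. -/
def negScale : Set (Eps → ℝ) := {r | ∀ q : ℕ, ∃ C : ℝ, ∀ᶠ ε in eps0, |r ε| ≤ C * (ε : ℝ) ^ q}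

/-- Slow scale nets of numbers. -/
def slowScale : Set (Eps → ℝ) := {r | IsSlowScale r}

/-- `sup_{x ∈ K} p_ε(x)` is bounded by a net in `S`. -/
def ScaleBound {E : Type} (S : Set (Eps → ℝ)) (p : Eps → E → ℝ) (K : Set E) : Prop :=
  ∃ r ∈ S, ∀ᶠ ε in eps0, ∀ x ∈ K, p ε x ≤ |r ε|

lemma modScale_iff {r : Eps → ℝ} :
    r ∈ modScale ↔ ModBound (fun ε (_ : Unit) => |r ε|) univ := by
  simp [modScale, ModBound]

lemma negScale_iff {r : Eps → ℝ} :
    r ∈ negScale ↔ NegBound (fun ε (_ : Unit) => |r ε|) univ := by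
  simp [negScale, NegBound]

lemma isScale_modScale : IsScale modScale where
  one := ⟨0, 1, by simp⟩
  add hr hs := by
    rw [modScale_iff] at *
    exact (hr.add hs).mono fun ε x _ => abs_add_le _ _
  mul hr hs := by
    rw [modScale_iff] at *
    exact (hr.mul hs (fun _ _ => abs_nonneg _) fun _ _ => abs_nonneg _).mono
      fun ε x _ => (abs_mul _ _).le
  solid := fun ⟨N, C, h⟩ hrs => ⟨N, C, by filter_upwards [h, hrs] with ε a b using b.trans a⟩

lemma isScaleModule_negScale : IsScaleModule modScale negScale where
  zero := fun q => ⟨0, by simp⟩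
  add hr hs := by
    rw [negScale_iff] at *
    exact (hr.add hs).mono fun ε x _ => abs_add_le _ _
  mul hr hs := by
    rw [modScale_iff] at hs
    rw [negScale_iff] at *
    exact (hr.mul_mod hs (fun _ _ => abs_nonneg _) fun _ _ => abs_nonneg _).mono
      fun ε x _ => (abs_mul _ _).le
  solid := fun h hrs q => by
    obtain ⟨C, hC⟩ := h q
    exact ⟨C, by filter_upwards [hC, hrs] with ε a b using b.trans a⟩

lemma IsSlowScale.of_abs_le {r s : Eps → ℝ} (hs : IsSlowScale s)
    (h : ∀ᶠ ε in eps0, |r ε| ≤ |s ε|) : IsSlowScale r := fun q => by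
  obtain ⟨C, hC⟩ := hs q
  exact ⟨C, by filter_upwards [hC, h] with ε a b using (pow_le_pow_left₀ (abs_nonneg _) b q).trans a⟩

lemma isScale_slowScale : IsScale slowScale where
  one := fun q => ⟨1, Eventually.of_forall fun ε => by simpa using one_le_inv ε⟩
  add {r s} hr hs := fun q => by
    obtain ⟨C, hC⟩ := hr q
    obtain ⟨D, hD⟩ := hs q
    refine ⟨2 ^ (q - 1) * (C + D), ?_⟩
    filter_upwards [hC, hD] with ε a b
    calc |r ε + s ε| ^ q ≤ (|r ε| + |s ε|) ^ q := by gcongr; exact abs_add_le _ _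
      _ ≤ 2 ^ (q - 1) * (|r ε| ^ q + |s ε| ^ q) := add_pow_le (abs_nonneg _) (abs_nonneg _) q
      _ ≤ 2 ^ (q - 1) * (C * (ε : ℝ)⁻¹ + D * (ε : ℝ)⁻¹) := by gcongr
      _ = _ := by ring
  mul {r s} hr hs := fun q => by
    -- The doubled exponent pays for the product: `xy ≤ (x² + y²) / 2` with `x = |r|^q`, `y =
    -- |s|^q`.
    obtain ⟨C, hC⟩ := hr (q * 2)
    obtain ⟨D, hD⟩ := hs (q * 2)
    refine ⟨C + D, ?_⟩
    filter_upwards [hC, hD] with ε a b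
    rw [pow_mul] at a b
    rw [abs_mul, mul_pow]
    nlinarith [sq_nonneg (|r ε| ^ q - |s ε| ^ q), sq_nonneg (|r ε| ^ q), sq_nonneg (|s ε| ^ q)]
  solid := fun hs h => hs.of_abs_le h

end Scales

/-! ### Bounds on sets by nets of a scale -/

section ScaleBound

variable {E : Type} {S N : Set (Eps → ℝ)} {p q : Eps → E → ℝ} {K : Set E}

lemma ScaleBound.mono (hq : ScaleBound N q K) (h : ∀ ε, ∀ x ∈ K, p ε x ≤ q ε x) :
    ScaleBound N p K := by
  obtain ⟨r, hr, hC⟩ := hq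
  exact ⟨r, hr, hC.mono fun ε he x hx => (h ε x hx).trans (he x hx)⟩

lemma scaleBound_const (hS : IsScale S) {c : ℝ} (h : ∀ ε, ∀ x ∈ K, p ε x ≤ c) :
    ScaleBound S p K :=
  ⟨fun _ => c, hS.const c, Eventually.of_forall fun ε x hx => (h ε x hx).trans (le_abs_self c)⟩

lemma scaleBound_zero (hN : IsScaleModule S N) (h : ∀ ε, ∀ x ∈ K, p ε x ≤ 0) :
    ScaleBound N p K :=
  ⟨fun _ => 0, hN.zero, Eventually.of_forall fun ε x hx => by simpa using h ε x hx⟩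

lemma ScaleBound.add (hN : IsScaleModule S N) (hp : ScaleBound N p K) (hq : ScaleBound N q K) :
    ScaleBound N (fun ε x => p ε x + q ε x) K := by
  obtain ⟨r, hr, h1⟩ := hp
  obtain ⟨s, hs, h2⟩ := hq
  refine ⟨_, hN.add (hN.abs hr) (hN.abs hs), ?_⟩
  filter_upwards [h1, h2] with ε a b x hx
  rw [abs_of_nonneg (by positivity)]
  exact add_le_add (a x hx) (b x hx)

lemma ScaleBound.mul (hN : IsScaleModule S N) (hp : ScaleBound N p K) (hq : ScaleBound S q K)
    (hq0 : ∀ ε x, 0 ≤ q ε x) : ScaleBound N (fun ε x => p ε x * q ε x) K := by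
  obtain ⟨r, hr, h1⟩ := hp
  obtain ⟨s, hs, h2⟩ := hq
  refine ⟨_, hN.mul hr hs, ?_⟩
  filter_upwards [h1, h2] with ε a b x hx
  rw [abs_mul]
  exact mul_le_mul (a x hx) (b x hx) (hq0 ε x) (abs_nonneg _)

lemma ScaleBound.sum (hN : IsScaleModule S N) {ι : Type} (s : Finset ι) {P : ι → Eps → E → ℝ}
    (h : ∀ i ∈ s, ScaleBound N (P i) K) : ScaleBound N (fun ε x => ∑ i ∈ s, P i ε x) K := by
  classical
  induction s using Finset.induction_on with
  | empty => exact scaleBound_zero hN (by simp)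
  | insert a s ha ih =>
    simp only [Finset.sum_insert ha]
    exact (h a (by simp)).add hN (ih fun i hi => h i (by simp [hi]))

lemma ScaleBound.const_mul (hS : IsScale S) (hN : IsScaleModule S N) (hp : ScaleBound N p K)
    (c : ℝ) (hc : 0 ≤ c) : ScaleBound N (fun ε x => c * p ε x) K :=
  (hp.mul hN (scaleBound_const hS (p := fun _ _ => c) fun _ _ _ => le_rfl) fun _ _ => hc).mono
    fun ε x _ => (mul_comm _ _).le

lemma ScaleBound.pow (hS : IsScale S) (hp : ScaleBound S p K) (hp0 : ∀ ε x, 0 ≤ p ε x) (n : ℕ) :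
    ScaleBound S (fun ε x => p ε x ^ n) K := by
  induction n with
  | zero => exact scaleBound_const hS (c := 1) fun ε x _ => by simp
  | succ n ih =>
    simp only [pow_succ]
    exact ih.mul hS.isScaleModule hp hp0

lemma ScaleBound.comp_of_mapsTo {E' : Type} {p : Eps → E' → ℝ} {f : Eps → E → E'} {L : Set E'}
    (hp : ScaleBound N p L) (h : ∀ᶠ ε in eps0, MapsTo (f ε) K L) :
    ScaleBound N (fun ε x => p ε (f ε x)) K := by
  obtain ⟨r, hr, hC⟩ := hp
  refine ⟨r, hr, ?_⟩
  filter_upwards [hC, h] with ε h1 h2 x hx using h1 _ (h2 hx)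

lemma scaleBound_modScale_iff : ScaleBound modScale p K ↔ ModBound p K := by
  constructor
  · rintro ⟨r, ⟨N, C, h⟩, hr⟩
    exact ⟨N, C, by filter_upwards [h, hr] with ε a b x hx using (b x hx).trans a⟩
  · rintro ⟨N, C, h⟩
    refine ⟨fun ε => C * ((ε : ℝ)⁻¹) ^ N, ⟨N, |C|, Eventually.of_forall fun ε => ?_⟩, ?_⟩
    · rw [abs_mul, abs_of_nonneg (a := ((ε : ℝ)⁻¹) ^ N)]
      have := one_le_inv ε
      positivity
    · exact h.mono fun ε a x hx => (a x hx).trans (le_abs_self _)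

/-- A single net has to serve all orders `q`, so the supremum over `K` is taken as witness. The
bound for `q = 0` makes it a genuine supremum for small `ε`. -/
lemma scaleBound_negScale_iff (hp : ∀ ε x, 0 ≤ p ε x) :
    ScaleBound negScale p K ↔ NegBound p K := by
  constructor
  · rintro ⟨r, hr, hp⟩ q
    obtain ⟨C, hC⟩ := hr q
    exact ⟨C, by filter_upwards [hC, hp] with ε a b x hx using (b x hx).trans a⟩
  · intro h
    have h0 : ∀ ε, 0 ≤ sSup (p ε '' K) := fun ε =>
      Real.sSup_nonneg (by rintro _ ⟨x, _, rfl⟩; exact hp ε x)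
    refine ⟨fun ε => sSup (p ε '' K), fun q => ?_, ?_⟩
    · obtain ⟨C, hC⟩ := h q
      refine ⟨|C|, hC.mono fun ε a => ?_⟩
      have he : (0 : ℝ) < ε := ε.2.1
      rw [abs_of_nonneg (h0 ε)]
      refine Real.sSup_le ?_ (by positivity)
      rintro _ ⟨x, hx, rfl⟩
      exact (a x hx).trans (by gcongr; exact le_abs_self C)
    · obtain ⟨C, hC⟩ := h 0
      refine hC.mono fun ε a x hx => (le_csSup ⟨C * (ε : ℝ) ^ 0, ?_⟩ (mem_image_of_mem _ hx)).trans
        (le_abs_self _)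
      rintro _ ⟨y, hy, rfl⟩
      exact a y hy

lemma scaleBound_slowScale_iff : ScaleBound slowScale p K ↔ SlowScaleBound p K := by
  constructor
  · rintro ⟨r, hr, h⟩
    exact ⟨r, hr, 1, by simpa using h⟩
  · rintro ⟨r, hr, C, h⟩
    refine ⟨fun ε => r ε * C, isScale_slowScale.mul hr (isScale_slowScale.const C), ?_⟩
    refine h.mono fun ε a x hx => (a x hx).trans ?_
    rw [abs_mul, mul_comm]
    gcongr
    exact le_abs_self C

end ScaleBound

/-! ### Nets of functions with derivatives up to a given order in a scale -/

/-- The derivatives of order at most `k` of `u_ε` are bounded on compact sets by nets in `S`. -/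
def ScaleOrd {E F : Type} [NormedAddCommGroup E] [NormedSpace ℝ E] [NormedAddCommGroup F]
    [NormedSpace ℝ F] (S : Set (Eps → ℝ)) (k : ℕ) (u : Eps → E → F) : Prop :=
  ∀ K : Set E, IsCompact K → ∀ j ≤ k, ScaleBound S (fun ε x => ‖iteratedFDeriv ℝ j (u ε) x‖) K

/-- `‖u_ε‖` is bounded on compact sets by nets `m` such that all `exp (T m)` belong to `S`. -/
def LogOrd {E F : Type} [NormedAddCommGroup E] [NormedAddCommGroup F]
    (S : Set (Eps → ℝ)) (u : Eps → E → F) : Prop :=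
  ∀ K : Set E, IsCompact K → ∃ m : Eps → ℝ, (∀ T : ℝ, (fun ε => Real.exp (T * m ε)) ∈ S) ∧
    ∀ᶠ ε in eps0, ∀ x ∈ K, ‖u ε x‖ ≤ m ε

section ScaleOrd

variable {E : Type} [NormedAddCommGroup E] [NormedSpace ℝ E]
  {E' : Type} [NormedAddCommGroup E'] [NormedSpace ℝ E']
  {F : Type} [NormedAddCommGroup F] [NormedSpace ℝ F]
  {F' : Type} [NormedAddCommGroup F'] [NormedSpace ℝ F']
  {F'' : Type} [NormedAddCommGroup F''] [NormedSpace ℝ F'']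
  {S N : Set (Eps → ℝ)} {k : ℕ}

lemma modOn_iff_scaleOrd {u : Eps → E → F} : ModOn u univ ↔ ∀ k, ScaleOrd modScale k u :=
  ⟨fun h _ K hK j _ => scaleBound_modScale_iff.2 (h K (subset_univ _) hK j),
    fun h K _ hK j => scaleBound_modScale_iff.1 (h j K hK j le_rfl)⟩

lemma negOn_iff_scaleOrd {u : Eps → E → F} : NegOn u univ ↔ ∀ k, ScaleOrd negScale k u :=
  ⟨fun h _ K hK j _ => (scaleBound_negScale_iff fun _ _ => norm_nonneg _).2
      (h K (subset_univ _) hK j),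
    fun h K _ hK j => (scaleBound_negScale_iff fun _ _ => norm_nonneg _).1 (h j K hK j le_rfl)⟩

lemma slowScaleOn_iff_scaleOrd {u : Eps → E → F} :
    SlowScaleOn u univ ↔ ∀ k, ScaleOrd slowScale k u :=
  ⟨fun h _ K hK j _ => scaleBound_slowScale_iff.2 (h K (subset_univ _) hK j),
    fun h K _ hK j => scaleBound_slowScale_iff.1 (h j K hK j le_rfl)⟩

lemma ScaleOrd.of_le {u : Eps → E → F} {j : ℕ} (h : ScaleOrd S k u) (hj : j ≤ k) :
    ScaleOrd S j u := fun K hK i hi => h K hK i (hi.trans hj)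

lemma scaleOrd_const (hS : IsScale S) {f : E → F} (hf : ContDiff ℝ ∞ f) :
    ScaleOrd S k (fun _ : Eps => f) := fun K hc j _ => by
  have hcont : Continuous fun x => ‖iteratedFDeriv ℝ j f x‖ :=
    (hf.continuous_iteratedFDeriv (m := j) (by exact_mod_cast le_top)).norm
  obtain ⟨C, hC⟩ := hc.bddAbove_image hcont.continuousOn
  exact scaleBound_const hS (c := C) fun ε x hx => hC (mem_image_of_mem _ hx)

lemma scaleOrd_zero (hN : IsScaleModule S N) :
    ScaleOrd N k (fun (_ : Eps) (_ : E) => (0 : F)) := fun K hc j _ =>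
  scaleBound_zero hN fun ε x _ => by simp [show (fun _ : E => (0 : F)) = 0 from rfl]

lemma ScaleOrd.add (hN : IsScaleModule S N) {u v : Eps → E → F} (su : ∀ ε, ContDiff ℝ ∞ (u ε))
    (sv : ∀ ε, ContDiff ℝ ∞ (v ε)) (hu : ScaleOrd N k u) (hv : ScaleOrd N k v) :
    ScaleOrd N k (fun ε x => u ε x + v ε x) := fun K hK j hj =>
  ((hu K hK j hj).add hN (hv K hK j hj)).mono fun ε x _ => by
    change ‖iteratedFDeriv ℝ j (u ε + v ε) x‖ ≤ _
    rw [iteratedFDeriv_add_apply ((su ε).contDiffAt.of_le (by exact_mod_cast le_top))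
      ((sv ε).contDiffAt.of_le (by exact_mod_cast le_top))]
    exact norm_add_le _ _

lemma ScaleOrd.neg {u : Eps → E → F} (hu : ScaleOrd N k u) :
    ScaleOrd N k (fun ε x => - u ε x) := fun K hK j hj =>
  (hu K hK j hj).mono fun ε x _ => by
    change ‖iteratedFDeriv ℝ j (-(u ε)) x‖ ≤ _
    rw [iteratedFDeriv_neg_apply, norm_neg]

/-- Leibniz' rule. One factor lies in the module and one in the ring, so the same lemma covers
moderate times moderate and negligible times moderate. -/
lemma ScaleOrd.bilin (hS : IsScale S) (hN : IsScaleModule S N) (B : F →L[ℝ] F' →L[ℝ] F'')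
    {u : Eps → E → F} {v : Eps → E → F'}
    (su : ∀ ε, ContDiff ℝ ∞ (u ε)) (sv : ∀ ε, ContDiff ℝ ∞ (v ε))
    (hu : ScaleOrd N k u) (hv : ScaleOrd S k v) :
    ScaleOrd N k (fun ε y => B (u ε y) (v ε y)) := fun K hK j hj => by
  refine ScaleBound.mono ?_ fun ε x _ => norm_bilin_le B (su ε) (sv ε) j x
  refine ScaleBound.const_mul hS hN (ScaleBound.sum hN _ fun i hi => ?_) _ (by positivity)
  refine ScaleBound.const_mul hS hN ?_ _ (by positivity)
  exact (hu K hK i (by simp at hi; omega)).mul hN (hv K hK (j - i) (by omega))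
    (fun _ _ => norm_nonneg _)

lemma ScaleOrd.clm (hS : IsScale S) (hN : IsScaleModule S N) (L : F →L[ℝ] F')
    {u : Eps → E → F} (su : ∀ ε, ContDiff ℝ ∞ (u ε)) (hu : ScaleOrd N k u) :
    ScaleOrd N k (fun ε y => L (u ε y)) :=
  ScaleOrd.bilin hS hN (v := fun _ _ => L) (ContinuousLinearMap.id ℝ (F →L[ℝ] F')).flip su
    (fun _ => contDiff_const) hu (scaleOrd_const hS contDiff_const)

lemma ScaleOrd.fderiv {u : Eps → E → F} (hu : ScaleOrd N (k + 1) u) :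
    ScaleOrd N k (fun ε => fderiv ℝ (u ε)) := fun K hK j hj =>
  (hu K hK (j + 1) (by omega)).mono fun ε x _ => by rw [norm_iteratedFDeriv_fderiv]

lemma ScaleOrd.succ {u : Eps → E → F} (hu : ScaleOrd N 0 u)
    (hd : ScaleOrd N k (fun ε => _root_.fderiv ℝ (u ε))) : ScaleOrd N (k + 1) u :=
  fun K hK j hj => by
    obtain _ | j := j
    · exact hu K hK 0 le_rfl
    · exact (hd K hK j (by omega)).mono fun ε x _ => by rw [norm_iteratedFDeriv_fderiv]

/-- Faà di Bruno's formula: every term is linear in derivatives of the outer net, which may lie in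
the module, and polynomial in those of the inner net, which lie in the ring. The bounds on the outer
net are used on the compact set supplied by c-boundedness. -/
lemma ScaleOrd.comp (hS : IsScale S) (hN : IsScaleModule S N) {u : Eps → E' → F}
    {f : Eps → E → E'} (su : ∀ ε, ContDiff ℝ ∞ (u ε)) (sf : ∀ ε, ContDiff ℝ ∞ (f ε))
    (hu : ScaleOrd N k u) (hf : ScaleOrd S k f) (cf : CBounded f) :
    ScaleOrd N k (fun ε x => u ε (f ε x)) := fun K hK j hj => by
  obtain ⟨L, hL, hKL⟩ := cf K hK
  refine ScaleBound.mono ?_ fun ε x _ => norm_comp_le (su ε) (sf ε) j x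
  refine ScaleBound.const_mul hS hN (ScaleBound.mul hN (ScaleBound.sum hN _ fun i hi => ?_)
    (ScaleBound.pow hS (ScaleBound.add hS.isScaleModule
      (scaleBound_const hS (c := 1) fun _ _ _ => le_rfl)
      (ScaleBound.sum hS.isScaleModule _ fun i hi => hf K hK i (by simp at hi; omega))) ?_ j) ?_)
      _ (by positivity)
  · exact (hu L hL i (by simp at hi; omega)).comp_of_mapsTo hKL
  all_goals intros; positivity

lemma ScaleOrd.prodMk (hN : IsScaleModule S N) {u : Eps → E → E'} {v : Eps → E → F}
    (su : ∀ ε, ContDiff ℝ ∞ (u ε)) (sv : ∀ ε, ContDiff ℝ ∞ (v ε)) (hu : ScaleOrd N k u)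
    (hv : ScaleOrd N k v) : ScaleOrd N k (fun ε x => (u ε x, v ε x)) := fun K hK j hj =>
  ((hu K hK j hj).add hN (hv K hK j hj)).mono fun ε x _ => by
    rw [iteratedFDeriv_prodMk (su ε).contDiffAt (sv ε).contDiffAt (by exact_mod_cast le_top),
      ContinuousMultilinearMap.opNorm_prod]
    exact max_le_add_of_nonneg (norm_nonneg _) (norm_nonneg _)

lemma ScaleOrd.comp_const (hS : IsScale S) (hN : IsScaleModule S N) {u : Eps → E' → F}
    (su : ∀ ε, ContDiff ℝ ∞ (u ε)) (hu : ScaleOrd N k u) {f : E → E'} (hf : ContDiff ℝ ∞ f) :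
    ScaleOrd N k (fun ε x => u ε (f x)) :=
  hu.comp hS hN su (fun _ => hf) (scaleOrd_const hS hf) (cBounded_const hf.continuous)

/-- Order zero of the induction for the flow, where the bound is even independent of `ε`. -/
lemma ScaleOrd.zero_of_cBounded (hS : IsScale S) {u : Eps → E → F} (hu : CBounded u) :
    ScaleOrd S 0 u := fun K hK j hj => by
  obtain rfl : j = 0 := by omega
  obtain ⟨L, hL, h⟩ := hu K hK
  obtain ⟨R, hR⟩ := hL.isBounded.exists_norm_le
  refine ⟨fun _ => R, hS.const R, h.mono fun ε a x hx => ?_⟩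
  simp only [norm_iteratedFDeriv_zero]
  exact (hR _ (a hx)).trans (le_abs_self _)

lemma LogOrd.mono {u : Eps → E → F} {v : Eps → E → F'} (hu : LogOrd S u)
    (h : ∀ ε x, ‖v ε x‖ ≤ ‖u ε x‖) : LogOrd S v := fun K hK => by
  obtain ⟨m, hm, hb⟩ := hu K hK
  exact ⟨m, hm, hb.mono fun ε a x hx => (h ε x).trans (a x hx)⟩

lemma LogOrd.comp {u : Eps → E' → F} {f : Eps → E → E'} (hu : LogOrd S u) (cf : CBounded f) :
    LogOrd S (fun ε x => u ε (f ε x)) := fun K hK => by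
  obtain ⟨L, hL, hKL⟩ := cf K hK
  obtain ⟨m, hm, hb⟩ := hu L hL
  exact ⟨m, hm, by filter_upwards [hb, hKL] with ε a b x hx using a _ (b hx)⟩

lemma LogOrd.add (hS : IsScale S) {u v : Eps → E → F} (hu : LogOrd S u) (hv : LogOrd S v) :
    LogOrd S (fun ε x => u ε x + v ε x) := fun K hK => by
  obtain ⟨m, hm, h1⟩ := hu K hK
  obtain ⟨l, hl, h2⟩ := hv K hK
  refine ⟨fun ε => m ε + l ε, fun T => ?_, ?_⟩
  · simpa [mul_add, Real.exp_add] using hS.mul (hm T) (hl T)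
  · filter_upwards [h1, h2] with ε a b x hx
    exact (norm_add_le _ _).trans (add_le_add (a x hx) (b x hx))

lemma LogOrd.sum (hS : IsScale S) {ι : Type} (s : Finset ι) {u : ι → Eps → E → F}
    (hu : ∀ i ∈ s, LogOrd S (u i)) : LogOrd S (fun ε x => ∑ i ∈ s, u i ε x) := by
  classical
  induction s using Finset.induction_on with
  | empty => exact fun K _ => ⟨fun _ => 0, fun T => by simpa using hS.one, by simp⟩
  | insert a s ha ih =>
    simp only [Finset.sum_insert ha]
    exact (hu a (by simp)).add hS (ih fun i hi => hu i (by simp [hi]))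

/-- Grönwall in the last variable. Here the logarithmic bound is spent: the factor `exp (T m)`
belongs to `S` by the definition of `LogOrd`. -/
lemma ScaleOrd.zero_of_linear_ode (hS : IsScale S) (hN : IsScaleModule S N)
    {v g : Eps → E × ℝ → F} {M : Eps → E × ℝ → F →L[ℝ] F} (sv : ∀ ε, ContDiff ℝ ∞ (v ε))
    (hode : ∀ ε z, _root_.fderiv ℝ (v ε) z (0, 1) = M ε z (v ε z) + g ε z)
    (hM : LogOrd S M) (hg : ScaleOrd N 0 g) (hv0 : ScaleOrd N 0 (fun ε p => v ε (p, 0))) :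
    ScaleOrd N 0 v := by
  intro K hK j hj
  obtain rfl : j = 0 := by omega
  have hK1 : IsCompact (Prod.fst '' K) := hK.image continuous_fst
  obtain ⟨T, hT⟩ := hK.exists_bound_of_continuousOn (f := Prod.snd) continuous_snd.continuousOn
  -- The enlarged compact set contains the whole time segment from `(p, 0)` to each point `(p, s)`
  -- of `K`.
  have hL : IsCompact ((Prod.fst '' K) ×ˢ Icc (-T) T) := hK1.prod isCompact_Icc
  obtain ⟨m, hm, h1⟩ := hM _ hL
  obtain ⟨r, hr, h2⟩ := hg _ hL 0 le_rfl
  obtain ⟨r0, hr0, h3⟩ := hv0 _ hK1 0 le_rfl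
  refine ⟨_, hN.mul (hN.add (hN.abs hr0) (hN.mul (hN.abs hr) (hS.const T))) (hm T), ?_⟩
  filter_upwards [h1, h2, h3] with ε a b c z hz
  simp only [norm_iteratedFDeriv_zero] at b c ⊢
  have hzT : |z.2| ≤ T := hT z hz
  have hT0 : 0 ≤ T := (abs_nonneg _).trans hzT
  have hz1 : z.1 ∈ Prod.fst '' K := ⟨z, hz, rfl⟩
  have hm0 : 0 ≤ m ε := (norm_nonneg _).trans (a (z.1, 0) ⟨hz1, by simpa using hT0⟩)
  have := norm_le_of_norm_deriv_le (v := fun s => v ε (z.1, s))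
    (v' := fun s => M ε (z.1, s) (v ε (z.1, s)) + g ε (z.1, s)) (T := T) (K := m ε)
    (ε := |r ε|) hm0 (abs_nonneg _)
    (fun s _ => by
      rw [← hode]
      have h := (((sv ε).differentiable (by simp)) (z.1, s)).hasFDerivAt.comp_hasDerivAt s
        ((hasDerivAt_const s z.1).prodMk (hasDerivAt_id s))
      simpa [Function.comp_def] using h)
    (fun s hs => by
      refine (norm_add_le _ _).trans (add_le_add ?_ (b _ ⟨hz1, abs_le.1 hs⟩))
      exact (ContinuousLinearMap.le_opNorm _ _).trans
        (by gcongr; exact a _ ⟨hz1, abs_le.1 hs⟩)) z.2 hzT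
  calc ‖v ε z‖ ≤ (‖v ε (z.1, 0)‖ + |r ε| * |z.2|) * Real.exp (m ε * |z.2|) := this
    _ ≤ (|r0 ε| + |r ε| * T) * Real.exp (T * m ε) := by
      rw [mul_comm T]
      gcongr
      exact c _ hz1
    _ = _ := (abs_of_nonneg (by positivity)).symm

lemma ScaleOrd.sum (hN : IsScaleModule S N) {ι : Type} (s : Finset ι) {u : ι → Eps → E → F}
    (su : ∀ i ε, ContDiff ℝ ∞ (u i ε)) (hu : ∀ i ∈ s, ScaleOrd N k (u i)) :
    ScaleOrd N k (fun ε x => ∑ i ∈ s, u i ε x) := by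
  classical
  induction s using Finset.induction_on with
  | empty => simpa using scaleOrd_zero hN
  | insert a s ha ih =>
    simp only [Finset.sum_insert ha]
    exact (hu a (by simp)).add hN (su a) (fun ε => ContDiff.sum fun i _ => su i ε)
      (ih fun i hi => hu i (by simp [hi]))

lemma contDiff_fderiv_apply {u : E → F} (su : ContDiff ℝ ∞ u) (w : E) :
    ContDiff ℝ ∞ fun z => fderiv ℝ u z w := (contDiff_fderiv su).clm_apply contDiff_const

lemma ScaleOrd.fderiv_apply (hS : IsScale S) (hN : IsScaleModule S N) {u : Eps → E → F}
    (su : ∀ ε, ContDiff ℝ ∞ (u ε)) (hu : ScaleOrd N (k + 1) u) (w : E) :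
    ScaleOrd N k (fun ε z => _root_.fderiv ℝ (u ε) z w) :=
  ScaleOrd.clm hS hN (ContinuousLinearMap.apply ℝ F w) (fun ε => contDiff_fderiv (su ε)) hu.fderiv

/-- Differential equations control directional derivatives one direction at a time; in finite
dimension a basis recovers the full derivative from them. -/
lemma ScaleOrd.succ_of_fderiv_apply [FiniteDimensional ℝ E] (hS : IsScale S)
    (hN : IsScaleModule S N) {u : Eps → E → F} (su : ∀ ε, ContDiff ℝ ∞ (u ε))
    (hu : ScaleOrd N 0 u) (hd : ∀ w, ScaleOrd N k (fun ε z => _root_.fderiv ℝ (u ε) z w)) :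
    ScaleOrd N (k + 1) u := by
  refine hu.succ ?_
  let b := Module.finBasis ℝ E
  let c : Fin (Module.finrank ℝ E) → E →L[ℝ] ℝ := fun i => LinearMap.toContinuousLinearMap (b.coord i)
  have e : (fun ε => _root_.fderiv ℝ (u ε)) = fun ε z => ∑ i,
      ContinuousLinearMap.smulRightL ℝ E F (c i) (_root_.fderiv ℝ (u ε) z (b i)) := by
    funext ε z
    ext w
    have : w = ∑ i, c i w • b i := (b.sum_repr w).symm
    conv_lhs => rw [this]
    simp
  rw [e]
  refine ScaleOrd.sum hN _ (fun i ε => ?_) fun i _ => ?_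
  · exact (ContinuousLinearMap.contDiff (F := E →L[ℝ] F) _).comp (contDiff_fderiv_apply (su ε) _)
  · exact ScaleOrd.clm (F' := E →L[ℝ] F) hS hN _ (fun ε => contDiff_fderiv_apply (su ε) _) (hd (b i))

/-- Schwarz' theorem, used to differentiate a differential equation with respect to its parameters.
-/
lemma fderiv_fderiv_apply_comm {u : E → F} (su : ContDiff ℝ ∞ u) (z w w' : E) :
    fderiv ℝ (fun z => fderiv ℝ u z w) z w' = fderiv ℝ (fun z => fderiv ℝ u z w') z w := by
  have h : ∀ w w', fderiv ℝ (fun z => fderiv ℝ u z w) z w' = fderiv ℝ (fderiv ℝ u) z w' w := by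
    intro w w'
    rw [fderiv_clm_apply (((contDiff_fderiv su).differentiable (by simp)) z)
      (differentiableAt_const _)]
    simp
  have hsymm : IsSymmSndFDerivAt ℝ u z := su.contDiffAt.isSymmSndFDerivAt
    (by simpa using (by exact_mod_cast le_top : ((2 : ℕ∞) : WithTop ℕ∞) ≤ ∞))
  rw [h, h, hsymm.eq]

/-- Bounds for the solutions of linear differential equations with parameters: if
`∂ₛ v = M v + g`, where `M` has logarithmic bounds, then `v` inherits the bounds of `g` and
of the initial values. -/
lemma ScaleOrd.of_linear_ode [FiniteDimensional ℝ E] (hS : IsScale S) (hN : IsScaleModule S N)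
    (k : ℕ) : ∀ {v g : Eps → E × ℝ → F} {M : Eps → E × ℝ → F →L[ℝ] F},
      (∀ ε, ContDiff ℝ ∞ (v ε)) → (∀ ε, ContDiff ℝ ∞ (g ε)) → (∀ ε, ContDiff ℝ ∞ (M ε)) →
      (∀ ε z, _root_.fderiv ℝ (v ε) z (0, 1) = M ε z (v ε z) + g ε z) →
      ScaleOrd S k M → LogOrd S M → ScaleOrd N k g → ScaleOrd N k (fun ε p => v ε (p, 0)) →
      ScaleOrd N k v := by
  induction k with
  | zero => exact fun sv _ _ hode _ hlog hg hv0 => zero_of_linear_ode hS hN sv hode hlog hg hv0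
  | succ k ih =>
    intro v g M sv sg sM hode hM hlog hg hv0
    have hv : ScaleOrd N k v := ih sv sg sM hode (hM.of_le (by omega)) hlog (hg.of_le (by omega))
      (hv0.of_le (by omega))
    refine (hv.of_le (by omega)).succ_of_fderiv_apply hS hN sv fun w => ?_
    have sMw : ∀ ε, ContDiff ℝ ∞ fun z => _root_.fderiv ℝ (M ε) z w :=
      fun ε => contDiff_fderiv_apply (sM ε) w
    have sMwv : ∀ ε, ContDiff ℝ ∞ fun z => _root_.fderiv ℝ (M ε) z w (v ε z) :=
      fun ε => (sMw ε).clm_apply (sv ε)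
    have sgw : ∀ ε, ContDiff ℝ ∞ fun z => _root_.fderiv ℝ (g ε) z w :=
      fun ε => contDiff_fderiv_apply (sg ε) w
    have hMwv : ScaleOrd N k fun ε z => _root_.fderiv ℝ (M ε) z w (v ε z) :=
      ScaleOrd.bilin hS hN (ContinuousLinearMap.id ℝ (F →L[ℝ] F)).flip sv sMw hv
        (hM.fderiv_apply hS hS.isScaleModule sM w)
    -- `∂_w v` solves the equation with the same coefficient `M` and the source `∂_w M v + ∂_w g`,
    -- which has bounds of order `k` because `v` has. No derivative of `M` enters the exponential.
    refine ih (M := M)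
      (g := fun ε z => _root_.fderiv ℝ (M ε) z w (v ε z) + _root_.fderiv ℝ (g ε) z w)
      (fun ε => contDiff_fderiv_apply (sv ε) w) (fun ε => (sMwv ε).add (sgw ε)) sM ?_
      (hM.of_le (by omega)) hlog (hMwv.add hN sMwv sgw (hg.fderiv_apply hS hN sg w)) ?_
    · intro ε z
      rw [fderiv_fderiv_apply_comm (sv ε), show (fun z => _root_.fderiv ℝ (v ε) z (0, 1)) =
        fun z => M ε z (v ε z) + g ε z from funext fun z => hode ε z, fderiv_fun_add
        (((((sM ε).clm_apply (sv ε))).differentiable (by simp)) z)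
        (((sg ε).differentiable (by simp)) z),
        fderiv_clm_apply (((sM ε).differentiable (by simp)) z)
        (((sv ε).differentiable (by simp)) z)]
      simp [add_assoc]
    · have s0 : ∀ ε, ContDiff ℝ ∞ (fun p => v ε (p, 0)) := fun ε => (sv ε).comp (by fun_prop)
      have se : ContDiff ℝ ∞ fun p : E => (p, (0 : ℝ)) := by fun_prop
      -- At time zero the space part of `w` differentiates the initial values, and the time part is
      -- read off the equation.
      have key : (fun ε p => _root_.fderiv ℝ (v ε) (p, 0) w) = fun ε p =>
          _root_.fderiv ℝ (fun p => v ε (p, 0)) p w.1 +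
          (w.2 • ContinuousLinearMap.id ℝ F) (M ε (p, 0) (v ε (p, 0)) + g ε (p, 0)) := by
        funext ε p
        have h1 : _root_.fderiv ℝ (fun p => v ε (p, 0)) p =
            (_root_.fderiv ℝ (v ε) (p, 0)).comp (ContinuousLinearMap.inl ℝ E ℝ) :=
          ((((sv ε).differentiable (by simp)) (p, 0)).hasFDerivAt.comp p
            (hasFDerivAt_prodMk_left p 0)).fderiv
        rw [h1, ← hode]
        have : w = (w.1, 0) + w.2 • ((0 : E), (1 : ℝ)) := by simp
        conv_lhs => rw [this, map_add, map_smul]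
        simp
      rw [key]
      have sMv : ∀ ε, ContDiff ℝ ∞ (fun p => M ε (p, 0) (v ε (p, 0))) :=
        fun ε => ((sM ε).comp se).clm_apply (s0 ε)
      have sg0 : ∀ ε, ContDiff ℝ ∞ (fun p => g ε (p, 0)) := fun ε => (sg ε).comp se
      have hMv : ScaleOrd N k (fun ε p => M ε (p, 0) (v ε (p, 0))) :=
        ScaleOrd.bilin hS hN (ContinuousLinearMap.id ℝ (F →L[ℝ] F)).flip s0
          (fun ε => (sM ε).comp se) (hv0.of_le (by omega))
          ((hM.of_le (by omega)).comp_const hS hS.isScaleModule sM se)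
      exact ScaleOrd.add hN (fun ε => contDiff_fderiv_apply (s0 ε) _)
        (fun ε => (ContinuousLinearMap.contDiff _).comp ((sMv ε).add (sg0 ε)))
        (hv0.fderiv_apply hS hN s0 _)
        (ScaleOrd.clm hS hN _ (fun ε => (sMv ε).add (sg0 ε))
          (hMv.add hN sMv sg0 ((hg.of_le (by omega)).comp_const hS hN sg se)))

end ScaleOrd

/-! ### Characteristic flows -/

section CharFlow

variable {E : Type} [NormedAddCommGroup E] [NormedSpace ℝ E]

/-- `γ(x, t, s)` is the flow of the time dependent field `-a`, started in `x` at time `t`. -/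
structure IsFlow (a : ℝ × E → E) (γ : E × ℝ × ℝ → E) : Prop where
  smooth : ContDiff ℝ ∞ γ
  init : ∀ x t, γ (x, t, t) = x
  deriv : ∀ x t s, HasDerivAt (fun s => γ (x, t, s)) (-a (s, γ (x, t, s))) s

lemma exists_isFlow [FiniteDimensional ℝ E] {a : ℝ × E → E} (ha : ContDiff ℝ ∞ a) {K : Set E}
    (hK : IsCompact K) (hsupp : ∀ t, ∀ x ∉ K, a (t, x) = 0) : ∃ γ, IsFlow a γ := by
  obtain ⟨g, sg, hg0, hg⟩ := exists_flow ha.neg hK (fun t x hx => by simp [hsupp t x hx])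
  refine ⟨fun z => g ((z.1, z.2.1), z.2.2 - z.2.1), sg.comp (by fun_prop), fun x t => by simp [hg0],
    fun x t s => ?_⟩
  have := (hg (x, t) (s - t)).scomp s ((hasDerivAt_id s).sub_const t)
  simpa [Function.comp_def] using this

section

variable [FiniteDimensional ℝ E] {a : ℝ × E → E} {γ : E × ℝ × ℝ → E}

/-- Any integral curve is determined by its value at one time; the cocycle law and the rest points
outside the support are special cases. -/
lemma IsFlow.eq_of_hasDerivAt (hγ : IsFlow a γ) (ha : ContDiff ℝ ∞ a) {c : ℝ → E}
    (hc : ∀ s, HasDerivAt c (-a (s, c s)) s) (t s : ℝ) : c s = γ (c t, t, s) := by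
  have hf : ContDiff ℝ 1 (Function.uncurry fun s x => -a (s, x)) :=
    (ha.of_le (by exact_mod_cast le_top)).neg
  exact congrFun (ode_unique_univ hf (t₀ := t) hc (hγ.deriv (c t) t) (hγ.init _ _).symm) s

lemma IsFlow.cocycle (hγ : IsFlow a γ) (ha : ContDiff ℝ ∞ a) (x : E) (t r s : ℝ) :
    γ (γ (x, t, r), r, s) = γ (x, t, s) :=
  (hγ.eq_of_hasDerivAt ha (hγ.deriv x t) r s).symm

/-- A point outside `K` is an equilibrium at all times. A characteristic that is outside `K` at time
`s` is therefore constant, hence equal to its starting point. -/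
lemma IsFlow.mem_or_eq (hγ : IsFlow a γ) (ha : ContDiff ℝ ∞ a) {K : Set E}
    (hsupp : ∀ t, ∀ x ∉ K, a (t, x) = 0) (x : E) (t s : ℝ) :
    γ (x, t, s) ∈ K ∨ γ (x, t, s) = x := by
  by_cases h : γ (x, t, s) ∈ K
  · exact Or.inl h
  · right
    have h1 := hγ.eq_of_hasDerivAt ha (c := fun _ => γ (x, t, s)) (fun r => by
      rw [hsupp r _ h, neg_zero]; exact hasDerivAt_const _ _) s t
    rw [hγ.cocycle ha, hγ.init] at h1
    exact h1

end

variable (E) in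
/-- `((x, t), σ) ↦ (x, t, t + σ)`. -/
def shiftTime : (E × ℝ) × ℝ →L[ℝ] E × ℝ × ℝ :=
  ((ContinuousLinearMap.fst ℝ E ℝ).comp (ContinuousLinearMap.fst ℝ (E × ℝ) ℝ)).prod
    (((ContinuousLinearMap.snd ℝ E ℝ).comp (ContinuousLinearMap.fst ℝ (E × ℝ) ℝ)).prod
      ((ContinuousLinearMap.snd ℝ E ℝ).comp (ContinuousLinearMap.fst ℝ (E × ℝ) ℝ) +
        ContinuousLinearMap.snd ℝ (E × ℝ) ℝ))

@[simp] lemma shiftTime_apply (z : (E × ℝ) × ℝ) :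
    shiftTime E z = (z.1.1, z.1.2, z.1.2 + z.2) := rfl

lemma fderiv_comp_shiftTime {F : Type} [NormedAddCommGroup F] [NormedSpace ℝ F]
    {u : E × ℝ × ℝ → F} (su : ContDiff ℝ ∞ u) (z w : (E × ℝ) × ℝ) :
    fderiv ℝ (fun z => u (shiftTime E z)) z w = fderiv ℝ u (shiftTime E z) (shiftTime E w) := by
  have h : HasFDerivAt (fun z => u (shiftTime E z))
      ((fderiv ℝ u (shiftTime E z)).comp (shiftTime E)) z :=
    (su.differentiable (by simp) (shiftTime E z)).hasFDerivAt.comp z (shiftTime E).hasFDerivAt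
  rw [h.fderiv]
  rfl

lemma IsFlow.fderiv_apply {a : ℝ × E → E} {γ : E × ℝ × ℝ → E} (hγ : IsFlow a γ)
    (z : E × ℝ × ℝ) : fderiv ℝ γ z (0, 0, 1) = -a (z.2.2, γ z) := by
  have h := (hγ.smooth.differentiable (by simp) z).hasFDerivAt.comp_hasDerivAt z.2.2
    ((hasDerivAt_const z.2.2 z.1).prodMk ((hasDerivAt_const z.2.2 z.2.1).prodMk
      (hasDerivAt_id z.2.2)))
  exact h.unique (hγ.deriv z.1 z.2.1 z.2.2)

/-- The derivative in the space variables. -/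
noncomputable def fderivSnd {F : Type} [NormedAddCommGroup F] [NormedSpace ℝ F]
    (a : ℝ × E → F) (z : ℝ × E) : E →L[ℝ] F := (fderiv ℝ a z).comp (ContinuousLinearMap.inr ℝ ℝ E)

lemma contDiff_fderivSnd {F : Type} [NormedAddCommGroup F] [NormedSpace ℝ F]
    {a : ℝ × E → F} (sa : ContDiff ℝ ∞ a) : ContDiff ℝ ∞ (fderivSnd a) :=
  (contDiff_fderiv sa).clm_comp contDiff_const

variable {S N : Set (Eps → ℝ)} {k : ℕ}

lemma ScaleOrd.spaceDeriv {F : Type} [NormedAddCommGroup F] [NormedSpace ℝ F] (hS : IsScale S)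
    (hN : IsScaleModule S N) {a : Eps → ℝ × E → F} (sa : ∀ ε, ContDiff ℝ ∞ (a ε))
    (ha : ScaleOrd N (k + 1) a) : ScaleOrd N k (fun ε => fderivSnd (a ε)) :=
  ScaleOrd.clm (F' := E →L[ℝ] F) hS hN
    ((ContinuousLinearMap.compL ℝ E (ℝ × E) F).flip (ContinuousLinearMap.inr ℝ ℝ E))
    (fun ε => contDiff_fderiv (sa ε)) ha.fderiv

variable [FiniteDimensional ℝ E] {a : Eps → ℝ × E → E} {γ : Eps → E × ℝ × ℝ → E} {K : Set E}

lemma IsFlow.cBounded (hγ : ∀ ε, IsFlow (a ε) (γ ε)) (sa : ∀ ε, ContDiff ℝ ∞ (a ε))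
    (hK : IsCompact K) (hsupp : ∀ ε t, ∀ x ∉ K, a ε (t, x) = 0) : CBounded γ := fun L hL => by
  refine ⟨K ∪ Prod.fst '' L, hK.union (hL.image continuous_fst), Eventually.of_forall
    fun ε z hz => ?_⟩
  rcases (hγ ε).mem_or_eq (sa ε) (hsupp ε) z.1 z.2.1 z.2.2 with h | h
  · exact Or.inl h
  · exact Or.inr ⟨z, hz, h.symm⟩

lemma CBounded.prodMk {G F F' : Type} [NormedAddCommGroup F] [NormedAddCommGroup F']
    [NormedAddCommGroup G] [NormedSpace ℝ G] [NormedSpace ℝ F] [NormedSpace ℝ F']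
    {u : Eps → G → F} {v : Eps → G → F'} (hu : CBounded u) (hv : CBounded v) :
    CBounded (fun ε x => (u ε x, v ε x)) := fun L hL => by
  obtain ⟨M, hM, h1⟩ := hu L hL
  obtain ⟨M', hM', h2⟩ := hv L hL
  exact ⟨M ×ˢ M', hM.prod hM', by filter_upwards [h1, h2] with ε a b x hx using ⟨a hx, b hx⟩⟩

/-- `((x, t), σ) ↦ (t + σ, g ((x, t), σ))`. -/
def withTime (g : (E × ℝ) × ℝ → E) (z : (E × ℝ) × ℝ) : ℝ × E := (z.1.2 + z.2, g z)

lemma contDiff_time : ContDiff ℝ ∞ fun z : (E × ℝ) × ℝ => z.1.2 + z.2 := by fun_prop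

lemma contDiff_withTime {g : (E × ℝ) × ℝ → E} (sg : ContDiff ℝ ∞ g) :
    ContDiff ℝ ∞ (withTime g) := contDiff_time.prodMk sg

lemma CBounded.graph {g : Eps → (E × ℝ) × ℝ → E} (cg : CBounded g) :
    CBounded fun ε => withTime (g ε) :=
  (cBounded_const contDiff_time.continuous).prodMk cg

lemma ScaleOrd.graph (hS : IsScale S) {g : Eps → (E × ℝ) × ℝ → E}
    (sg : ∀ ε, ContDiff ℝ ∞ (g ε)) (hg : ScaleOrd S k g) :
    ScaleOrd S k fun ε => withTime (g ε) :=
  ScaleOrd.prodMk hS.isScaleModule (fun _ => contDiff_time) sg (scaleOrd_const hS contDiff_time) hg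

/-- Separates the time derivative of `a`, which ends up in the source, from its space derivative,
which alone multiplies the unknown and needs a logarithmic bound. -/
lemma fderiv_comp_withTime {F : Type} [NormedAddCommGroup F] [NormedSpace ℝ F]
    {a : ℝ × E → F} {g : (E × ℝ) × ℝ → E} (sa : ContDiff ℝ ∞ a) (sg : ContDiff ℝ ∞ g)
    (z w : (E × ℝ) × ℝ) :
    fderiv ℝ (fun z => a (withTime g z)) z w = (w.1.2 + w.2) • fderiv ℝ a (withTime g z) (1, 0) +
      fderivSnd a (withTime g z) (fderiv ℝ g z w) := by
  have h1 : HasFDerivAt (withTime g) (((ContinuousLinearMap.snd ℝ E ℝ).comp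
      (ContinuousLinearMap.fst ℝ (E × ℝ) ℝ) + ContinuousLinearMap.snd ℝ (E × ℝ) ℝ).prod
      (fderiv ℝ g z)) z :=
    (((ContinuousLinearMap.snd ℝ E ℝ).comp (ContinuousLinearMap.fst ℝ (E × ℝ) ℝ) +
      ContinuousLinearMap.snd ℝ (E × ℝ) ℝ).hasFDerivAt).prodMk
      (sg.differentiable (by simp) z).hasFDerivAt
  have h2 := ((sa.differentiable (by simp) (withTime g z)).hasFDerivAt.comp z h1).fderiv
  rw [Function.comp_def] at h2
  rw [h2]
  have e : (w.1.2 + w.2, fderiv ℝ g z w) =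
      (w.1.2 + w.2) • ((1 : ℝ), (0 : E)) + (0, fderiv ℝ g z w) := by simp
  change fderiv ℝ a (withTime g z) (w.1.2 + w.2, fderiv ℝ g z w) = _
  rw [e, map_add, map_smul]
  simp [fderivSnd]

/-- Each `∂_w g` solves a linear equation with coefficient `-∂ₓa` along the flow and a source made
of `∂_t a` along the flow. Both have order `k` bounds by the induction hypothesis on `g`, so
`ScaleOrd.of_linear_ode` gives order `k` for `∂_w g`. -/
lemma scaleOrd_succ_of_flow (hS : IsScale S) {g : Eps → (E × ℝ) × ℝ → E}
    (sg : ∀ ε, ContDiff ℝ ∞ (g ε)) (cg : CBounded g) (hg0 : ∀ ε p, g ε (p, 0) = p.1)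
    (hg : ∀ ε z, fderiv ℝ (g ε) z (0, 1) = -a ε (withTime (g ε) z))
    (sa : ∀ ε, ContDiff ℝ ∞ (a ε)) (ha : ScaleOrd S (k + 1) a)
    (hlog : LogOrd S fun ε => fderivSnd (a ε)) (ih : ScaleOrd S k g) :
    ScaleOrd S (k + 1) g := by
  have hM := hS.isScaleModule
  have sh : ∀ ε, ContDiff ℝ ∞ (withTime (g ε)) := fun ε => contDiff_withTime (sg ε)
  have ch := cg.graph
  have hh := ih.graph hS sg
  have sDa : ∀ ε, ContDiff ℝ ∞ fun z => fderiv ℝ (a ε) z (1, 0) :=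
    fun ε => contDiff_fderiv_apply (sa ε) (1, 0)
  have hDa : ScaleOrd S k fun ε z => fderiv ℝ (a ε) z (1, 0) :=
    ha.fderiv_apply hS hM sa (1, 0)
  have sah : ∀ ε, ContDiff ℝ ∞ (fun z => fderiv ℝ (a ε) (withTime (g ε) z) (1, 0)) :=
    fun ε => (sDa ε).comp (sh ε)
  have hah : ScaleOrd S k (fun ε z => fderiv ℝ (a ε) (withTime (g ε) z) (1, 0)) :=
    (hDa.comp hS hM sDa sh hh ch :)
  have sSa : ∀ ε, ContDiff ℝ ∞ (fderivSnd (a ε)) := fun ε => contDiff_fderivSnd (sa ε)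
  have hSa : ScaleOrd S k fun ε => fderivSnd (a ε) := ha.spaceDeriv hS hM sa
  have sM : ∀ ε, ContDiff ℝ ∞ (fun z => fderivSnd (a ε) (withTime (g ε) z)) :=
    fun ε => (sSa ε).comp (sh ε)
  have hMh : ScaleOrd S k (fun ε z => fderivSnd (a ε) (withTime (g ε) z)) :=
    (hSa.comp hS hM sSa sh hh ch :)
  refine (ih.of_le (by omega)).succ_of_fderiv_apply hS hM sg fun w => ?_
  have sw : ∀ ε, ContDiff ℝ ∞ fun z => fderiv ℝ (g ε) z w := fun ε => contDiff_fderiv_apply (sg ε) w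
  have sr : ∀ ε, ContDiff ℝ ∞ fun z =>
      -(w.1.2 + w.2) • fderiv ℝ (a ε) (withTime (g ε) z) (1, 0) := fun ε => contDiff_const.smul (sah ε)
  have hr : ScaleOrd S k fun ε z => -(w.1.2 + w.2) • fderiv ℝ (a ε) (withTime (g ε) z) (1, 0) :=
    hah.clm hS hM (-(w.1.2 + w.2) • ContinuousLinearMap.id ℝ E) sah
  have sMn : ∀ ε, ContDiff ℝ ∞ (fun z => -fderivSnd (a ε) (withTime (g ε) z)) :=
    fun ε => (sM ε).neg
  have hMn : ScaleOrd S k (fun ε z => -fderivSnd (a ε) (withTime (g ε) z)) := hMh.neg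
  have hlog' : LogOrd S (fun ε z => -fderivSnd (a ε) (withTime (g ε) z)) :=
    (hlog.comp ch :).mono fun ε z => by simp
  refine ScaleOrd.of_linear_ode hS hM k sw sr sMn ?_ hMn hlog' hr ?_
  · intro ε z
    rw [fderiv_fderiv_apply_comm (sg ε), show (fun z => fderiv ℝ (g ε) z (0, 1)) =
      fun z => -a ε (withTime (g ε) z) from funext (hg ε), fderiv_fun_neg,
      ContinuousLinearMap.neg_apply, fderiv_comp_withTime (sa ε) (sg ε)]
    simp only [ContinuousLinearMap.neg_apply]
    module
  · have se : ContDiff ℝ ∞ fun p : E × ℝ => (p.2, p.1) := by fun_prop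
    -- Initial value of `∂_w g`: the space part differentiates `g (p, 0) = p.1`, the time part is
    -- given by the field.
    have e1 : (fun ε p => fderiv ℝ (g ε) (p, 0) w) = fun ε (p : E × ℝ) =>
        w.1.1 + (-w.2 • ContinuousLinearMap.id ℝ E) (a ε (p.2, p.1)) := by
      funext ε p
      have h1 : fderiv ℝ (fun p => g ε (p, 0)) p =
          (fderiv ℝ (g ε) (p, 0)).comp (ContinuousLinearMap.inl ℝ (E × ℝ) ℝ) :=
        (((sg ε).differentiable (by simp) (p, 0)).hasFDerivAt.comp p
          (hasFDerivAt_prodMk_left p 0)).fderiv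
      rw [show (fun p => g ε (p, 0)) = Prod.fst from funext (hg0 ε), fderiv_fst] at h1
      have h3 : fderiv ℝ (g ε) (p, 0) (w.1, 0) = w.1.1 := by
        have := DFunLike.congr_fun h1 w.1
        simpa using this.symm
      have h4 : withTime (g ε) (p, 0) = (p.2, p.1) := by
        simp [withTime, hg0]
      have : w = (w.1, 0) + w.2 • ((0 : E × ℝ), (1 : ℝ)) := by simp
      conv_lhs => rw [this, map_add, map_smul, h3, hg, h4]
      simp
    rw [e1]
    have sae : ∀ ε, ContDiff ℝ ∞ fun p : E × ℝ => a ε (p.2, p.1) := fun ε => (sa ε).comp se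
    exact ScaleOrd.add hM (fun _ => contDiff_const)
      (fun ε => (ContinuousLinearMap.contDiff _).comp (sae ε))
      (scaleOrd_const hS contDiff_const)
      (ScaleOrd.clm hS hM _ sae ((ha.of_le (by omega)).comp_const hS hM sa se))

/-- The flow inherits the bounds of the field, if its space derivatives have logarithmic bounds. -/
lemma IsFlow.scaleOrd (hS : IsScale S) (hγ : ∀ ε, IsFlow (a ε) (γ ε))
    (sa : ∀ ε, ContDiff ℝ ∞ (a ε)) (cγ : CBounded γ) (ha : ∀ k, ScaleOrd S k a)
    (hlog : LogOrd S fun ε => fderivSnd (a ε)) (k : ℕ) : ScaleOrd S k γ := by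
  have sγ := fun ε => (hγ ε).smooth
  -- In the shifted time `σ = s - t` the initial condition moves from the diagonal `s = t` to `σ =
  -- 0`, as the linear estimate requires.
  have sg : ∀ ε, ContDiff ℝ ∞ fun z => γ ε (shiftTime E z) :=
    fun ε => (sγ ε).comp (shiftTime E).contDiff
  have cg : CBounded fun ε z => γ ε (shiftTime E z) :=
    cγ.comp (cBounded_const (shiftTime E).continuous)
  have key : ScaleOrd S k fun ε z => γ ε (shiftTime E z) := by
    induction k with
    | zero => exact ScaleOrd.zero_of_cBounded hS cg
    | succ k ih =>
      refine scaleOrd_succ_of_flow hS sg cg (fun ε p => by simp [(hγ ε).init]) (fun ε z => ?_) sa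
        (ha _) hlog ih
      rw [fderiv_comp_shiftTime (sγ ε)]
      simpa [withTime] using (hγ ε).fderiv_apply (shiftTime E z)
  have := key.comp_const hS hS.isScaleModule sg
    (by fun_prop : ContDiff ℝ ∞ fun z : E × ℝ × ℝ => ((z.1, z.2.1), z.2.2 - z.2.1))
  simpa using this

end CharFlow

/-! ### Transport equations -/

section Transport

variable {E : Type} [NormedAddCommGroup E] [NormedSpace ℝ E] [FiniteDimensional ℝ E]
  {F : Type} [NormedAddCommGroup F] [NormedSpace ℝ F]
  {S N : Set (Eps → ℝ)} {k : ℕ}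

lemma fderiv_comp_clm {G H : Type} [NormedAddCommGroup G] [NormedSpace ℝ G] [NormedAddCommGroup H]
    [NormedSpace ℝ H] {u : H → F} (su : ContDiff ℝ ∞ u) (L : G →L[ℝ] H) (z w : G) :
    fderiv ℝ (fun z => u (L z)) z w = fderiv ℝ u (L z) (L w) := by
  have h : HasFDerivAt (fun z => u (L z)) ((fderiv ℝ u (L z)).comp L) z :=
    (su.differentiable (by simp) (L z)).hasFDerivAt.comp z L.hasFDerivAt
  rw [h.fderiv]
  rfl

/-- `ScaleOrd.of_linear_ode` with the time variable in front. -/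
lemma ScaleOrd.of_linear_ode_fst (hS : IsScale S) (hN : IsScaleModule S N)
    {v g : Eps → ℝ × E → F} {M : Eps → ℝ × E → F →L[ℝ] F}
    (sv : ∀ ε, ContDiff ℝ ∞ (v ε)) (sg : ∀ ε, ContDiff ℝ ∞ (g ε)) (sM : ∀ ε, ContDiff ℝ ∞ (M ε))
    (hode : ∀ ε z, _root_.fderiv ℝ (v ε) z (1, 0) = M ε z (v ε z) + g ε z)
    (hM : ScaleOrd S k M) (hlog : LogOrd S M) (hg : ScaleOrd N k g)
    (hv0 : ScaleOrd N k (fun ε p => v ε (0, p))) : ScaleOrd N k v := by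
  let L : E × ℝ →L[ℝ] ℝ × E := (ContinuousLinearMap.snd ℝ E ℝ).prod (ContinuousLinearMap.fst ℝ E ℝ)
  have hL : ∀ z, L z = (z.2, z.1) := fun _ => rfl
  have h := ScaleOrd.of_linear_ode hS hN k (v := fun ε z => v ε (L z)) (g := fun ε z => g ε (L z))
    (M := fun ε z => M ε (L z)) (fun ε => (sv ε).comp L.contDiff) (fun ε => (sg ε).comp L.contDiff)
    (fun ε => (sM ε).comp L.contDiff)
    (fun ε z => by rw [fderiv_comp_clm (sv ε), ← hode]; rfl)
    (hM.comp_const hS hS.isScaleModule sM L.contDiff :)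
    (hlog.comp (cBounded_const L.continuous) :) (hg.comp_const hS hN sg L.contDiff :) hv0
  have h2 := (h.comp_const hS hN (fun ε => (sv ε).comp L.contDiff)
    (by fun_prop : ContDiff ℝ ∞ fun z : ℝ × E => (z.2, z.1)) :)
  simpa [hL] using h2

/-! #### Primitives -/

/-- The primitive `∫₀ᵗ g(τ, y) dτ`. -/
noncomputable def prim (g : ℝ × E → ℂ) (z : ℝ × E) : ℂ := ∫ τ in (0 : ℝ)..z.1, g (τ, z.2)

lemma contDiff_prim {g : ℝ × E → ℂ} (sg : ContDiff ℝ ∞ g) : ContDiff ℝ ∞ (prim g) := by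
  have : ProperSpace E := FiniteDimensional.proper ℝ E
  have e : prim g = fun z => (z.1 : ℂ) * ∫ s in (0 : ℝ)..1, g (z.1 * s, z.2) :=
    funext fun z => intervalIntegral_eq_unit _ _
  rw [e]
  exact timeCoord_contDiff.mul (contDiff_unitIntegral (g := fun z : (ℝ × E) × ℝ =>
    g (z.1.1 * z.2, z.1.2)) (sg.comp rescale_contDiff))

lemma fderiv_apply_one_zero {u : ℝ × E → F} (su : ContDiff ℝ ∞ u) {z : ℝ × E} {d : F}
    (h : HasDerivAt (fun s => u (s, z.2)) d z.1) : fderiv ℝ u z (1, 0) = d := by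
  have h1 := (su.differentiable (by simp) z).hasFDerivAt.comp_hasDerivAt z.1
    ((hasDerivAt_id z.1).prodMk (hasDerivAt_const z.1 z.2))
  exact h1.unique h

lemma fderiv_prim {g : ℝ × E → ℂ} (sg : ContDiff ℝ ∞ g) (z : ℝ × E) :
    fderiv ℝ (prim g) z (1, 0) = g z := by
  refine fderiv_apply_one_zero (contDiff_prim sg) ?_
  have hc : Continuous fun τ : ℝ => g (τ, z.2) := sg.continuous.comp (by fun_prop)
  exact intervalIntegral.integral_hasDerivAt_right (hc.intervalIntegrable _ _)
    (hc.stronglyMeasurableAtFilter _ _) hc.continuousAt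

lemma prim_zero (g : ℝ × E → ℂ) (y : E) : prim g (0, y) = 0 := by simp [prim]

/-- A primitive solves `∂_t v = 0 · v + g` with zero initial value, so the estimate for linear
equations applies. -/
lemma ScaleOrd.prim (hS : IsScale S) (hN : IsScaleModule S N) {g : Eps → ℝ × E → ℂ}
    (sg : ∀ ε, ContDiff ℝ ∞ (g ε)) (hg : ScaleOrd N k g) : ScaleOrd N k fun ε => prim (g ε) := by
  refine ScaleOrd.of_linear_ode_fst hS hN (M := fun _ _ => 0) (fun ε => contDiff_prim (sg ε)) sg
    (fun _ => contDiff_const) (fun ε z => by simp [fderiv_prim (sg ε)])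
    (scaleOrd_const hS contDiff_const) (fun K _ => ⟨fun _ => 0, fun T => ?_, by simp⟩) hg ?_
  · simpa using hS.one
  · simpa [prim_zero] using scaleOrd_zero (E := E) (F := ℂ) (k := k) hN

/-- Multiplication by a complex number as a real linear map. -/
noncomputable def mulL : ℂ →L[ℝ] ℂ →L[ℝ] ℂ := ContinuousLinearMap.mul ℝ ℂ

lemma mulL_apply (a b : ℂ) : mulL a b = a * b := rfl

lemma norm_mulL_le (a : ℂ) : ‖mulL a‖ ≤ ‖a‖ :=
  ContinuousLinearMap.opNorm_le_bound _ (norm_nonneg _) fun b => by simp [mulL_apply]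

/-- Bounds for the solutions of scalar linear equations. -/
lemma ScaleOrd.of_scalar_ode (hS : IsScale S) (hN : IsScaleModule S N)
    {v g β : Eps → ℝ × E → ℂ} (sv : ∀ ε, ContDiff ℝ ∞ (v ε)) (sg : ∀ ε, ContDiff ℝ ∞ (g ε))
    (sβ : ∀ ε, ContDiff ℝ ∞ (β ε))
    (hode : ∀ ε z, _root_.fderiv ℝ (v ε) z (1, 0) = β ε z * v ε z + g ε z)
    (hβ : ScaleOrd S k β) (hlog : LogOrd S β) (hg : ScaleOrd N k g)
    (hv0 : ScaleOrd N k (fun ε p => v ε (0, p))) : ScaleOrd N k v :=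
  ScaleOrd.of_linear_ode_fst hS hN (M := fun ε z => mulL (β ε z)) sv sg
    (fun ε => mulL.contDiff.comp (sβ ε)) hode (hβ.clm hS hS.isScaleModule mulL sβ :)
    (hlog.mono fun ε z => norm_mulL_le _) hg hv0

lemma contDiff_exp_prim {g : ℝ × E → ℂ} (sg : ContDiff ℝ ∞ g) :
    ContDiff ℝ ∞ fun z => Complex.exp (prim g z) := (contDiff_prim sg).cexp

lemma fderiv_exp_prim {g : ℝ × E → ℂ} (sg : ContDiff ℝ ∞ g) (z : ℝ × E) :
    fderiv ℝ (fun z => Complex.exp (prim g z)) z (1, 0) = g z * Complex.exp (prim g z) := by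
  have h := ((contDiff_prim sg).differentiable (by simp) z).hasFDerivAt.cexp
  rw [h.fderiv, _root_.smul_apply, fderiv_prim sg, smul_eq_mul, mul_comm]

/-- The exponential is estimated as the solution of `∂_t v = β v`, `v = 1` at `t = 0`. Moderate
bounds on the exponent would not suffice; the logarithmic bound on `β` does. -/
lemma ScaleOrd.exp_prim (hS : IsScale S) {β : Eps → ℝ × E → ℂ} (sβ : ∀ ε, ContDiff ℝ ∞ (β ε))
    (hβ : ScaleOrd S k β) (hlog : LogOrd S β) :
    ScaleOrd S k fun ε z => Complex.exp (Colombeau.prim (β ε) z) := by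
  refine ScaleOrd.of_scalar_ode hS hS.isScaleModule (g := fun _ _ => 0)
    (fun ε => contDiff_exp_prim (sβ ε)) (fun _ => contDiff_const) sβ
    (fun _ _ => by rw [fderiv_exp_prim (sβ _), add_zero]) hβ hlog
    (scaleOrd_zero hS.isScaleModule) ?_
  simpa [prim_zero] using scaleOrd_const (E := E) (F := ℂ) (k := k) hS (f := fun _ => 1)
    contDiff_const

/-! #### The flow maps -/

/-- `(t, y) ↦ (t, γ(y, 0, t))`. -/
def forward (γ : E × ℝ × ℝ → E) (z : ℝ × E) : ℝ × E := (z.1, γ (z.2, 0, z.1))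

/-- `(t, x) ↦ (t, γ(x, t, 0))`. -/
def backward (γ : E × ℝ × ℝ → E) (z : ℝ × E) : ℝ × E := (z.1, γ (z.2, z.1, 0))

lemma contDiff_forward {γ : E × ℝ × ℝ → E} (sγ : ContDiff ℝ ∞ γ) : ContDiff ℝ ∞ (forward γ) :=
  contDiff_fst.prodMk (sγ.comp (by fun_prop : ContDiff ℝ ∞ fun z : ℝ × E => (z.2, (0 : ℝ), z.1)))

lemma contDiff_backward {γ : E × ℝ × ℝ → E} (sγ : ContDiff ℝ ∞ γ) : ContDiff ℝ ∞ (backward γ) :=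
  contDiff_fst.prodMk (sγ.comp (by fun_prop : ContDiff ℝ ∞ fun z : ℝ × E => (z.2, z.1, (0 : ℝ))))

lemma CBounded.forward {γ : Eps → E × ℝ × ℝ → E} (cγ : CBounded γ) :
    CBounded fun ε => forward (γ ε) :=
  (cBounded_const continuous_fst).prodMk (cγ.comp (cBounded_const
    (by fun_prop : Continuous fun z : ℝ × E => (z.2, (0 : ℝ), z.1))) :)

lemma CBounded.backward {γ : Eps → E × ℝ × ℝ → E} (cγ : CBounded γ) :
    CBounded fun ε => backward (γ ε) :=
  (cBounded_const continuous_fst).prodMk (cγ.comp (cBounded_const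
    (by fun_prop : Continuous fun z : ℝ × E => (z.2, z.1, (0 : ℝ)))) :)

lemma ScaleOrd.forward (hS : IsScale S) {γ : Eps → E × ℝ × ℝ → E} (sγ : ∀ ε, ContDiff ℝ ∞ (γ ε))
    (hγ : ScaleOrd S k γ) : ScaleOrd S k fun ε => forward (γ ε) := by
  have c : ContDiff ℝ ∞ fun z : ℝ × E => (z.2, (0 : ℝ), z.1) := by fun_prop
  exact ScaleOrd.prodMk hS.isScaleModule (fun _ => contDiff_fst) (fun ε => (sγ ε).comp c)
    (scaleOrd_const hS contDiff_fst) (hγ.comp_const hS hS.isScaleModule sγ c :)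

lemma ScaleOrd.backward (hS : IsScale S) {γ : Eps → E × ℝ × ℝ → E} (sγ : ∀ ε, ContDiff ℝ ∞ (γ ε))
    (hγ : ScaleOrd S k γ) : ScaleOrd S k fun ε => backward (γ ε) := by
  have c : ContDiff ℝ ∞ fun z : ℝ × E => (z.2, z.1, (0 : ℝ)) := by fun_prop
  exact ScaleOrd.prodMk hS.isScaleModule (fun _ => contDiff_fst) (fun ε => (sγ ε).comp c)
    (scaleOrd_const hS contDiff_fst) (hγ.comp_const hS hS.isScaleModule sγ c :)

lemma IsFlow.forward_backward {a : ℝ × E → E} {γ : E × ℝ × ℝ → E} (hγ : IsFlow a γ)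
    (sa : ContDiff ℝ ∞ a) (z : ℝ × E) : forward γ (backward γ z) = z := by
  simp [forward, backward, hγ.cocycle sa, hγ.init]

lemma IsFlow.backward_forward {a : ℝ × E → E} {γ : E × ℝ × ℝ → E} (hγ : IsFlow a γ)
    (sa : ContDiff ℝ ∞ a) (z : ℝ × E) : backward γ (forward γ z) = z := by
  simp [forward, backward, hγ.cocycle sa, hγ.init]

/-- Derivative of a function along the characteristics. -/
lemma IsFlow.fderiv_comp_forward {a : ℝ × E → E} {γ : E × ℝ × ℝ → E} (hγ : IsFlow a γ)
    {u : ℝ × E → ℂ} (su : ContDiff ℝ ∞ u) (z : ℝ × E) :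
    fderiv ℝ (fun z => u (forward γ z)) z (1, 0) =
      fderiv ℝ u (forward γ z) (1, -a (forward γ z)) := by
  have hs : ContDiff ℝ ∞ fun z => u (forward γ z) := su.comp (contDiff_fst.prodMk
    (hγ.smooth.comp (by fun_prop : ContDiff ℝ ∞ fun z : ℝ × E => (z.2, (0 : ℝ), z.1))))
  have h1 := (hs.differentiable (by simp) z).hasFDerivAt.comp_hasDerivAt z.1
    ((hasDerivAt_id z.1).prodMk (hasDerivAt_const z.1 z.2))
  have h2 : HasFDerivAt u (fderiv ℝ u (forward γ z)) (z.1, γ (z.2, 0, z.1)) :=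
    (su.differentiable (by simp) (forward γ z)).hasFDerivAt
  have h3 : HasDerivAt (fun s => u (s, γ (z.2, 0, s)))
      (fderiv ℝ u (forward γ z) (1, -a (forward γ z))) z.1 :=
    h2.comp_hasDerivAt z.1 ((hasDerivAt_id z.1).prodMk (hγ.deriv z.2 0 z.1))
  exact h1.unique h3

/-- The operator `∂_t - a·∂ₓ` is `∂_t` in characteristic coordinates. This is the formula for
`forward`, applied to `U ∘ backward`, since the two maps are mutually inverse. -/
lemma IsFlow.fderiv_comp_backward {a : ℝ × E → E} {γ : E × ℝ × ℝ → E} (hγ : IsFlow a γ)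
    (sa : ContDiff ℝ ∞ a) {U : ℝ × E → ℂ} (sU : ContDiff ℝ ∞ U) (z : ℝ × E) :
    fderiv ℝ (fun z => U (backward γ z)) z (1, -a z) = fderiv ℝ U (backward γ z) (1, 0) := by
  have h := hγ.fderiv_comp_forward (sU.comp (contDiff_backward hγ.smooth)) (backward γ z)
  simp only [Function.comp_def, hγ.forward_backward sa, hγ.backward_forward sa] at h
  exact h.symm

section Nets

variable {a : Eps → ℝ × E → E} {γ : Eps → E × ℝ × ℝ → E}

/-- Uniqueness for transport equations. -/
lemma negOn_of_transport (hγ : ∀ ε, IsFlow (a ε) (γ ε)) (sa : ∀ ε, ContDiff ℝ ∞ (a ε))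
    (cγ : CBounded γ) (mγ : ModOn γ univ) {u α : Eps → ℝ × E → ℂ} (su : ∀ ε, ContDiff ℝ ∞ (u ε))
    (sα : ∀ ε, ContDiff ℝ ∞ (α ε)) (mα : ModOn α univ) (hlog : LogOrd modScale α)
    (hu : NegOn (fun ε z => fderiv ℝ (u ε) z (1, -a ε z) - α ε z * u ε z) univ)
    (hu0 : NegOn (fun ε x => u ε (0, x)) univ) : NegOn u univ := by
  have hS := isScale_modScale
  have hN := isScaleModule_negScale
  have sγ := fun ε => (hγ ε).smooth
  have sF := fun ε => contDiff_forward (sγ ε)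
  have sB := fun ε => contDiff_backward (sγ ε)
  rw [negOn_iff_scaleOrd] at *
  rw [modOn_iff_scaleOrd] at *
  have sr : ∀ ε, ContDiff ℝ ∞ fun z => fderiv ℝ (u ε) z (1, -a ε z) - α ε z * u ε z := fun ε =>
    ((contDiff_fderiv (su ε)).clm_apply (contDiff_const.prodMk (sa ε).neg)).sub
      ((sα ε).mul (su ε))
  intro k
  have hF := ScaleOrd.forward hS sγ (mγ k)
  have hB := ScaleOrd.backward hS sγ (mγ k)
  -- Along the characteristics `u` solves a scalar linear equation with negligible source and
  -- initial values; composition with `backward` then returns to `u`.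
  have hv : ScaleOrd negScale k fun ε z => u ε (forward (γ ε) z) := by
    refine ScaleOrd.of_scalar_ode hS hN (β := fun ε z => α ε (forward (γ ε) z))
      (g := fun ε z => fderiv ℝ (u ε) (forward (γ ε) z) (1, -a ε (forward (γ ε) z)) -
        α ε (forward (γ ε) z) * u ε (forward (γ ε) z)) (fun ε => (su ε).comp (sF ε))
      (fun ε => (sr ε).comp (sF ε)) (fun ε => (sα ε).comp (sF ε)) (fun ε z => ?_)
      ((mα k).comp hS hS.isScaleModule sα sF hF cγ.forward :) (hlog.comp cγ.forward :)
      ((hu k).comp hS hN sr sF hF cγ.forward :) ?_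
    · rw [(hγ ε).fderiv_comp_forward (su ε)]
      ring
    · simpa [forward, (hγ _).init] using hu0 k
  have h := (hv.comp hS hN (fun ε => (su ε).comp (sF ε)) sB hB cγ.backward :)
  simpa [(hγ _).forward_backward (sa _)] using h

end Nets

/-! #### Uniqueness of the characteristic flow -/

/-- The fundamental theorem of calculus on the segment. It makes the difference of two solutions of
the nonlinear characteristic equation solve a linear one. -/
lemma sub_eq_integral_fderivSnd {a : ℝ × E → E} (sa : ContDiff ℝ ∞ a) (s : ℝ)
    (x y : E) :
    a (s, y) - a (s, x) = (∫ θ in (0 : ℝ)..1, fderivSnd a (s, x + θ • (y - x))) (y - x) := by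
  have : CompleteSpace E := FiniteDimensional.complete ℝ E
  have hc : Continuous fun θ : ℝ => fderivSnd a (s, x + θ • (y - x)) :=
    (contDiff_fderivSnd sa).continuous.comp (by fun_prop)
  rw [ContinuousLinearMap.intervalIntegral_apply (hc.intervalIntegrable _ _)]
  have hd : ∀ θ : ℝ, HasDerivAt (fun θ : ℝ => a (s, x + θ • (y - x)))
      (fderivSnd a (s, x + θ • (y - x)) (y - x)) θ := fun θ => by
    have h := (sa.differentiable (by simp) (s, x + θ • (y - x))).hasFDerivAt.comp_hasDerivAt θ
      ((hasDerivAt_const θ s).prodMk (((hasDerivAt_id θ).smul_const (y - x)).const_add x))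
    simpa [Function.comp_def, fderivSnd] using h
  rw [intervalIntegral.integral_eq_sub_of_hasDerivAt (fun θ _ => hd θ)
    ((hc.clm_apply continuous_const).intervalIntegrable _ _)]
  simp

/-- The average of the space derivative of `a` over a segment. -/
noncomputable def averageDeriv (a : ℝ × E → E) (w : ℝ × E × E) : E →L[ℝ] E :=
  ∫ θ in (0 : ℝ)..1, fderivSnd a (w.1, w.2.1 + θ • (w.2.2 - w.2.1))

/-- `((s, x, y), θ) ↦ (s, x + θ (y - x))`. -/
def segmentPoint (w : (ℝ × E × E) × ℝ) : ℝ × E := (w.1.1, w.1.2.1 + w.2 • (w.1.2.2 - w.1.2.1))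

lemma contDiff_segmentPoint : ContDiff ℝ ∞ (segmentPoint (E := E)) := by
  unfold segmentPoint
  fun_prop

lemma contDiff_fderivSnd_segmentPoint {a : ℝ × E → E} (sa : ContDiff ℝ ∞ a) :
    ContDiff ℝ ∞ fun w => fderivSnd a (segmentPoint w) :=
  (contDiff_fderivSnd sa).comp contDiff_segmentPoint

lemma contDiff_averageDeriv {a : ℝ × E → E} (sa : ContDiff ℝ ∞ a) :
    ContDiff ℝ ∞ (averageDeriv a) := by
  have : ProperSpace E := FiniteDimensional.proper ℝ E
  exact contDiff_unitIntegral (contDiff_fderivSnd_segmentPoint sa)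

lemma ModOn.averageDeriv {a : Eps → ℝ × E → E} (sa : ∀ ε, ContDiff ℝ ∞ (a ε))
    (ma : ModOn a univ) : ModOn (fun ε => averageDeriv (a ε)) univ := by
  have : ProperSpace E := FiniteDimensional.proper ℝ E
  have m : ModOn (fun ε => fderivSnd (a ε)) univ := modOn_iff_scaleOrd.2 fun k =>
    (modOn_iff_scaleOrd.1 ma (k + 1)).spaceDeriv isScale_modScale isScale_modScale.isScaleModule sa
  have h := (ModOn.comp (fun ε => contDiff_fderivSnd (sa ε)) (fun _ => contDiff_segmentPoint) m
    (modOn_const contDiff_segmentPoint univ) (cBounded_const contDiff_segmentPoint.continuous) :)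
  exact (ModOn.unitIntegral (fun ε => contDiff_fderivSnd_segmentPoint (sa ε)) h :)

/-- The segments between points of a compact set sweep out a compact set, and an average is bounded
by the supremum. -/
lemma LogOrd.averageDeriv {a : Eps → ℝ × E → E} (h : LogOrd S fun ε => fderivSnd (a ε)) :
    LogOrd S fun ε => averageDeriv (a ε) := by
  have hc := (h.comp (cBounded_const (contDiff_segmentPoint (E := E)).continuous) :)
  intro K hK
  obtain ⟨m, hm, hb⟩ := hc (K ×ˢ Icc 0 1) (hK.prod isCompact_Icc)
  refine ⟨m, hm, hb.mono fun ε h z hz => ?_⟩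
  have := intervalIntegral.norm_integral_le_of_norm_le_const (a := 0) (b := 1)
    (f := fun θ => fderivSnd (a ε) (segmentPoint (z, θ))) (C := m ε) (fun θ hθ => by
      rw [uIoc_of_le zero_le_one] at hθ
      exact h (z, θ) ⟨hz, hθ.1.le, hθ.2⟩)
  rwa [sub_zero, abs_one, mul_one] at this

/-- Negligible perturbations of the characteristic equation, in shifted time. -/
lemma negOn_sub_of_shifted_flow {a : Eps → ℝ × E → E} (sa : ∀ ε, ContDiff ℝ ∞ (a ε))
    (ma : ModOn a univ) (hlog : LogOrd modScale fun ε => fderivSnd (a ε))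
    {G Γ r : Eps → (E × ℝ) × ℝ → E}
    (sG : ∀ ε, ContDiff ℝ ∞ (G ε)) (sΓ : ∀ ε, ContDiff ℝ ∞ (Γ ε)) (sr : ∀ ε, ContDiff ℝ ∞ (r ε))
    (mG : ModOn G univ) (mΓ : ModOn Γ univ) (cG : CBounded G) (cΓ : CBounded Γ) (hr : NegOn r univ)
    (hode : ∀ ε z, fderiv ℝ (G ε) z (0, 1) + a ε (z.1.2 + z.2, G ε z) -
      (fderiv ℝ (Γ ε) z (0, 1) + a ε (z.1.2 + z.2, Γ ε z)) = r ε z)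
    (h0 : NegOn (fun ε p => G ε (p, 0) - Γ ε (p, 0)) univ) :
    NegOn (fun ε z => G ε z - Γ ε z) univ := by
  have hS := isScale_modScale
  have sj : ∀ ε, ContDiff ℝ ∞ fun z : (E × ℝ) × ℝ => (z.1.2 + z.2, Γ ε z, G ε z) :=
    fun ε => contDiff_time.prodMk ((sΓ ε).prodMk (sG ε))
  have mj : ModOn (fun ε (z : (E × ℝ) × ℝ) => (z.1.2 + z.2, Γ ε z, G ε z)) univ :=
    ModOn.prodMk (fun _ => contDiff_time) (fun ε => (sΓ ε).prodMk (sG ε))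
      (modOn_const contDiff_time univ) (ModOn.prodMk sΓ sG mΓ mG)
  have cj : CBounded (fun ε (z : (E × ℝ) × ℝ) => (z.1.2 + z.2, Γ ε z, G ε z)) :=
    (cBounded_const contDiff_time.continuous).prodMk (cΓ.prodMk cG)
  have sA : ∀ ε, ContDiff ℝ ∞ (averageDeriv (a ε)) := fun ε => contDiff_averageDeriv (sa ε)
  have mA := ModOn.averageDeriv sa ma
  have sM : ∀ ε, ContDiff ℝ ∞ fun z : (E × ℝ) × ℝ =>
      averageDeriv (a ε) (z.1.2 + z.2, Γ ε z, G ε z) := fun ε => (sA ε).comp (sj ε)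
  have mM := (ModOn.comp sA sj mA mj cj :)
  have lM := (hlog.averageDeriv.comp cj :)
  rw [negOn_iff_scaleOrd] at h0 hr ⊢
  rw [modOn_iff_scaleOrd] at mM
  intro k
  -- The coefficient is minus the averaged derivative between `Γ` and `G`, and the source is the
  -- difference `r` of the two residuals.
  refine ScaleOrd.of_linear_ode hS isScaleModule_negScale k (fun ε => (sG ε).sub (sΓ ε)) sr
    (fun ε => (sM ε).neg) (fun ε z => ?_) (mM k).neg (lM.mono fun ε z => by simp) (hr k) (h0 k)
  have hmv := sub_eq_integral_fderivSnd (sa ε) (z.1.2 + z.2) (Γ ε z) (G ε z)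
  have h1 : fderiv ℝ (fun z => G ε z - Γ ε z) z (0, 1) =
      fderiv ℝ (G ε) z (0, 1) - fderiv ℝ (Γ ε) z (0, 1) := by
    rw [fderiv_fun_sub ((sG ε).differentiable (by simp) z) ((sΓ ε).differentiable (by simp) z)]
    rfl
  rw [h1, _root_.neg_apply, ← hode]
  change _ = -(averageDeriv (a ε) (z.1.2 + z.2, Γ ε z, G ε z) (G ε z - Γ ε z)) + _
  rw [show averageDeriv (a ε) (z.1.2 + z.2, Γ ε z, G ε z) (G ε z - Γ ε z) =
    a ε (z.1.2 + z.2, G ε z) - a ε (z.1.2 + z.2, Γ ε z) from hmv.symm]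
  abel

lemma contDiff_flowResidual {a : ℝ × E → E} (sa : ContDiff ℝ ∞ a) {G : E × ℝ × ℝ → E}
    (sG : ContDiff ℝ ∞ G) :
    ContDiff ℝ ∞ fun z => fderiv ℝ G z (0, 0, 1) + a (z.2.2, G z) :=
  (contDiff_fderiv_apply sG _).add (sa.comp
    ((by fun_prop : ContDiff ℝ ∞ fun z : E × ℝ × ℝ => z.2.2).prodMk sG))

/-- Two nets that solve the characteristic equation up to negligible errors differ by a negligible
net. -/
lemma negOn_sub_of_flow {a : Eps → ℝ × E → E} (sa : ∀ ε, ContDiff ℝ ∞ (a ε)) (ma : ModOn a univ)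
    (hlog : LogOrd modScale fun ε => fderivSnd (a ε)) {G Γ : Eps → E × ℝ × ℝ → E}
    (sG : ∀ ε, ContDiff ℝ ∞ (G ε)) (sΓ : ∀ ε, ContDiff ℝ ∞ (Γ ε)) (mG : ModOn G univ)
    (mΓ : ModOn Γ univ) (cG : CBounded G) (cΓ : CBounded Γ)
    (hG : NegOn (fun ε z => fderiv ℝ (G ε) z (0, 0, 1) + a ε (z.2.2, G ε z)) univ)
    (hΓ : NegOn (fun ε z => fderiv ℝ (Γ ε) z (0, 0, 1) + a ε (z.2.2, Γ ε z)) univ)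
    (h0 : NegOn (fun ε (p : E × ℝ) => G ε (p.1, p.2, p.2) - Γ ε (p.1, p.2, p.2)) univ) :
    NegOn (fun ε z => G ε z - Γ ε z) univ := by
  have sL : ContDiff ℝ ∞ (shiftTime E) := (shiftTime E).contDiff
  have mL : ModOn (fun _ : Eps => shiftTime E) univ := modOn_const sL univ
  have cL : CBounded (fun _ : Eps => shiftTime E) := cBounded_const sL.continuous
  have r1 := fun ε => contDiff_flowResidual (sa ε) (sG ε)
  have r2 := fun ε => contDiff_flowResidual (sa ε) (sΓ ε)
  have srr := fun ε => (r1 ε).add (r2 ε).neg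
  have hrr := NegOn.add isOpen_univ (fun ε => (r1 ε).contDiffOn)
    (fun ε => (r2 ε).neg.contDiffOn) hG hΓ.neg
  have hrL := (NegOn.comp srr (fun _ => sL) hrr mL cL :)
  have mGL := (ModOn.comp sG (fun _ => sL) mG mL cL :)
  have mΓL := (ModOn.comp sΓ (fun _ => sL) mΓ mL cL :)
  -- Again the time shift `σ = s - t` moves the initial condition to `σ = 0`; it is undone
  -- afterwards.
  have hv := negOn_sub_of_shifted_flow sa ma hlog (fun ε => (sG ε).comp sL)
    (fun ε => (sΓ ε).comp sL) (fun ε => (srr ε).comp sL) mGL mΓL (cG.comp cL :) (cΓ.comp cL :) hrL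
    (fun ε z => by
      have e1 := fderiv_comp_shiftTime (sG ε) z (0, 1)
      have e2 := fderiv_comp_shiftTime (sΓ ε) z (0, 1)
      simp only [Function.comp_def] at *
      rw [e1, e2]
      simp [sub_eq_add_neg])
    (by simpa using h0)
  have s' : ContDiff ℝ ∞ fun z : E × ℝ × ℝ => ((z.1, z.2.1), z.2.2 - z.2.1) := by fun_prop
  have := (NegOn.comp (fun ε => ((sG ε).comp sL).sub ((sΓ ε).comp sL)) (fun _ => s') hv
    (modOn_const s' univ) (cBounded_const s'.continuous) :)
  simpa using this

end Transport

/-! ### Fourier inversion for linear phases -/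

section FourierInversion

open scoped FourierTransform

variable {n : ℕ}

/-- `𝓕` has `2π` in its exponent; the rescaled frequency absorbs it. -/
lemma fourierHat_eq (g : X n → ℂ) (η : X n) : fourierHat g η = 𝓕 g ((2 * Real.pi)⁻¹ • η) := by
  rw [Real.fourier_eq', fourierHat]
  refine integral_congr_ae (Eventually.of_forall fun y => ?_)
  have h : (-2 * Real.pi * inner ℝ y ((2 * Real.pi)⁻¹ • η) : ℝ) = -inner ℝ y η := by
    rw [inner_smul_right]
    field_simp
  simp only [h, smul_eq_mul, Complex.ofReal_neg]
  rw [mul_comm Complex.I, neg_mul]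

/-- Fourier inversion for smooth functions with compact support. -/
lemma integral_fourierHat {g : X n → ℂ} (sg : ContDiff ℝ ∞ g) (cg : HasCompactSupport g) (c : X n) :
    ∫ η : X n, Complex.exp (Complex.I * (inner ℝ c η : ℝ)) * fourierHat g η =
      (((2 * Real.pi) ^ n : ℝ) : ℂ) * g c := by
  have hπ : (0 : ℝ) < 2 * Real.pi := by positivity
  have hint : Integrable (𝓕 g) := (𝓕 (cg.toSchwartzMap sg)).integrable
  have hinv : 𝓕⁻ (𝓕 g) c = g c := by
    rw [sg.continuous.fourierInv_fourier_eq (cg.toSchwartzMap sg).integrable hint]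
  -- The substitution `η = 2π w` produces the factor `(2π)ⁿ`.
  have h := Measure.integral_comp_inv_smul_of_nonneg (volume : Measure (X n))
    (fun w => Complex.exp (((2 * Real.pi * inner ℝ w c : ℝ) : ℂ) * Complex.I) • 𝓕 g w) hπ.le
  rw [← Real.fourierInv_eq', hinv, finrank_euclideanSpace, Fintype.card_fin,
    Complex.real_smul] at h
  rw [← h]
  refine integral_congr_ae (Eventually.of_forall fun η => ?_)
  have e : (2 * Real.pi * inner ℝ ((2 * Real.pi)⁻¹ • η) c : ℝ) = inner ℝ c η := by
    rw [real_inner_smul_left, real_inner_comm]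
    field_simp
  simp only [e, smul_eq_mul, fourierHat_eq]
  rw [mul_comm Complex.I]

/-- An oscillatory integral with the linear phase `∑ₕ cₕ(t, x) ηₕ` is a substitution. -/
lemma oscInt_linear (c : ℝ × X n → X n) (b : ℝ × X n → ℂ) {v : ℝ × X n → ℂ}
    (sv : ContDiff ℝ ∞ v) {K : Set (X n)} (hK : IsCompact K) (hv : ∀ t, ∀ x ∉ K, v (t, x) = 0)
    (z : ℝ × X n) :
    oscInt (fun p => ∑ h, c p.1 h * p.2 h) b v z = b z * v (z.1, c z) := by
  have sg : ContDiff ℝ ∞ fun y => v (z.1, y) := sv.comp (by fun_prop)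
  have cg : HasCompactSupport fun y => v (z.1, y) := HasCompactSupport.intro hK (hv z.1)
  have h := integral_fourierHat sg cg (c z)
  have e : ∀ η : X n, Complex.exp (Complex.I * ((∑ h, c z h * η h : ℝ) : ℂ)) * b z *
      fourierHat (fun y => v (z.1, y)) η = b z * (Complex.exp (Complex.I * (inner ℝ (c z) η : ℝ)) *
      fourierHat (fun y => v (z.1, y)) η) := fun η => by
    rw [show (∑ h, c z h * η h : ℝ) = inner ℝ (c z) η by simp [PiLp.inner_apply, mul_comm]]
    ring
  have hπ : (((2 * Real.pi) ^ n : ℝ) : ℂ) ≠ 0 := by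
    exact_mod_cast (by positivity : (2 * Real.pi) ^ n ≠ 0)
  simp only [oscInt, e]
  rw [integral_const_mul, h]
  field_simp

end FourierInversion

/-! ### Representatives -/

section Reps

variable {E : Type} [NormedAddCommGroup E] [NormedSpace ℝ E]
  {E' : Type} [NormedAddCommGroup E'] [NormedSpace ℝ E']
  {F : Type} [NormedAddCommGroup F] [NormedSpace ℝ F]
  {F' : Type} [NormedAddCommGroup F'] [NormedSpace ℝ F']

lemma NegOn.sub {u v : Eps → E → F} (su : ∀ ε, ContDiff ℝ ∞ (u ε)) (sv : ∀ ε, ContDiff ℝ ∞ (v ε))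
    (hu : NegOn u univ) (hv : NegOn v univ) : NegOn (fun ε x => u ε x - v ε x) univ := by
  simpa [sub_eq_add_neg] using NegOn.add isOpen_univ (fun ε => (su ε).contDiffOn)
    (fun ε => (sv ε).neg.contDiffOn) hu hv.neg

lemma NegOn.clm (L : F →L[ℝ] F') {u : Eps → E → F} (su : ∀ ε, ContDiff ℝ ∞ (u ε))
    (hu : NegOn u univ) : NegOn (fun ε x => L (u ε x)) univ :=
  negOn_iff_scaleOrd.2 fun k =>
    (negOn_iff_scaleOrd.1 hu k).clm isScale_modScale isScaleModule_negScale L su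

lemma IsRep.smooth {u : Eps → E → ℂ} {w : Gen E} (h : IsRep u w) (ε : Eps) : ContDiff ℝ ∞ (u ε) :=
  h.1.1 ε

lemma IsRep.modOn {u : Eps → E → ℂ} {w : Gen E} (h : IsRep u w) : ModOn u univ := h.1.2

lemma exists_isRep (w : Gen E) : ∃ u, IsRep u w := by
  obtain ⟨u, rfl⟩ := Gen.mk_surjective w
  exact ⟨u, u.2, rfl⟩

lemma IsRep.eq_iff {u v : Eps → E → ℂ} {w w' : Gen E} (hu : IsRep u w) (hv : IsRep v w') :
    w = w' ↔ NegOn (fun ε x => u ε x - v ε x) univ := by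
  obtain ⟨h, rfl⟩ := hu
  obtain ⟨h', rfl⟩ := hv
  exact Gen.mk_eq_iff

lemma IsRep.of_negOn {u v : Eps → E → ℂ} {w : Gen E} (hu : IsRep u w)
    (sv : ∀ ε, ContDiff ℝ ∞ (v ε)) (h : NegOn (fun ε x => v ε x - u ε x) univ) : IsRep v w := by
  have hv : v ∈ moderateNets E := by
    refine mem_moderateNets.2 ⟨sv, ?_⟩
    simpa using ModOn.add isOpen_univ (fun ε => ((sv ε).sub (hu.smooth ε)).contDiffOn)
      (fun ε => (hu.smooth ε).contDiffOn) h.modOn hu.modOn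
  have hv' : IsRep v (Gen.mk ⟨v, hv⟩) := ⟨hv, rfl⟩
  rw [← (hv'.eq_iff hu).2 h]
  exact hv'

lemma isRep_mk {u : Eps → E → ℂ} (su : ∀ ε, ContDiff ℝ ∞ (u ε)) (mu : ModOn u univ) :
    IsRep u (Gen.mk ⟨u, mem_moderateNets.2 ⟨su, mu⟩⟩) := ⟨_, rfl⟩

lemma isRep_zero : IsRep (fun _ _ => 0) (0 : Gen E) := ⟨(moderateNets E).zero_mem, rfl⟩

lemma isRep_one : IsRep (fun _ _ => 1) (1 : Gen E) := ⟨(moderateNets E).one_mem, rfl⟩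

lemma IsRep.add {u v : Eps → E → ℂ} {w w' : Gen E} (hu : IsRep u w) (hv : IsRep v w') :
    IsRep (fun ε x => u ε x + v ε x) (w + w') := by
  obtain ⟨h, rfl⟩ := hu
  obtain ⟨h', rfl⟩ := hv
  exact ⟨(moderateNets E).add_mem h h', rfl⟩

lemma IsRep.mul {u v : Eps → E → ℂ} {w w' : Gen E} (hu : IsRep u w) (hv : IsRep v w') :
    IsRep (fun ε x => u ε x * v ε x) (w * w') := by
  obtain ⟨h, rfl⟩ := hu
  obtain ⟨h', rfl⟩ := hv
  exact ⟨(moderateNets E).mul_mem h h', rfl⟩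

lemma IsRep.neg {u : Eps → E → ℂ} {w : Gen E} (hu : IsRep u w) :
    IsRep (fun ε x => -u ε x) (-w) := by
  obtain ⟨h, rfl⟩ := hu
  exact ⟨(moderateNets E).neg_mem h, rfl⟩

lemma IsRep.smul {u : Eps → E → ℂ} {w : Gen E} (hu : IsRep u w) (c : ℂ) :
    IsRep (fun ε x => c * u ε x) (c • w) := by
  obtain ⟨h, rfl⟩ := hu
  exact ⟨(moderateNets E).smul_mem h c, rfl⟩

lemma IsRep.sum {ι : Type} (s : Finset ι) {u : ι → Eps → E → ℂ} {w : ι → Gen E}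
    (h : ∀ i, IsRep (u i) (w i)) : IsRep (fun ε x => ∑ i ∈ s, u i ε x) (∑ i ∈ s, w i) := by
  classical
  induction s using Finset.induction_on with
  | empty => simpa using isRep_zero
  | insert a s ha ih =>
    simp only [Finset.sum_insert ha]
    exact (h a).add ih

lemma IsRep.pderiv {u : Eps → E → ℂ} {w : Gen E} (hu : IsRep u w) (v : E) :
    IsRep (fun ε x => fderiv ℝ (u ε) x v) (w.pderiv v) := by
  obtain ⟨h, rfl⟩ := hu
  exact ⟨_, rfl⟩

lemma IsRep.comp [ProperSpace E'] {u : Eps → E' → ℂ} {w : Gen E'} (hu : IsRep u w)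
    (f : MapNet E E') :
    IsRep (fun ε x => u ε (f.net ε x)) (w.comp (Quotient.mk _ f : GMap E E')) := by
  obtain ⟨h, rfl⟩ := hu
  exact ⟨_, rfl⟩

lemma IsRep.comp_ofSmooth [ProperSpace E'] {u : Eps → E' → ℂ} {w : Gen E'} (hu : IsRep u w)
    {f : E → E'} (hf : ContDiff ℝ ∞ f) :
    IsRep (fun ε x => u ε (f x)) (w.comp (GMap.ofSmooth f hf)) := hu.comp (MapNet.const f hf)

lemma isRep_ofSmooth {f : E → ℂ} (hf : ContDiff ℝ ∞ f) : IsRep (fun _ => f) (Gen.ofSmooth f hf) :=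
  ⟨_, rfl⟩

lemma IsRep.primitive [FiniteDimensional ℝ E] [ProperSpace E] {u : Eps → ℝ × E → ℂ}
    {w : Gen (ℝ × E)}
    (hu : IsRep u w) : IsRep (fun ε => prim (u ε)) (Gen.primitive w) := by
  obtain ⟨h, rfl⟩ := hu
  exact ⟨_, rfl⟩

lemma IsRep.mul_eq_one {u v : Eps → E → ℂ} {w w' : Gen E} (hu : IsRep u w) (hv : IsRep v w')
    (h : ∀ ε x, u ε x * v ε x = 1) : w * w' = 1 := by
  refine ((hu.mul hv).eq_iff isRep_one).2 ?_
  simpa [h] using negOn_zero (E := E) (F := ℂ) univ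

/-! #### Cutting off representatives -/

lemma norm_iteratedFDeriv_eq_zero {f : E → F} {x : E} (h : f =ᶠ[𝓝 x] fun _ => 0) (k : ℕ) :
    ‖iteratedFDeriv ℝ k f x‖ = 0 := by
  rw [(h.iteratedFDeriv ℝ k).eq_of_nhds]
  simp [show (fun _ : E => (0 : F)) = 0 from rfl]

/-- Finitely many pieces suffice by compactness, so negligibility may be proved for different
reasons near different points. -/
lemma negBound_of_local {p : Eps → E → ℝ} {K : Set E} (hK : IsCompact K)
    (h : ∀ z ∈ K, ∃ U ∈ 𝓝 z, NegBound p U) : NegBound p K := by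
  refine hK.induction_on (p := fun K => NegBound p K) (fun q => ⟨0, by simp⟩)
    (fun s t hst ht q => ?_) (fun s t hs ht q => ?_) fun z hz => ?_
  · obtain ⟨C, hC⟩ := ht q
    exact ⟨C, hC.mono fun ε he x hx => he x (hst hx)⟩
  · obtain ⟨C, hC⟩ := hs q
    obtain ⟨D, hD⟩ := ht q
    refine ⟨max C D, ?_⟩
    filter_upwards [hC, hD] with ε h1 h2 x hx
    have he : (0 : ℝ) ≤ (ε : ℝ) ^ q := pow_nonneg ε.2.1.le q
    rcases hx with hx | hx
    · exact (h1 x hx).trans (mul_le_mul_of_nonneg_right (le_max_left _ _) he)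
    · exact (h2 x hx).trans (mul_le_mul_of_nonneg_right (le_max_right _ _) he)
  · obtain ⟨U, hU, hb⟩ := h z hz
    exact ⟨U, mem_nhdsWithin_of_mem_nhds hU, hb⟩

/-- Vanishing near `z` is witnessed by some representative; any other differs from it by a
negligible net. -/
lemma IsRep.negOn_of_notMem_supp {u : Eps → E → ℂ} {w : Gen E} (hu : IsRep u w) {z : E}
    (hz : z ∉ w.supp) : ∃ V, IsOpen V ∧ z ∈ V ∧ NegOn u V := by
  obtain ⟨V, hV, hzV, v, hv, hneg⟩ := not_not.1 hz
  refine ⟨V, hV, hzV, ?_⟩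
  simpa using NegOn.add hV (fun ε => ((hu.smooth ε).sub (hv.smooth ε)).contDiffOn)
    (fun ε => (hv.smooth ε).contDiffOn) (((hu.eq_iff hv).1 rfl).mono (subset_univ V)) hneg

/-- Multiplication by a smooth function that equals one near the support does not change the
class. -/
lemma IsRep.cutoff [ProperSpace E] {u : Eps → E → ℂ} {w : Gen E} (hu : IsRep u w) {χ : E → ℝ}
    (sχ : ContDiff ℝ ∞ χ) (hχ : ∀ z ∈ w.supp, χ =ᶠ[𝓝 z] fun _ => 1) :
    IsRep (fun ε x => (χ x : ℂ) * u ε x) w := by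
  have sc : ContDiff ℝ ∞ fun x => (χ x : ℂ) := Complex.ofRealCLM.contDiff.comp sχ
  have sc1 : ContDiff ℝ ∞ fun x => (χ x : ℂ) - 1 := sc.sub contDiff_const
  refine hu.of_negOn (fun ε => sc.mul (hu.smooth ε)) ?_
  have e : (fun ε x => (χ x : ℂ) * u ε x - u ε x) = fun ε x =>
      ContinuousLinearMap.mul ℝ ℂ (u ε x) ((χ x : ℂ) - 1) := by
    funext ε x
    simp only [ContinuousLinearMap.mul_apply']
    ring
  rw [e]
  intro K _ hK k
  refine negBound_of_local hK fun z _ => ?_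
  -- Near a point of the support `χ - 1` vanishes identically; near any other point `u` is
  -- negligible and `χ - 1` is a fixed smooth function.
  by_cases hz : z ∈ w.supp
  · obtain ⟨U, hU, hUo, hzU⟩ := eventually_nhds_iff.1 (hχ z hz)
    refine ⟨U, hUo.mem_nhds hzU, fun q => ⟨0, Eventually.of_forall fun ε x hx => ?_⟩⟩
    have h0 : (fun x => ContinuousLinearMap.mul ℝ ℂ (u ε x) ((χ x : ℂ) - 1)) =ᶠ[𝓝 x]
        fun _ => (0 : ℂ) := by
      filter_upwards [hUo.mem_nhds hx] with y hy
      simp [hU y hy]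
    exact (norm_iteratedFDeriv_eq_zero h0 k).le.trans (zero_mul _).ge
  · obtain ⟨V, hV, hzV, hneg⟩ := hu.negOn_of_notMem_supp hz
    obtain ⟨L, hL, hzL, hLV⟩ := exists_compact_subset hV hzV
    refine ⟨L, mem_interior_iff_mem_nhds.1 hzL, ?_⟩
    exact negBound_bilin _ hu.smooth (fun _ => sc1) (fun j _ => hneg L hLV hL j)
      (fun j _ => modOn_const sc1 univ L (subset_univ _) hL j)

lemma exists_cutoff [FiniteDimensional ℝ E] [HasContDiffBump E] {K : Set E} (hK : IsCompact K) :
    ∃ χ : E → ℝ, ContDiff ℝ ∞ χ ∧ (∀ z ∈ K, χ =ᶠ[𝓝 z] fun _ => 1) ∧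
      ∃ L : Set E, IsCompact L ∧ ∀ x ∉ L, χ x = 0 := by
  have : ProperSpace E := FiniteDimensional.proper ℝ E
  obtain ⟨R, hR⟩ := hK.isBounded.subset_ball_lt 0 (0 : E)
  let ψ : ContDiffBump (0 : E) := ⟨R, R + 1, hR.1, by linarith⟩
  refine ⟨ψ, ψ.contDiff, fun z hz => ?_, Metric.closedBall 0 (R + 1), isCompact_closedBall _ _,
    fun x hx => ?_⟩
  · exact ψ.eventuallyEq_one_of_mem_ball (hR.2 hz)
  · refine ψ.zero_of_le_dist ?_
    rw [Metric.mem_closedBall, not_le] at hx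
    exact hx.le

lemma exists_cutoff_of_isCompact_supp [FiniteDimensional ℝ E] [HasContDiffBump E] {w : Gen E}
    (hw : IsCompact w.supp) : ∃ χ : E → ℝ, ContDiff ℝ ∞ χ ∧
      (∀ u, IsRep u w → IsRep (fun ε x => (χ x : ℂ) * u ε x) w) ∧
      ∃ L : Set E, IsCompact L ∧ ∀ x ∉ L, χ x = 0 := by
  have : ProperSpace E := FiniteDimensional.proper ℝ E
  obtain ⟨χ, sχ, h1, h2⟩ := exists_cutoff hw
  exact ⟨χ, sχ, fun u hu => hu.cutoff sχ h1, h2⟩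

/-- The cutoff depends on `x` only, since the support need not be bounded in time. -/
lemma CompactlySupportedInX.exists_cutoff {n : ℕ} {w : Gen (ℝ × X n)}
    (hw : CompactlySupportedInX w) : ∃ χ : X n → ℝ, ContDiff ℝ ∞ χ ∧
      (∀ u, IsRep u w → IsRep (fun ε z => (χ z.2 : ℂ) * u ε z) w) ∧
      ∃ L : Set (X n), IsCompact L ∧ ∀ x ∉ L, χ x = 0 := by
  obtain ⟨K, hK, hs⟩ := hw
  obtain ⟨χ, sχ, h1, h2⟩ := Colombeau.exists_cutoff hK
  exact ⟨χ, sχ, fun u hu => hu.cutoff (χ := fun z => χ z.2) (sχ.comp contDiff_snd) fun z hz =>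
    (h1 z.2 (hs hz).2).comp_tendsto continuousAt_snd, h2⟩

lemma compactlySupportedInX_of_isRep {n : ℕ} {u : Eps → ℝ × X n → ℂ} {w : Gen (ℝ × X n)}
    (hu : IsRep u w) {K : Set (X n)} (hK : IsCompact K) (h : ∀ ε t, ∀ x ∉ K, u ε (t, x) = 0) :
    CompactlySupportedInX w := by
  refine ⟨K, hK, fun z hz => ⟨mem_univ _, ?_⟩⟩
  by_contra hzK
  have hV : IsOpen (univ ×ˢ Kᶜ : Set (ℝ × X n)) := isOpen_univ.prod hK.isClosed.isOpen_compl
  refine hz ⟨univ ×ˢ Kᶜ, hV, ⟨mem_univ _, hzK⟩, u, hu, fun L hL _ k q =>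
    ⟨0, Eventually.of_forall fun ε x hx => ?_⟩⟩
  have h0 : u ε =ᶠ[𝓝 x] fun _ => (0 : ℂ) := by
    filter_upwards [hV.mem_nhds (hL hx)] with y hy using h ε y.1 y.2 hy.2
  exact (norm_iteratedFDeriv_eq_zero h0 k).le.trans (zero_mul _).ge

end Reps

/-! ### Logarithmic and slow scale bounds for all representatives -/

section Bounds

variable {E : Type} [NormedAddCommGroup E] [NormedSpace ℝ E]
  {F : Type} [NormedAddCommGroup F] [NormedSpace ℝ F]
  {S : Set (Eps → ℝ)}

lemma IsScale.pow (hS : IsScale S) {r : Eps → ℝ} (hr : r ∈ S) (N : ℕ) : (fun ε => r ε ^ N) ∈ S := by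
  induction N with
  | zero => simpa using hS.one
  | succ N ih => simpa [pow_succ] using hS.mul ih hr

/-- The net is `r ^ (T C)`, which a natural power of `r ≥ 1` dominates. This is how logarithmic
bounds become bounds in the scale. -/
lemma IsScale.exp_log (hS : IsScale S) {r : Eps → ℝ} (hr : r ∈ S) (h1 : ∀ ε, 1 ≤ r ε) (C T : ℝ) :
    (fun ε => Real.exp (T * (C * Real.log (r ε)))) ∈ S := by
  obtain ⟨N, hN⟩ := exists_nat_ge (T * C)
  refine hS.solid (hS.pow hr N) (Eventually.of_forall fun ε => ?_)
  have h0 : 0 < r ε := zero_lt_one.trans_le (h1 ε)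
  rw [abs_of_pos (Real.exp_pos _), abs_of_pos (pow_pos h0 N), ← Real.rpow_natCast,
    Real.rpow_def_of_pos h0]
  refine Real.exp_le_exp.2 ?_
  have := Real.log_nonneg (h1 ε)
  nlinarith

lemma logOrd_of_log_bound (hS : IsScale S) {u : Eps → E → F}
    (h : ∀ K : Set E, IsCompact K → ∃ r ∈ S, (∀ ε, 1 ≤ r ε) ∧
      ∃ C : ℝ, ∀ᶠ ε in eps0, ∀ x ∈ K, ‖u ε x‖ ≤ C * Real.log (r ε)) : LogOrd S u := fun K hK => by
  obtain ⟨r, hr, h1, C, hC⟩ := h K hK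
  exact ⟨_, hS.exp_log hr h1 C, hC⟩

lemma NegOn.logOrd (hS : IsScale S) {u : Eps → E → F} (h : NegOn u univ) : LogOrd S u :=
  fun K hK => by
    obtain ⟨C, hC⟩ := h K (subset_univ _) hK 0 0
    exact ⟨fun _ => C, fun T => hS.const _, by simpa using hC⟩

lemma inv_mem_modScale : (fun ε : Eps => (ε : ℝ)⁻¹) ∈ modScale :=
  ⟨1, 1, Eventually.of_forall fun ε => by
    rw [abs_of_nonneg (zero_le_one.trans (one_le_inv ε))]; simp⟩

lemma slowScale_subset_modScale : slowScale ⊆ modScale := fun r hr => by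
  obtain ⟨C, hC⟩ := hr 1
  exact ⟨1, C, by simpa using hC⟩

lemma negScale_subset_slowScale : negScale ⊆ slowScale := fun r hr => by
  obtain ⟨C, hC⟩ := hr 0
  exact isScale_slowScale.solid (isScale_slowScale.const C)
    (hC.mono fun ε h => (by simpa using h : |r ε| ≤ C).trans (le_abs_self C))

lemma LogOrd.mono_scale {S' : Set (Eps → ℝ)} (hSS : S ⊆ S') {u : Eps → E → F} (h : LogOrd S u) :
    LogOrd S' u := fun K hK => by
  obtain ⟨m, hm, hb⟩ := h K hK
  exact ⟨m, fun T => hSS (hm T), hb⟩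

lemma ScaleOrd.mono_scale {S' : Set (Eps → ℝ)} (hSS : S ⊆ S') {u : Eps → E → F} {k : ℕ}
    (h : ScaleOrd S k u) : ScaleOrd S' k u := fun K hK j hj => by
  obtain ⟨r, hr, hb⟩ := h K hK j hj
  exact ⟨r, hSS hr, hb⟩

/-- A negligible difference is bounded on compact sets, so a logarithmic bound for one
representative passes to all, in particular to those obtained by cutting off. -/
lemma IsRep.logOrd_of_isRep (hS : IsScale S) {u v : Eps → E → ℂ} {w : Gen E} (hu : IsRep u w)
    (hv : IsRep v w) (h : LogOrd S v) : LogOrd S u := by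
  simpa using LogOrd.add hS (((hu.eq_iff hv).1 rfl).logOrd hS) h

lemma Gen.LogType.logOrd {w : Gen E} (hw : w.LogType) {u : Eps → E → ℂ} (hu : IsRep u w) :
    LogOrd modScale u := by
  obtain ⟨v, hv, h⟩ := hw
  exact hu.logOrd_of_isRep isScale_modScale hv
    (logOrd_of_log_bound isScale_modScale fun K hK => ⟨_, inv_mem_modScale, one_le_inv, h K hK⟩)

lemma Gen.SlowScaleLogType.logOrd {w : Gen E} (hw : w.SlowScaleLogType) {u : Eps → E → ℂ}
    (hu : IsRep u w) : LogOrd slowScale u := by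
  obtain ⟨v, hv, h⟩ := hw
  exact hu.logOrd_of_isRep isScale_slowScale hv (logOrd_of_log_bound isScale_slowScale h)

lemma Gen.SlowScaleRegular.scaleOrd {w : Gen E} (hw : w.SlowScaleRegular) {u : Eps → E → ℂ}
    (hu : IsRep u w) (k : ℕ) : ScaleOrd slowScale k u := by
  obtain ⟨v, hv, h⟩ := hw
  have h1 := (negOn_iff_scaleOrd.1 ((hu.eq_iff hv).1 rfl) k).mono_scale negScale_subset_slowScale
  simpa using ScaleOrd.add isScale_slowScale.isScaleModule
    (fun ε => (hu.smooth ε).sub (hv.smooth ε)) hv.smooth h1 (slowScaleOn_iff_scaleOrd.1 h k)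

lemma IsRep.scaleOrd {u : Eps → E → ℂ} {w : Gen E} (hu : IsRep u w) (k : ℕ) :
    ScaleOrd modScale k u := modOn_iff_scaleOrd.1 hu.modOn k

end Bounds

/-! ### The vector field -/

section Field

variable {n : ℕ} {S N : Set (Eps → ℝ)} {k : ℕ}

/-- `z ↦ Re z • e_j`. -/
noncomputable def coordL (j : Fin n) : ℂ →L[ℝ] X n :=
  Complex.reCLM.smulRight (EuclideanSpace.single j (1 : ℝ))

/-- The vector field with components `Re (a_j)`. -/
noncomputable def field (a : Fin n → ℝ × X n → ℂ) (z : ℝ × X n) : X n := ∑ j, coordL j (a j z)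

lemma field_apply (a : Fin n → ℝ × X n → ℂ) (z : ℝ × X n) (h : Fin n) :
    field a z h = (a h z).re := by
  simp [field, coordL, Finset.sum_apply, Pi.single_apply]

lemma contDiff_field {a : Fin n → ℝ × X n → ℂ} (sa : ∀ j, ContDiff ℝ ∞ (a j)) :
    ContDiff ℝ ∞ (field a) := ContDiff.sum fun j _ => (coordL j).contDiff.comp (sa j)

lemma ScaleOrd.field (hS : IsScale S) {a : Eps → Fin n → ℝ × X n → ℂ}
    (sa : ∀ ε j, ContDiff ℝ ∞ (a ε j)) (ha : ∀ j, ScaleOrd S k fun ε => a ε j) :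
    ScaleOrd S k fun ε => field (a ε) :=
  ScaleOrd.sum hS.isScaleModule _ (fun j ε => (coordL j).contDiff.comp (sa ε j))
    fun j _ => (ha j).clm hS hS.isScaleModule (coordL j) fun ε => sa ε j

lemma eq_sum_single (x : X n) : x = ∑ j, x j • EuclideanSpace.single j (1 : ℝ) := by
  ext i
  simp [Finset.sum_apply, Pi.single_apply]

lemma norm_le_sum_single {F : Type} [NormedAddCommGroup F] [NormedSpace ℝ F] (T : X n →L[ℝ] F) :
    ‖T‖ ≤ ∑ j, ‖T (EuclideanSpace.single j 1)‖ := by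
  refine T.opNorm_le_bound (by positivity) fun x => ?_
  calc ‖T x‖ = ‖∑ j, x j • T (EuclideanSpace.single j 1)‖ := by
        conv_lhs => rw [eq_sum_single x]
        simp
    _ ≤ ∑ j, ‖x j • T (EuclideanSpace.single j 1)‖ := norm_sum_le _ _
    _ ≤ ∑ j, ‖T (EuclideanSpace.single j 1)‖ * ‖x‖ := by
        refine Finset.sum_le_sum fun j _ => ?_
        rw [norm_smul, mul_comm]
        gcongr
        exact PiLp.norm_apply_le x j
    _ = _ := (Finset.sum_mul _ _ _).symm

lemma fderivSnd_field_apply {a : Fin n → ℝ × X n → ℂ} (sa : ∀ j, ContDiff ℝ ∞ (a j))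
    (z : ℝ × X n) (v : X n) :
    fderivSnd (field a) z v = ∑ j, coordL j (fderiv ℝ (a j) z (0, v)) := by
  have h : HasFDerivAt (field a) (∑ j, (coordL j).comp (fderiv ℝ (a j) z)) z :=
    HasFDerivAt.fun_sum fun j _ =>
      (coordL j).hasFDerivAt.comp z ((sa j).differentiable (by simp) z).hasFDerivAt
  simp [fderivSnd, h.fderiv]

lemma LogOrd.fderivSnd_field (hS : IsScale S) {a : Eps → Fin n → ℝ × X n → ℂ}
    (sa : ∀ ε j, ContDiff ℝ ∞ (a ε j))
    (h : ∀ j k, LogOrd S fun ε z => fderiv ℝ (a ε j) z (0, EuclideanSpace.single k 1)) :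
    LogOrd S fun ε => fderivSnd (field (a ε)) := by
  have h1 : LogOrd S fun ε z => ∑ k : Fin n, ∑ j : Fin n,
      ‖fderiv ℝ (a ε j) z (0, EuclideanSpace.single k 1)‖ :=
    LogOrd.sum hS _ fun k _ => LogOrd.sum hS _ fun j _ => (h j k).mono fun ε z => by simp
  refine h1.mono fun ε z => ?_
  rw [Real.norm_of_nonneg (by positivity)]
  refine (norm_le_sum_single _).trans (Finset.sum_le_sum fun k _ => ?_)
  rw [fderivSnd_field_apply (sa ε)]
  refine (norm_sum_le _ _).trans (Finset.sum_le_sum fun j _ => ?_)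
  simp only [coordL, ContinuousLinearMap.smulRight_apply, norm_smul]
  simpa using Complex.abs_re_le_norm _

/-- Recasts the principal part of the equation as a derivative along the characteristic direction.
-/
lemma fderiv_apply_field (u : ℝ × X n → ℂ) (z : ℝ × X n) (v : X n) :
    fderiv ℝ u z (1, -v) = fderiv ℝ u z (1, 0) -
      ∑ j, (v j : ℂ) * fderiv ℝ u z (0, EuclideanSpace.single j 1) := by
  have e : ((1 : ℝ), -v) = (1, 0) - ContinuousLinearMap.inr ℝ ℝ (X n) v := by simp
  rw [e, map_sub]
  congr 1
  conv_lhs => rw [eq_sum_single v]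
  simp only [map_sum, map_smul, ContinuousLinearMap.inr_apply, Complex.real_smul]

end Field

/-! ### Solution of the transport equation by characteristics -/

section Characteristics

variable {E : Type} [NormedAddCommGroup E] [NormedSpace ℝ E] [FiniteDimensional ℝ E]

/-- `exp (i ∫₀ᵗ α(τ, γ(y, 0, τ)) dτ)`. -/
noncomputable def factor (γ : E × ℝ × ℝ → E) (α : ℝ × E → ℂ) (z : ℝ × E) : ℂ :=
  Complex.exp (prim (fun z => Complex.I * α (forward γ z)) z)

/-- The factor transported to the end point of the characteristic. -/
noncomputable def symbol (γ : E × ℝ × ℝ → E) (α : ℝ × E → ℂ) (z : ℝ × E) : ℂ :=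
  factor γ α (backward γ z)

/-- `v(y) + i ∫₀ᵗ φ(τ, γ(y, 0, τ)) / factor(τ, y) dτ`. -/
noncomputable def amplitude (γ : E × ℝ × ℝ → E) (α φ : ℝ × E → ℂ) (v : E → ℂ) (z : ℝ × E) : ℂ :=
  v z.2 + Complex.I * prim (fun z => factor γ (fun z => -α z) z * φ (forward γ z)) z

/-- The solution of `D_t u = ∑ⱼ aⱼ D_j u + α u + φ` with initial value `v`. -/
noncomputable def solution (γ : E × ℝ × ℝ → E) (α φ : ℝ × E → ℂ) (v : E → ℂ) (z : ℝ × E) : ℂ :=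
  symbol γ α z * amplitude γ α φ v (backward γ z)

variable {a : ℝ × E → E} {γ : E × ℝ × ℝ → E} {α φ : ℝ × E → ℂ} {v : E → ℂ}

lemma contDiff_exponent (sγ : ContDiff ℝ ∞ γ) (sα : ContDiff ℝ ∞ α) :
    ContDiff ℝ ∞ fun z => Complex.I * α (forward γ z) :=
  contDiff_const.mul (sα.comp (contDiff_forward sγ))

lemma contDiff_factor (sγ : ContDiff ℝ ∞ γ) (sα : ContDiff ℝ ∞ α) : ContDiff ℝ ∞ (factor γ α) :=
  contDiff_exp_prim (contDiff_exponent sγ sα)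

lemma contDiff_symbol (sγ : ContDiff ℝ ∞ γ) (sα : ContDiff ℝ ∞ α) : ContDiff ℝ ∞ (symbol γ α) :=
  (contDiff_factor sγ sα).comp (contDiff_backward sγ)

lemma contDiff_quotient (sγ : ContDiff ℝ ∞ γ) (sα : ContDiff ℝ ∞ α) (sφ : ContDiff ℝ ∞ φ) :
    ContDiff ℝ ∞ fun z => factor γ (fun z => -α z) z * φ (forward γ z) :=
  (contDiff_factor sγ sα.neg).mul (sφ.comp (contDiff_forward sγ))

lemma contDiff_amplitude (sγ : ContDiff ℝ ∞ γ) (sα : ContDiff ℝ ∞ α) (sφ : ContDiff ℝ ∞ φ)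
    (sv : ContDiff ℝ ∞ v) : ContDiff ℝ ∞ (amplitude γ α φ v) :=
  (sv.comp contDiff_snd).add (contDiff_const.mul (contDiff_prim (contDiff_quotient sγ sα sφ)))

lemma contDiff_solution (sγ : ContDiff ℝ ∞ γ) (sα : ContDiff ℝ ∞ α) (sφ : ContDiff ℝ ∞ φ)
    (sv : ContDiff ℝ ∞ v) : ContDiff ℝ ∞ (solution γ α φ v) :=
  (contDiff_symbol sγ sα).mul ((contDiff_amplitude sγ sα sφ sv).comp (contDiff_backward sγ))

/-- The reciprocal of the exponential is the exponential with `-α`, which obeys the same bounds. No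
lower bound is needed to invert `b` along the flow. -/
lemma factor_mul_factor_neg (z : ℝ × E) : factor γ α z * factor γ (fun z => -α z) z = 1 := by
  have h : prim (fun z => Complex.I * -α (forward γ z)) z =
      -prim (fun z => Complex.I * α (forward γ z)) z := by
    simp [prim]
  rw [factor, factor, h, ← Complex.exp_add, add_neg_cancel, Complex.exp_zero]

lemma factor_zero (y : E) : factor γ α (0, y) = 1 := by simp [factor, prim_zero]

lemma amplitude_zero (y : E) : amplitude γ α φ v (0, y) = v y := by simp [amplitude, prim_zero]

lemma IsFlow.symbol_forward (hγ : IsFlow a γ) (sa : ContDiff ℝ ∞ a) (z : ℝ × E) :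
    symbol γ α (forward γ z) = factor γ α z := by
  rw [symbol, hγ.backward_forward sa]

lemma IsFlow.backward_zero (hγ : IsFlow a γ) (x : E) : backward γ (0, x) = (0, x) := by
  simp [backward, hγ.init]

lemma IsFlow.solution_zero (hγ : IsFlow a γ) (x : E) : solution γ α φ v (0, x) = v x := by
  rw [solution, symbol, hγ.backward_zero, factor_zero, amplitude_zero, one_mul]

/-- Variation of constants. In characteristic coordinates the solution is `factor * amplitude`,
where the time derivative of `factor` is `i α factor` and that of `amplitude` is `i φ / factor`; the
product rule gives the claim. -/
lemma IsFlow.fderiv_solution (hγ : IsFlow a γ) (sa : ContDiff ℝ ∞ a) (sα : ContDiff ℝ ∞ α)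
    (sφ : ContDiff ℝ ∞ φ) (sv : ContDiff ℝ ∞ v) (z : ℝ × E) :
    fderiv ℝ (solution γ α φ v) z (1, -a z) =
      Complex.I * α z * solution γ α φ v z + Complex.I * φ z := by
  have sγ := hγ.smooth
  have sF := contDiff_factor sγ sα
  have sA := contDiff_amplitude sγ sα sφ sv
  have h := hγ.fderiv_comp_backward sa (sF.mul sA) z
  have e : (fun z => factor γ α (backward γ z) * amplitude γ α φ v (backward γ z)) =
    solution γ α φ v := rfl
  have h1 : ∀ w, fderiv ℝ (amplitude γ α φ v) w (1, 0) =
      Complex.I * (factor γ (fun z => -α z) w * φ (forward γ w)) := fun w => by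
    have sP := contDiff_prim (contDiff_quotient sγ sα sφ)
    have hc : HasDerivAt (fun s => amplitude γ α φ v (s, w.2))
        (Complex.I * (factor γ (fun z => -α z) w * φ (forward γ w))) w.1 := by
      have hp := (sP.differentiable (by simp) w).hasFDerivAt.comp_hasDerivAt w.1
        ((hasDerivAt_id w.1).prodMk (hasDerivAt_const w.1 w.2))
      rw [fderiv_prim (contDiff_quotient sγ sα sφ)] at hp
      exact (hp.const_mul Complex.I).const_add (v w.2)
    exact fderiv_apply_one_zero sA hc
  have h2 : ∀ w, fderiv ℝ (factor γ α) w (1, 0) =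
      Complex.I * α (forward γ w) * factor γ α w :=
    fun w => fderiv_exp_prim (contDiff_exponent sγ sα) w
  rw [e, fderiv_fun_mul (sF.differentiable (by simp) _) (sA.differentiable (by simp) _)] at h
  rw [h]
  simp only [_root_.add_apply, _root_.smul_apply, h1, h2, smul_eq_mul, hγ.forward_backward sa]
  have := factor_mul_factor_neg (γ := γ) (α := α) (backward γ z)
  rw [solution, symbol]
  linear_combination Complex.I * φ z * this

lemma IsFlow.eq_self_of_notMem (hγ : IsFlow a γ) (sa : ContDiff ℝ ∞ a) {K : Set E}
    (hsupp : ∀ t, ∀ x ∉ K, a (t, x) = 0) {x : E} (hx : x ∉ K) (t s : ℝ) : γ (x, t, s) = x :=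
  (hγ.eq_of_hasDerivAt sa (c := fun _ => x)
    (fun r => by rw [hsupp r x hx, neg_zero]; exact hasDerivAt_const _ _) t s).symm

/-- Characteristics starting outside `K` stand still, so along them neither `φ` nor `v` is ever met.
Here `K` contains the supports of the field, of `φ` and of `v`. -/
lemma IsFlow.amplitude_eq_zero (hγ : IsFlow a γ) (sa : ContDiff ℝ ∞ a) {K : Set E}
    (hsupp : ∀ t, ∀ x ∉ K, a (t, x) = 0) (hφ : ∀ t, ∀ x ∉ K, φ (t, x) = 0)
    (hv : ∀ x ∉ K, v x = 0) (t : ℝ) {x : E} (hx : x ∉ K) : amplitude γ α φ v (t, x) = 0 := by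
  simp [amplitude, prim, forward, hγ.eq_self_of_notMem sa hsupp hx, hφ _ x hx, hv x hx]

/-! ### Bounds for the factor, the symbol, the amplitude and the solution -/

section Growth

variable {S : Set (Eps → ℝ)} {k : ℕ} {γ : Eps → E × ℝ × ℝ → E} {α φ : Eps → ℝ × E → ℂ}
  {v : Eps → E → ℂ}

lemma ScaleOrd.mul (hS : IsScale S) {E : Type} [NormedAddCommGroup E] [NormedSpace ℝ E]
    {u w : Eps → E → ℂ} (su : ∀ ε, ContDiff ℝ ∞ (u ε)) (sw : ∀ ε, ContDiff ℝ ∞ (w ε))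
    (hu : ScaleOrd S k u) (hw : ScaleOrd S k w) : ScaleOrd S k fun ε z => u ε z * w ε z :=
  (hu.bilin hS hS.isScaleModule mulL su sw hw :)

lemma ScaleOrd.factor (hS : IsScale S) (sγ : ∀ ε, ContDiff ℝ ∞ (γ ε)) (hγ : ScaleOrd S k γ)
    (cγ : CBounded γ) (sα : ∀ ε, ContDiff ℝ ∞ (α ε)) (hα : ScaleOrd S k α) (hlog : LogOrd S α) :
    ScaleOrd S k fun ε => factor (γ ε) (α ε) := by
  have sF := fun ε => contDiff_forward (sγ ε)
  have h1 := (hα.comp hS hS.isScaleModule sα sF (hγ.forward hS sγ) cγ.forward :)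
  have l1 := (hlog.comp cγ.forward :)
  exact ScaleOrd.exp_prim hS (fun ε => contDiff_exponent (sγ ε) (sα ε))
    (h1.clm hS hS.isScaleModule (mulL Complex.I) fun ε => (sα ε).comp (sF ε) :)
    (l1.mono fun ε z => by simp)

lemma ScaleOrd.symbol (hS : IsScale S) (sγ : ∀ ε, ContDiff ℝ ∞ (γ ε)) (hγ : ScaleOrd S k γ)
    (cγ : CBounded γ) (sα : ∀ ε, ContDiff ℝ ∞ (α ε)) (hα : ScaleOrd S k α) (hlog : LogOrd S α) :
    ScaleOrd S k fun ε => symbol (γ ε) (α ε) :=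
  ((ScaleOrd.factor hS sγ hγ cγ sα hα hlog).comp hS hS.isScaleModule
    (fun ε => contDiff_factor (sγ ε) (sα ε)) (fun ε => contDiff_backward (sγ ε))
    (hγ.backward hS sγ) cγ.backward :)

lemma ScaleOrd.amplitude (hS : IsScale S) (sγ : ∀ ε, ContDiff ℝ ∞ (γ ε)) (hγ : ScaleOrd S k γ)
    (cγ : CBounded γ) (sα : ∀ ε, ContDiff ℝ ∞ (α ε)) (hα : ScaleOrd S k α) (hlog : LogOrd S α)
    (sφ : ∀ ε, ContDiff ℝ ∞ (φ ε)) (hφ : ScaleOrd S k φ) (sv : ∀ ε, ContDiff ℝ ∞ (v ε))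
    (hv : ScaleOrd S k v) : ScaleOrd S k fun ε => amplitude (γ ε) (α ε) (φ ε) (v ε) := by
  have sF := fun ε => contDiff_forward (sγ ε)
  have h1 := (hφ.comp hS hS.isScaleModule sφ sF (hγ.forward hS sγ) cγ.forward :)
  have h2 := ScaleOrd.factor (α := fun ε z => -α ε z) hS sγ hγ cγ (fun ε => (sα ε).neg) hα.neg
    (hlog.mono fun ε z => by simp)
  have h3 := ScaleOrd.mul hS (fun ε => contDiff_factor (sγ ε) (sα ε).neg)
    (fun ε => (sφ ε).comp (sF ε)) h2 h1
  have sq := fun ε => contDiff_quotient (sγ ε) (sα ε) (sφ ε)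
  have sP := fun ε => contDiff_prim (sq ε)
  have h4 := ScaleOrd.prim hS hS.isScaleModule sq h3
  have h5 := hv.comp_const (E := ℝ × E) hS hS.isScaleModule sv contDiff_snd
  exact ScaleOrd.add hS.isScaleModule (fun ε => (sv ε).comp contDiff_snd)
    (fun ε => contDiff_const.mul (sP ε)) h5
    (h4.clm hS hS.isScaleModule (mulL Complex.I) sP :)

lemma ScaleOrd.solution (hS : IsScale S) (sγ : ∀ ε, ContDiff ℝ ∞ (γ ε)) (hγ : ScaleOrd S k γ)
    (cγ : CBounded γ) (sα : ∀ ε, ContDiff ℝ ∞ (α ε)) (hα : ScaleOrd S k α) (hlog : LogOrd S α)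
    (sφ : ∀ ε, ContDiff ℝ ∞ (φ ε)) (hφ : ScaleOrd S k φ) (sv : ∀ ε, ContDiff ℝ ∞ (v ε))
    (hv : ScaleOrd S k v) : ScaleOrd S k fun ε => solution (γ ε) (α ε) (φ ε) (v ε) := by
  have sA := fun ε => contDiff_amplitude (sγ ε) (sα ε) (sφ ε) (sv ε)
  have sB := fun ε => contDiff_backward (sγ ε)
  have h := ScaleOrd.amplitude hS sγ hγ cγ sα hα hlog sφ hφ sv hv
  have h1 := (h.comp hS hS.isScaleModule sA sB (hγ.backward hS sγ) cγ.backward :)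
  exact ScaleOrd.mul hS (fun ε => contDiff_symbol (sγ ε) (sα ε)) (fun ε => (sA ε).comp (sB ε))
    (ScaleOrd.symbol hS sγ hγ cγ sα hα hlog) h1

end Growth

end Characteristics

/-! ### The Cauchy problem on representatives -/

section OnRepresentatives

variable {n : ℕ}

/-- Representatives of the principal coefficients that are real and vanish for `x ∉ K`. -/
structure FieldRep (a1 : Fin n → Gen (ℝ × X n)) (a : Eps → Fin n → ℝ × X n → ℂ)
    (K : Set (X n)) : Prop where
  rep : ∀ j, IsRep (fun ε => a ε j) (a1 j)
  real : ∀ ε j z, (a ε j z).im = 0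
  compact : IsCompact K
  supp : ∀ ε j t, ∀ x ∉ K, a ε j (t, x) = 0

/-- Multiplying real representatives by real cutoffs preserves their values' reality; finitely many
components leave the union of the supports compact. -/
lemma exists_fieldRep {a1 : Fin n → Gen (ℝ × X n)}
    (h : ∀ j, (a1 j).RealValued ∧ CompactlySupportedInX (a1 j)) : ∃ a K, FieldRep a1 a K := by
  choose u hu hreal using fun j => (h j).1
  choose χ _ hrep L hL hχ using fun j => (h j).2.exists_cutoff
  refine ⟨fun ε j z => (χ j z.2 : ℂ) * u j ε z, ⋃ j, L j, fun j => hrep j (u j) (hu j),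
    fun ε j z => by simp [hreal], isCompact_iUnion hL, fun ε j t x hx => ?_⟩
  simp [hχ j x fun h => hx (mem_iUnion.2 ⟨j, h⟩)]

variable {a1 : Fin n → Gen (ℝ × X n)} {a : Eps → Fin n → ℝ × X n → ℂ} {K : Set (X n)}

lemma FieldRep.contDiff (hr : FieldRep a1 a K) (ε : Eps) : ContDiff ℝ ∞ (field (a ε)) :=
  contDiff_field fun j => (hr.rep j).smooth ε

lemma FieldRep.scaleOrd (hr : FieldRep a1 a K) (k : ℕ) :
    ScaleOrd modScale k fun ε => field (a ε) :=
  ScaleOrd.field isScale_modScale (fun ε j => (hr.rep j).smooth ε) fun j => (hr.rep j).scaleOrd k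

lemma FieldRep.field_eq_zero (hr : FieldRep a1 a K) (ε : Eps) (t : ℝ) (x : X n) (hx : x ∉ K) :
    field (a ε) (t, x) = 0 := by
  simp [field, hr.supp ε _ t x hx]

lemma FieldRep.ofReal_field (hr : FieldRep a1 a K) (ε : Eps) (z : ℝ × X n) (h : Fin n) :
    (field (a ε) z h : ℂ) = a ε h z := by
  rw [field_apply]
  exact Complex.ext (by simp) (by simp [hr.real])

/-- `x ↦ x_h` as a complex valued map. -/
noncomputable def compL (h : Fin n) : X n →L[ℝ] ℂ :=
  Complex.ofRealCLM.comp (EuclideanSpace.proj h)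

lemma compL_apply (h : Fin n) (x : X n) : compL h x = (x h : ℂ) := rfl

lemma negOn_iff_compL {E : Type} [NormedAddCommGroup E] [NormedSpace ℝ E] {r : Eps → E → X n}
    (sr : ∀ ε, ContDiff ℝ ∞ (r ε)) :
    NegOn r univ ↔ ∀ h, NegOn (fun ε z => compL h (r ε z)) univ := by
  refine ⟨fun hr h => hr.clm (compL h) sr, fun H => ?_⟩
  have e : r = fun ε z => ∑ h, coordL h (compL h (r ε z)) := by
    funext ε z
    conv_lhs => rw [eq_sum_single (r ε z)]
    simp [coordL, compL_apply]
  rw [e, negOn_iff_scaleOrd]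
  intro k
  have sc := fun h ε => (compL h).contDiff.comp (sr ε)
  exact ScaleOrd.sum isScaleModule_negScale _ (fun h ε => (coordL h).contDiff.comp (sc h ε))
    fun h _ => (negOn_iff_scaleOrd.1 (H h) k).clm isScale_modScale isScaleModule_negScale
      (coordL h) (sc h)

/-- Translates equality of classes into negligible residuals. The real vector field may replace the
complex coefficients because the chosen representatives are real. -/
lemma isCharacteristic_iff (hr : FieldRep a1 a K) (G : MapNet (X n × ℝ × ℝ) (X n)) :
    IsCharacteristic a1 (Quotient.mk _ G) ↔
      NegOn (fun ε z => fderiv ℝ (G.net ε) z (0, 0, 1) + field (a ε) (z.2.2, G.net ε z)) univ ∧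
      NegOn (fun ε (p : X n × ℝ) => G.net ε (p.1, p.2, p.2) - p.1) univ := by
  refine and_congr ?_ Quotient.eq
  rw [negOn_iff_compL fun ε => contDiff_flowResidual (hr.contDiff ε) (G.smooth ε)]
  refine forall_congr' fun h => ?_
  have r1 := ((isRep_ofSmooth (coord_contDiff h)).comp G).pderiv ((0 : X n), (0 : ℝ), (1 : ℝ))
  have r2 := ((hr.rep h).comp ((MapNet.const (fun z : X n × ℝ × ℝ => z.2.2)
    (by fun_prop)).prod G)).neg
  refine (r1.eq_iff r2).trans (iff_of_eq ?_)
  congr 1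
  funext ε z
  have hd : HasFDerivAt (fun z => ((G.net ε z h : ℝ) : ℂ))
      ((compL h).comp (fderiv ℝ (G.net ε) z)) z :=
    (compL h).hasFDerivAt.comp z ((G.smooth ε).differentiable (by simp) z).hasFDerivAt
  rw [hd.fderiv, map_add, compL_apply h (field _ _), hr.ofReal_field, sub_neg_eq_add]
  rfl

variable {a0 f : Gen (ℝ × X n)} {u0 : Gen (X n)} {α φ u : Eps → ℝ × X n → ℂ} {v : Eps → X n → ℂ}
  {U : Gen (ℝ × X n)}

lemma isSolution_iff (hr : FieldRep a1 a K) (hα : IsRep α a0) (hφ : IsRep φ f) (hv : IsRep v u0)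
    (hu : IsRep u U) : IsSolution a1 a0 f u0 U ↔
      NegOn (fun ε z => fderiv ℝ (u ε) z (1, -field (a ε) z) -
        (Complex.I * α ε z * u ε z + Complex.I * φ ε z)) univ ∧
      NegOn (fun ε x => u ε (0, x) - v ε x) univ := by
  refine and_congr ?_ ((hu.comp_ofSmooth (f := fun x : X n => ((0 : ℝ), x)) _).eq_iff hv)
  have r1 := (hu.pderiv ((1 : ℝ), (0 : X n))).smul (-Complex.I)
  have r2 := ((IsRep.sum Finset.univ fun j => (hr.rep j).mul
    ((hu.pderiv ((0 : ℝ), EuclideanSpace.single j (1 : ℝ))).smul (-Complex.I))).add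
    (hα.mul hu)).add hφ
  have sres : ∀ ε, ContDiff ℝ ∞ fun z => fderiv ℝ (u ε) z (1, -field (a ε) z) -
      (Complex.I * α ε z * u ε z + Complex.I * φ ε z) := fun ε =>
    ((contDiff_fderiv (hu.smooth ε)).clm_apply (contDiff_const.prodMk (hr.contDiff ε).neg)).sub
      (((contDiff_const.mul (hα.smooth ε)).mul (hu.smooth ε)).add
        (contDiff_const.mul (hφ.smooth ε)))
  -- The residual of the equation written with `D = -i∂` is `-i` times the residual of the transport
  -- equation. Multiplication by `±i` preserves negligibility, which gives both directions.
  have e : ∀ ε z, -Complex.I * fderiv ℝ (u ε) z (1, 0) - (∑ j, a ε j z * (-Complex.I *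
      fderiv ℝ (u ε) z (0, EuclideanSpace.single j 1)) + α ε z * u ε z + φ ε z) =
      mulL (-Complex.I) (fderiv ℝ (u ε) z (1, -field (a ε) z) -
        (Complex.I * α ε z * u ε z + Complex.I * φ ε z)) := fun ε z => by
    rw [fderiv_apply_field, mulL_apply]
    simp only [hr.ofReal_field]
    rw [show ∑ j, a ε j z * (-Complex.I * fderiv ℝ (u ε) z (0, EuclideanSpace.single j 1)) =
      -Complex.I * ∑ j, a ε j z * fderiv ℝ (u ε) z (0, EuclideanSpace.single j 1) by
        rw [Finset.mul_sum]; exact Finset.sum_congr rfl fun j _ => by ring]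
    linear_combination (-α ε z * u ε z - φ ε z) * Complex.I_mul_I
  refine (r1.eq_iff r2).trans ?_
  simp only [e]
  refine ⟨fun h => ?_, fun h => h.clm _ sres⟩
  have := h.clm (mulL Complex.I) fun ε => (mulL (-Complex.I)).contDiff.comp (sres ε)
  simpa [mulL_apply, ← mul_assoc] using this

end OnRepresentatives

/-! ### The solution formula -/

section Formula

variable {n : ℕ} {a1 : Fin n → Gen (ℝ × X n)} {a : Eps → Fin n → ℝ × X n → ℂ} {K : Set (X n)}
  {γ : Eps → X n × ℝ × ℝ → X n}

lemma FieldRep.exists_isFlow (hr : FieldRep a1 a K) :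
    ∃ γ : Eps → X n × ℝ × ℝ → X n, ∀ ε, IsFlow (field (a ε)) (γ ε) := by
  choose γ hγ using fun ε =>
    Colombeau.exists_isFlow (hr.contDiff ε) hr.compact (hr.field_eq_zero ε)
  exact ⟨γ, hγ⟩

lemma FieldRep.cBounded (hr : FieldRep a1 a K) (hγ : ∀ ε, IsFlow (field (a ε)) (γ ε)) :
    CBounded γ := IsFlow.cBounded hγ hr.contDiff hr.compact hr.field_eq_zero

lemma FieldRep.scaleOrd_flow (hr : FieldRep a1 a K) (hγ : ∀ ε, IsFlow (field (a ε)) (γ ε))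
    (hlog : LogOrd modScale fun ε => fderivSnd (field (a ε))) (k : ℕ) : ScaleOrd modScale k γ :=
  IsFlow.scaleOrd isScale_modScale hγ hr.contDiff (hr.cBounded hγ) hr.scaleOrd hlog k

/-- The characteristic flow as a net of maps. -/
def FieldRep.flowNet (hr : FieldRep a1 a K) (hγ : ∀ ε, IsFlow (field (a ε)) (γ ε))
    (hlog : LogOrd modScale fun ε => fderivSnd (field (a ε))) : MapNet (X n × ℝ × ℝ) (X n) where
  net := γ
  smooth ε := (hγ ε).smooth
  moderate := modOn_iff_scaleOrd.2 (hr.scaleOrd_flow hγ hlog)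
  cBounded := hr.cBounded hγ

lemma FieldRep.isCharacteristic_flowNet (hr : FieldRep a1 a K)
    (hγ : ∀ ε, IsFlow (field (a ε)) (γ ε))
    (hlog : LogOrd modScale fun ε => fderivSnd (field (a ε))) :
    IsCharacteristic a1 (Quotient.mk _ (hr.flowNet hγ hlog)) := by
  refine (isCharacteristic_iff hr _).2 ⟨?_, ?_⟩
  · simp only [FieldRep.flowNet, (hγ _).fderiv_apply, neg_add_cancel]
    exact negOn_zero univ
  · simp only [FieldRep.flowNet, (hγ _).init, sub_self]
    exact negOn_zero univ

lemma IsCharacteristic.unique (hr : FieldRep a1 a K)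
    (hlog : LogOrd modScale fun ε => fderivSnd (field (a ε)))
    {Γ Γ' : GMap (X n × ℝ × ℝ) (X n)} (h : IsCharacteristic a1 Γ) (h' : IsCharacteristic a1 Γ') :
    Γ = Γ' := by
  induction Γ using Quotient.ind with | _ G
  induction Γ' using Quotient.ind with | _ G'
  obtain ⟨h1, h2⟩ := (isCharacteristic_iff hr G).1 h
  obtain ⟨h1', h2'⟩ := (isCharacteristic_iff hr G').1 h'
  refine Quotient.sound (negOn_sub_of_flow hr.contDiff (modOn_iff_scaleOrd.2 hr.scaleOrd) hlog
    G.smooth G'.smooth G.moderate G'.moderate G.cBounded G'.cBounded h1 h1' ?_)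
  have c : ContDiff ℝ ∞ fun p : X n × ℝ => (p.1, p.2, p.2) := by fun_prop
  have := NegOn.sub (fun ε => ((G.smooth ε).comp c).sub contDiff_fst)
    (fun ε => ((G'.smooth ε).comp c).sub contDiff_fst) h2 h2'
  simpa using this

variable {a0 f : Gen (ℝ × X n)} {u0 : Gen (X n)} {α φ : Eps → ℝ × X n → ℂ} {v : Eps → X n → ℂ}

/-- The source and the initial value cancel in the difference, leaving the homogeneous transport
equation with coefficient `i a₀` up to negligible errors. -/
lemma IsSolution.unique (hr : FieldRep a1 a K) (hγ : ∀ ε, IsFlow (field (a ε)) (γ ε))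
    (hlog : LogOrd modScale fun ε => fderivSnd (field (a ε))) (hα : IsRep α a0)
    (hlogα : LogOrd modScale α) {U U' : Gen (ℝ × X n)} (h : IsSolution a1 a0 f u0 U)
    (h' : IsSolution a1 a0 f u0 U') : U = U' := by
  obtain ⟨u, hu⟩ := exists_isRep U
  obtain ⟨u', hu'⟩ := exists_isRep U'
  obtain ⟨φ, hφ⟩ := exists_isRep f
  obtain ⟨v, hv⟩ := exists_isRep u0
  obtain ⟨h1, h2⟩ := (isSolution_iff hr hα hφ hv hu).1 h
  obtain ⟨h1', h2'⟩ := (isSolution_iff hr hα hφ hv hu').1 h'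
  have sres : ∀ {u : Eps → ℝ × X n → ℂ}, (∀ ε, ContDiff ℝ ∞ (u ε)) → ∀ ε, ContDiff ℝ ∞ fun z =>
      fderiv ℝ (u ε) z (1, -field (a ε) z) - (Complex.I * α ε z * u ε z + Complex.I * φ ε z) :=
    fun su ε => ((contDiff_fderiv (su ε)).clm_apply
      (contDiff_const.prodMk (hr.contDiff ε).neg)).sub
      (((contDiff_const.mul (hα.smooth ε)).mul (su ε)).add (contDiff_const.mul (hφ.smooth ε)))
  have c : ContDiff ℝ ∞ fun x : X n => ((0 : ℝ), x) := by fun_prop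
  have d1 := NegOn.sub (sres hu.smooth) (sres hu'.smooth) h1 h1'
  have d2 := NegOn.sub (fun ε => ((hu.smooth ε).comp c).sub (hv.smooth ε))
    (fun ε => ((hu'.smooth ε).comp c).sub (hv.smooth ε)) h2 h2'
  refine (hu.eq_iff hu').2 (negOn_of_transport hγ hr.contDiff (hr.cBounded hγ)
    (modOn_iff_scaleOrd.2 (hr.scaleOrd_flow hγ hlog))
    (α := fun ε z => Complex.I * α ε z) (fun ε => (hu.smooth ε).sub (hu'.smooth ε))
    (fun ε => contDiff_const.mul (hα.smooth ε))
    ((isRep_ofSmooth contDiff_const).mul hα).modOn (hlogα.mono fun ε z => by simp) ?_ ?_)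
  · convert d1 using 3 with ε z
    rw [fderiv_fun_sub ((hu.smooth ε).differentiable (by simp) z)
      ((hu'.smooth ε).differentiable (by simp) z), _root_.sub_apply]
    ring
  · simpa using d2

/-- Standing assumptions on representatives of the data of the Cauchy problem. -/
structure CauchyRep (a1 : Fin n → Gen (ℝ × X n)) (a0 f : Gen (ℝ × X n)) (u0 : Gen (X n))
    (a : Eps → Fin n → ℝ × X n → ℂ) (K : Set (X n)) (γ : Eps → X n × ℝ × ℝ → X n)
    (α φ : Eps → ℝ × X n → ℂ) (v : Eps → X n → ℂ) : Prop where
  field : FieldRep a1 a K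
  flow : ∀ ε, IsFlow (Colombeau.field (a ε)) (γ ε)
  log : LogOrd modScale fun ε => fderivSnd (Colombeau.field (a ε))
  rep : IsRep α a0
  logα : LogOrd modScale α
  source : IsRep φ f
  initial : IsRep v u0

lemma CauchyRep.isRep_solution (h : CauchyRep a1 a0 f u0 a K γ α φ v) :
    ∃ U, IsRep (fun ε => solution (γ ε) (α ε) (φ ε) (v ε)) U := by
  refine ⟨_, isRep_mk (fun ε => contDiff_solution (h.flow ε).smooth (h.rep.smooth ε)
    (h.source.smooth ε) (h.initial.smooth ε)) (modOn_iff_scaleOrd.2 fun k => ?_)⟩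
  exact ScaleOrd.solution isScale_modScale (fun ε => (h.flow ε).smooth)
    (h.field.scaleOrd_flow h.flow h.log k) (h.field.cBounded h.flow) h.rep.smooth
    (h.rep.scaleOrd k) h.logα h.source.smooth (h.source.scaleOrd k) h.initial.smooth
    (h.initial.scaleOrd k)

lemma CauchyRep.isSolution (h : CauchyRep a1 a0 f u0 a K γ α φ v) {U : Gen (ℝ × X n)}
    (hU : IsRep (fun ε => solution (γ ε) (α ε) (φ ε) (v ε)) U) : IsSolution a1 a0 f u0 U := by
  refine (isSolution_iff h.field h.rep h.source h.initial hU).2 ⟨?_, ?_⟩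
  · simp only [(h.flow _).fderiv_solution (h.field.contDiff _) (h.rep.smooth _)
      (h.source.smooth _) (h.initial.smooth _), sub_self]
    exact negOn_zero univ
  · simp only [(h.flow _).solution_zero, sub_self]
    exact negOn_zero univ

lemma CauchyRep.existsUnique (h : CauchyRep a1 a0 f u0 a K γ α φ v) :
    ∃! U, IsSolution a1 a0 f u0 U := by
  obtain ⟨U, hU⟩ := h.isRep_solution
  exact ⟨U, h.isSolution hU, fun U' hU' =>
    hU'.unique h.field h.flow h.log h.rep h.logα (h.isSolution hU)⟩

/-- Uniqueness lets the explicit formula represent an arbitrary solution. -/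
lemma CauchyRep.isRep_of_isSolution (h : CauchyRep a1 a0 f u0 a K γ α φ v) {U : Gen (ℝ × X n)}
    (hU : IsSolution a1 a0 f u0 U) : IsRep (fun ε => solution (γ ε) (α ε) (φ ε) (v ε)) U := by
  obtain ⟨U', hU'⟩ := h.isRep_solution
  rw [hU.unique h.field h.flow h.log h.rep h.logα (h.isSolution hU')]
  exact hU'

lemma CauchyRep.homogeneous (h : CauchyRep a1 a0 f u0 a K γ α φ v) :
    CauchyRep a1 a0 0 1 a K γ α (fun _ _ => 0) fun _ _ => 1 :=
  { h with source := isRep_zero, initial := isRep_one }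

lemma solution_zero_one {E : Type} [NormedAddCommGroup E] [NormedSpace ℝ E]
    [FiniteDimensional ℝ E] (γ : E × ℝ × ℝ → E) (α : ℝ × E → ℂ) :
    solution γ α (fun _ => 0) (fun _ => 1) = symbol γ α := by
  funext z
  simp [solution, amplitude, prim]

lemma CauchyRep.isRep_symbol (h : CauchyRep a1 a0 f u0 a K γ α φ v) {b : Gen (ℝ × X n)}
    (hb : IsSolution a1 a0 0 1 b) : IsRep (fun ε => symbol (γ ε) (α ε)) b := by
  simpa only [solution_zero_one] using h.homogeneous.isRep_of_isSolution hb

lemma CauchyRep.eq_flow (h : CauchyRep a1 a0 f u0 a K γ α φ v) {Γ : GMap (X n × ℝ × ℝ) (X n)}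
    (hΓ : IsCharacteristic a1 Γ) : Γ = Quotient.mk _ (h.field.flowNet h.flow h.log) :=
  hΓ.unique h.field h.log (h.field.isCharacteristic_flowNet h.flow h.log)

lemma CauchyRep.isRep_comp_flowOut (h : CauchyRep a1 a0 f u0 a K γ α φ v)
    {u : Eps → ℝ × X n → ℂ} {w : Gen (ℝ × X n)} (hu : IsRep u w) :
    IsRep (fun ε z => u ε (forward (γ ε) z))
      (w.comp (flowOut (Quotient.mk _ (h.field.flowNet h.flow h.log)))) :=
  hu.comp ((MapNet.const (fun z : ℝ × X n => z.1) (by fun_prop)).prod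
    ((h.field.flowNet h.flow h.log).comp
      (MapNet.const (fun z : ℝ × X n => (z.2, (0 : ℝ), z.1)) (by fun_prop))))

/-- Following a characteristic forward cancels the backward map in `symbol`, so `b(τ, γ(y, 0, τ))`
is a pure exponential. -/
lemma CauchyRep.isRep_factor (h : CauchyRep a1 a0 f u0 a K γ α φ v) {b : Gen (ℝ × X n)}
    (hb : IsRep (fun ε => symbol (γ ε) (α ε)) b) :
    IsRep (fun ε => factor (γ ε) (α ε))
      (b.comp (flowOut (Quotient.mk _ (h.field.flowNet h.flow h.log)))) := by
  simpa only [(h.flow _).symbol_forward (h.field.contDiff _)] using h.isRep_comp_flowOut hb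

lemma CauchyRep.exists_inverse (h : CauchyRep a1 a0 f u0 a K γ α φ v) {B : Gen (ℝ × X n)}
    (hB : IsRep (fun ε => factor (γ ε) (α ε)) B) :
    ∃ B', IsRep (fun ε => factor (γ ε) fun z => -α ε z) B' ∧ B * B' = 1 := by
  have hm : ∀ k, ScaleOrd modScale k fun ε => factor (γ ε) fun z => -α ε z := fun k =>
    ScaleOrd.factor (α := fun ε z => -α ε z) isScale_modScale (fun ε => (h.flow ε).smooth)
      (h.field.scaleOrd_flow h.flow h.log k) (h.field.cBounded h.flow)
      (fun ε => (h.rep.smooth ε).neg) (h.rep.scaleOrd k).neg (h.logα.mono fun ε z => by simp)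
  have hB' := isRep_mk (fun ε => contDiff_factor (h.flow ε).smooth (h.rep.smooth ε).neg)
    (modOn_iff_scaleOrd.2 hm)
  exact ⟨_, hB', hB.mul_eq_one hB' fun ε z => factor_mul_factor_neg z⟩

lemma CauchyRep.isRep_duhamel (h : CauchyRep a1 a0 f u0 a K γ α φ v) {b : Gen (ℝ × X n)}
    (hb : IsRep (fun ε => symbol (γ ε) (α ε)) b) :
    IsRep (fun ε => amplitude (γ ε) (α ε) (φ ε) (v ε))
      (duhamel (Quotient.mk _ (h.field.flowNet h.flow h.log)) b f u0) := by
  obtain ⟨B', hB', hBB'⟩ := h.exists_inverse (h.isRep_factor hb)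
  -- `Ring.inverse` is zero on non-units; as the product with `B'` is one, here it is the true
  -- inverse.
  obtain rfl : Ring.inverse _ = B' := by
    simpa [hBB', mul_assoc] using congrArg (· * B')
      (Ring.inverse_mul_cancel _ (IsUnit.of_mul_eq_one _ hBB'))
  exact (h.initial.comp_ofSmooth (f := fun z : ℝ × X n => z.2) (by fun_prop)).add
    ((hB'.mul (h.isRep_comp_flowOut h.source)).primitive.smul Complex.I)

lemma CauchyRep.solutionFormula (h : CauchyRep a1 a0 f u0 a K γ α φ v) {L : Set (X n)}
    (hL : IsCompact L) (hφ : ∀ ε t, ∀ x ∉ L, φ ε (t, x) = 0) (hv : ∀ ε, ∀ x ∉ L, v ε x = 0) :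
    SolutionFormula a1 a0 f u0 := by
  refine ⟨⟨_, h.field.isCharacteristic_flowNet h.flow h.log, fun Γ hΓ => h.eq_flow hΓ⟩,
    h.homogeneous.existsUnique, h.existsUnique, fun Γ b U hΓ hb hU => ?_⟩
  obtain rfl := h.eq_flow hΓ
  have hb' := h.isRep_symbol hb
  have hν := h.isRep_duhamel hb'
  obtain ⟨B', -, hBB'⟩ := h.exists_inverse (h.isRep_factor hb')
  have hKL : IsCompact (K ∪ L) := h.field.compact.union hL
  have hvan : ∀ ε t, ∀ x ∉ K ∪ L, amplitude (γ ε) (α ε) (φ ε) (v ε) (t, x) = 0 :=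
    fun ε t x hx => (h.flow ε).amplitude_eq_zero (h.field.contDiff ε)
      (fun t x hx => h.field.field_eq_zero ε t x fun hK => hx (Or.inl hK))
      (fun t x hx => hφ ε t x fun hL => hx (Or.inr hL))
      (fun x hx => hv ε x fun hL => hx (Or.inr hL)) t hx
  -- The witnesses are the flow itself for the phase, `symbol` for `b` and `amplitude` for the
  -- argument, which vanishes off `K ∪ L`.
  refine ⟨IsUnit.of_mul_eq_one _ hBB', compactlySupportedInX_of_isRep hν hKL hvan,
    PhaseNet.linear ((h.field.flowNet h.flow h.log).comp
      (MapNet.const (fun z : ℝ × X n => (z.2, z.1, (0 : ℝ))) (by fun_prop))), _, _, rfl, hb', hν,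
    ⟨K ∪ L, hKL, hvan⟩, ?_⟩
  -- An equality of nets and not only of classes: Fourier inversion evaluates the amplitude at `γ(x,
  -- t, 0)`.
  have e : (fun ε => solution (γ ε) (α ε) (φ ε) (v ε)) = fun ε =>
      oscInt (fun p : (ℝ × X n) × X n => ∑ h, γ ε (p.1.2, p.1.1, 0) h * p.2 h)
        (symbol (γ ε) (α ε)) (amplitude (γ ε) (α ε) (φ ε) (v ε)) := by
    funext ε z
    exact (oscInt_linear (fun z => γ ε (z.2, z.1, 0)) _ (contDiff_amplitude (h.flow ε).smooth
      (h.rep.smooth ε) (h.source.smooth ε) (h.initial.smooth ε)) hKL (hvan ε) z).symm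
  have hU' := h.isRep_of_isSolution hU
  rw [e] at hU'
  exact hU'

/-! #### Slow scale regularity -/

/-- The phase is bilinear in the flow at time zero and `η`, hence smooth also at `η = 0`; the bounds
hold on the whole space and are then restricted to `η ≠ 0`. -/
lemma CauchyRep.slowScaleRegular_phaseOf (h : CauchyRep a1 a0 f u0 a K γ α φ v)
    (hγ : ∀ k, ScaleOrd slowScale k γ) :
    (phaseOf (Quotient.mk _ (h.field.flowNet h.flow h.log))).SlowScaleRegular := by
  refine ⟨PhaseNet.linear ((h.field.flowNet h.flow h.log).comp
    (MapNet.const (fun z : ℝ × X n => (z.2, z.1, (0 : ℝ))) (by fun_prop))), rfl, ?_⟩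
  have hS := isScale_slowScale
  have c : ContDiff ℝ ∞ fun p : (ℝ × X n) × X n => (p.1.2, p.1.1, (0 : ℝ)) := by fun_prop
  have sγ := fun ε => ((h.flow ε).smooth.comp c)
  have hs : SlowScaleOn (fun ε (p : (ℝ × X n) × X n) =>
      innerSL ℝ (γ ε (p.1.2, p.1.1, 0)) p.2) univ :=
    slowScaleOn_iff_scaleOrd.2 fun k => ScaleOrd.bilin hS hS.isScaleModule (innerSL ℝ) sγ
      (fun _ => contDiff_snd) ((hγ k).comp_const hS hS.isScaleModule (fun ε => (h.flow ε).smooth) c)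
      (scaleOrd_const hS contDiff_snd)
  have e : (fun ε (p : (ℝ × X n) × X n) => ∑ h, γ ε (p.1.2, p.1.1, 0) h * p.2 h) =
      fun ε p => innerSL ℝ (γ ε (p.1.2, p.1.1, 0)) p.2 :=
    funext fun ε => sum_eq_innerSL fun z => γ ε (z.2, z.1, 0)
  intro L _ hL k
  have := hs L (subset_univ _) hL k
  rw [← e] at this
  exact this

lemma CauchyRep.slowScaleRegular_symbol (h : CauchyRep a1 a0 f u0 a K γ α φ v)
    (hγ : ∀ k, ScaleOrd slowScale k γ) (hα : ∀ k, ScaleOrd slowScale k α)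
    (hlogα : LogOrd slowScale α) {b : Gen (ℝ × X n)}
    (hb : IsSolution a1 a0 0 1 b) : b.SlowScaleRegular :=
  ⟨_, h.isRep_symbol hb, slowScaleOn_iff_scaleOrd.2 fun k => ScaleOrd.symbol isScale_slowScale
    (fun ε => (h.flow ε).smooth) (hγ k) (h.field.cBounded h.flow) h.rep.smooth (hα k) hlogα⟩

end Formula

/-! ### The Cauchy problem -/

section Main

variable {n : ℕ} {a1 : Fin n → Gen (ℝ × X n)} {a0 f : Gen (ℝ × X n)} {u0 : Gen (X n)}

lemma FieldRep.logOrd {a : Eps → Fin n → ℝ × X n → ℂ} {K : Set (X n)} (hr : FieldRep a1 a K)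
    {S : Set (Eps → ℝ)} (hS : IsScale S)
    (h : ∀ j k, ∀ u, IsRep u (partialX k (a1 j)) → LogOrd S u) :
    LogOrd S fun ε => fderivSnd (field (a ε)) :=
  LogOrd.fderivSnd_field hS (fun ε j => (hr.rep j).smooth ε) fun j k =>
    h j k _ ((hr.rep j).pderiv _)

/-- Representatives of the data, the data of the Cauchy problem being compactly supported. -/
lemma exists_cauchyRep (hf : CompactlySupportedInX f) (hu0 : IsCompact u0.supp)
    (ha1 : ∀ j, (a1 j).RealValued ∧ CompactlySupportedInX (a1 j))
    (hlog : ∀ j k, ∀ u, IsRep u (partialX k (a1 j)) → LogOrd modScale u)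
    (hlog0 : ∀ u, IsRep u a0 → LogOrd modScale u) :
    ∃ a K γ α φ v, CauchyRep a1 a0 f u0 a K γ α φ v ∧ ∃ L, IsCompact L ∧
      (∀ ε t, ∀ x ∉ L, φ ε (t, x) = 0) ∧ ∀ ε, ∀ x ∉ L, v ε x = 0 := by
  obtain ⟨a, K, hr⟩ := exists_fieldRep ha1
  obtain ⟨γ, hγ⟩ := hr.exists_isFlow
  obtain ⟨α, hα⟩ := exists_isRep a0
  obtain ⟨φ, hφ⟩ := exists_isRep f
  obtain ⟨v, hv⟩ := exists_isRep u0
  obtain ⟨χ, _, hχ, L, hL, hχ0⟩ := hf.exists_cutoff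
  obtain ⟨ψ, _, hψ, M, hM, hψ0⟩ := exists_cutoff_of_isCompact_supp hu0
  refine ⟨a, K, γ, α, _, _, ⟨hr, hγ, hr.logOrd isScale_modScale hlog, hα, hlog0 α hα, hχ φ hφ,
    hψ v hv⟩, L ∪ M, hL.union hM, fun ε t x hx => ?_, fun ε x hx => ?_⟩
  · simp [hχ0 x fun h => hx (Or.inl h)]
  · simp [hψ0 x fun h => hx (Or.inr h)]

end Main

end Colombeau

open Colombeau

theorem mainTheorem4 (n : ℕ) (a1 : Fin n → Gen (ℝ × X n)) (a0 f : Gen (ℝ × X n)) (u0 : Gen (X n))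
    (hf : CompactlySupportedInX f) (hu0 : IsCompact u0.supp) :
    (HypH1 a1 → HypI1 a0 → SolutionFormula a1 a0 f u0) ∧
    (HypH2 a1 → HypI2 a0 → SolutionFormula a1 a0 f u0 ∧
      ∀ γ b, IsCharacteristic a1 γ → IsSolution a1 a0 0 1 b →
        (phaseOf γ).SlowScaleRegular ∧ b.SlowScaleRegular) := by
  refine ⟨fun h1 i1 => ?_, fun h2 i2 => ?_⟩
  · obtain ⟨a, K, γ, α, φ, v, h, L, hL, hφ, hv⟩ := exists_cauchyRep hf hu0
      (fun j => ⟨(h1 j).1, (h1 j).2.1⟩) (fun j k u hu => ((h1 j).2.2 k).logOrd hu)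
      fun u hu => i1.2.logOrd hu
    exact h.solutionFormula hL hφ hv
  · have hlog : ∀ j k, ∀ u, IsRep u (partialX k (a1 j)) → LogOrd slowScale u :=
      fun j k u hu => ((h2 j).2.2.2 k).logOrd hu
    have hlog0 : ∀ u, IsRep u a0 → LogOrd slowScale u := fun u hu => i2.2.2.logOrd hu
    -- Slow scale nets are moderate, so the construction of the first part applies; the same
    -- representatives are then estimated again in the slow scale.
    obtain ⟨a, K, γ, α, φ, v, h, L, hL, hφ, hv⟩ := exists_cauchyRep hf hu0
      (fun j => ⟨(h2 j).1, (h2 j).2.2.1⟩)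
      (fun j k u hu => (hlog j k u hu).mono_scale slowScale_subset_modScale)
      fun u hu => (hlog0 u hu).mono_scale slowScale_subset_modScale
    have hS := isScale_slowScale
    have ha : ∀ k, ScaleOrd slowScale k fun ε => field (a ε) := fun k =>
      ScaleOrd.field hS (fun ε j => (h.field.rep j).smooth ε)
        fun j => (h2 j).2.1.scaleOrd (h.field.rep j) k
    have hγ := IsFlow.scaleOrd hS h.flow h.field.contDiff (h.field.cBounded h.flow) ha
      (h.field.logOrd hS hlog)
    refine ⟨h.solutionFormula hL hφ hv, fun Γ b hΓ hb => ⟨?_, ?_⟩⟩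
    · rw [h.eq_flow hΓ]
      exact h.slowScaleRegular_phaseOf hγ
    · exact h.slowScaleRegular_symbol hγ (i2.1.scaleOrd h.rep) (hlog0 α h.rep) hb
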